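/- Consider the deterministic congested clique on $n\ge 2$ network nodes (in every round each node may send a message of $O(\log n)$ bits to every other node; local computation is free). Let $G$ be a graph on the $n$ nodes with palettes $\Psi(v)$, where node $v$ initially knows its neighbors and $\Psi(v)$, $|\Psi(v)|\ge d_G(v)+1$, all degrees and palette sizes are $O(\sqrt n)$, and the colors come from a set of $n^{O(1)}$ colors. Let $C$ be at least a sufficiently large absolute constant, and let $G_0$ be the subgraph of $G$ induced by the nodes $v$ with $p(v):=|\Psi(v)|\ge C$. Write $d,N$ for degree and neighborhood in $G_0$, and $N^*(v)=\{u\in N(v): d(u)\ge 3d(v)\}$. The color trial on $G_0$ with hash functions $h_1,h_2:[A]\to[M]$, where the $n$ nodes have distinct identifiers in $[A]$, $A\ge n$, $4\mid M$ and $M\ge n^3$, is the following procedure. *Nomination step:* node $v$ self-nominates if $h_1(v)$ is among the first $M/4$ values of $[M]$. Let $\mathrm{Nom}_v$ be the set of self-nominated neighbors of $v$. Node $v$ is successful in this step if $|\mathrm{Nom}_v|\le \frac14 d(v)+p(v)^{0.7}$ and $|\mathrm{Nom}_v\cap N^*(v)|\ge\frac14|N^*(v)|-p(v)^{0.7}$,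 and otherwise it fails. *Coloring step:* every self-nominated node $v$ that was successful in the nomination step picks the color of rank $\lfloor h_2(v)\,p(v)/M\rfloor$ in $\Psi(v)$ (in increasing order, hash values and ranks counted from $0$), and takes it if no neighbor picks the same color. Node $v$ is successful in this step if at least one of the following holds: $p(v)\ge 1.1\,d(v)$; $|N^*(v)|<\frac13 d(v)$; at least $0.03\,d(v)$ neighbors of $v$ failed in the nomination step; at least $0.01\,p(v)$ neighbors of $v$ take a color outside $\Psi(v)$. Otherwise it fails. Then for every $n$ there is a $101$-wise independent (with uniform values) family $\mathcal H$ of hash functions $[A]\to[M]$, with $A,M,|\mathcal H|\le n^{O(1)}$ and $A$, $M$ as above, such that for each $C$ a deterministic congested clique algorithm finds, in $O(1)$ rounds and on every such input $(G,\Psi)$, functions $h_1,h_2\in\mathcal H$, known to all nodes, for which the subgraph $F$ of $G_0$ induced by the nodes that fail in the nomination step or in the coloring step has at most $Kn$ edges. Here $K$ and the lower bound on $C$ are absolute constants. The exponent of $n^{O(1)}$ for the family, the number of rounds and the constant in the message size depend only on the constants hidden in the $O(\sqrt n)$ and $n^{O(1)}$ bounds on the input. -/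

import Mathlib

/-! ### The deterministic congested clique -/

/-- A deterministic algorithm for the congested clique on the `n` network nodes `Fin n`: in each
round every node sends to every node a message of `B` bits that depends on its own state, and then
updates its state from the messages it received.  Local computation is unrestricted. -/
structure CliqueAlgorithm (n B : ℕ) (In Out : Type) where
  State : Type
  init : Fin n → In → State
  send : Fin n → State → Fin n → (Fin B → Bool)
  receive : Fin n → State → (Fin n → Fin B → Bool) → State
  output : Fin n → State → Out

/-- The state of every node after `r` rounds. -/
def CliqueAlgorithm.stateAfter {n B : ℕ} {In Out : Type} (P : CliqueAlgorithm n B In Out)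
    (input : Fin n → In) : ℕ → Fin n → P.State
  | 0, v => P.init v (input v)
  | r + 1, v => P.receive v (P.stateAfter input r v)
      (fun u => P.send u (P.stateAfter input r u) v)

/-- The output of node `v` when the algorithm is stopped after `r` rounds. -/
def CliqueAlgorithm.outputAfter {n B : ℕ} {In Out : Type} (P : CliqueAlgorithm n B In Out)
    (input : Fin n → In) (r : ℕ) (v : Fin n) : Out :=
  P.output v (P.stateAfter input r v)

/-! ### Hash families -/

/-- `H`, a family of hash functions `[A] → [M]` indexed by `S` seeds, is `k`-wise independent:
for a uniformly random seed, the values at any at most `k` points are independent and uniform. -/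
def KWiseIndependent (k : ℕ) {S A M : ℕ} (H : Fin S → Fin A → Fin M) : Prop :=
  ∀ I : Finset (Fin A), I.card ≤ k → ∀ y : Fin A → Fin M,
    ((Finset.univ.filter fun s : Fin S => ∀ x ∈ I, H s x = y x).card : ℚ) / (S : ℚ)
      = ∏ _x ∈ I, (1 / (M : ℚ))

/-- A `k`-wise independent family `[n^{O(1)}] → [n^{O(1)}]` with seeds of `O(log n)` bits; `q` bounds
all exponents.  The domain contains the node identifiers; the range is divisible by `4`, so that
probability `1/4` is represented exactly, and large enough for choosing almost uniform colors. -/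
structure IsPolyHashFamily (k n q : ℕ) {S A M : ℕ} (H : Fin S → Fin A → Fin M) : Prop where
  le_domain : n ≤ A
  domain_le : A ≤ n ^ q
  le_range : n ^ 3 ≤ M
  range_le : M ≤ n ^ q
  four_dvd_range : 4 ∣ M
  seeds_le : S ≤ n ^ q
  indep : KWiseIndependent k H

/-- Decision "with probability `1/4`" from a hash value `y ∈ [M]`. -/
def hashNominates {M : ℕ} (y : Fin M) : Prop := 4 * (y : ℕ) < M

/-- Choice of a palette color from a hash value `y ∈ [M]`: the element of `palette` of rank
`⌊y * |palette| / M⌋` (ranks start at `0`) in increasing order. -/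
noncomputable def hashColor {M : ℕ} (y : Fin M) (palette : Finset ℕ) : ℕ :=
  Nat.nth (fun c => c ∈ palette) ((y : ℕ) * palette.card / M)

/-! ### The color trial

`G` is the graph on which the trial is run, `Ψ` its palettes, `nom` the set of self-nominated nodes
and `c` the color that a node chooses if it takes part in the coloring step. -/

namespace ColorTrial

open scoped Classical in
/-- `N*(v)`: the neighbors of `v` of degree at least `3 d(v)`. -/
noncomputable def highNbrs {V : Type} [Fintype V] (G : SimpleGraph V) (v : V) : Finset V :=
  (G.neighborFinset v).filter fun u => 3 * G.degree v ≤ G.degree u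

open scoped Classical in
/-- A node is successful in the nomination step. -/
def NomSuccess {V : Type} [Fintype V] (G : SimpleGraph V) (Ψ : V → Finset ℕ) (nom : V → Prop)
    (v : V) : Prop :=
  (((G.neighborFinset v).filter nom).card : ℝ)
      ≤ 1 / 4 * (G.degree v : ℝ) + ((Ψ v).card : ℝ) ^ (0.7 : ℝ) ∧
  (((highNbrs G v).filter nom).card : ℝ)
      ≥ 1 / 4 * ((highNbrs G v).card : ℝ) - ((Ψ v).card : ℝ) ^ (0.7 : ℝ)

/-- A node picks a color in the coloring step: it nominated itself and did not fail in the
nomination step. -/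
def Picks {V : Type} [Fintype V] (G : SimpleGraph V) (Ψ : V → Finset ℕ) (nom : V → Prop)
    (v : V) : Prop :=
  nom v ∧ NomSuccess G Ψ nom v

/-- A node permanently takes the color that it picked: no neighbor picked the same color. -/
def TakesColor {V : Type} [Fintype V] (G : SimpleGraph V) (Ψ : V → Finset ℕ) (nom : V → Prop)
    (c : V → ℕ) (v : V) : Prop :=
  Picks G Ψ nom v ∧ ∀ u, G.Adj v u → Picks G Ψ nom u → c u ≠ c v

open scoped Classical in
/-- A node is successful in the coloring step. -/
def ColSuccess {V : Type} [Fintype V] (G : SimpleGraph V) (Ψ : V → Finset ℕ) (nom : V → Prop)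
    (c : V → ℕ) (v : V) : Prop :=
  ((Ψ v).card : ℝ) ≥ 1.1 * (G.degree v : ℝ) ∨
  ((highNbrs G v).card : ℝ) < 1 / 3 * (G.degree v : ℝ) ∨
  (((G.neighborFinset v).filter fun u => ¬ NomSuccess G Ψ nom u).card : ℝ)
      ≥ 0.03 * (G.degree v : ℝ) ∨
  (((G.neighborFinset v).filter fun u => TakesColor G Ψ nom c u ∧ c u ∉ Ψ v).card : ℝ)
      ≥ 0.01 * ((Ψ v).card : ℝ)

/-- The nodes that fail in the nomination step or in the coloring step. -/
def failed {V : Type} [Fintype V] (G : SimpleGraph V) (Ψ : V → Finset ℕ) (nom : V → Prop)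
    (c : V → ℕ) : Set V :=
  {v | ¬ NomSuccess G Ψ nom v ∨ ¬ ColSuccess G Ψ nom c v}

end ColorTrial

/-! ### The instances -/

open scoped Classical in
/-- `(G, Ψ)` is a degree+1 list coloring instance on `n` nodes with degrees and palette sizes at most
`D √n` and with colors from a set of `n ^ γ` colors (which are thus sent in `O(log n)` bits). -/
structure IsSqrtInstance (n D γ : ℕ) (G : SimpleGraph (Fin n)) (Ψ : Fin n → Finset ℕ) : Prop where
  degree_lt_palette : ∀ v, G.degree v + 1 ≤ (Ψ v).card
  degree_le : ∀ v, (G.degree v : ℝ) ≤ D * √(n : ℝ)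
  palette_le : ∀ v, ((Ψ v).card : ℝ) ≤ D * √(n : ℝ)
  color_lt : ∀ v, ∀ c ∈ Ψ v, c < n ^ γ

open scoped Classical in
/-- What the network node of `v` knows initially: the neighbors and the palette of `v`. -/
noncomputable def localInput {n : ℕ} (G : SimpleGraph (Fin n)) (Ψ : Fin n → Finset ℕ)
    (v : Fin n) : Finset (Fin n) × Finset ℕ :=
  (G.neighborFinset v, Ψ v)

/-- The node set of `G₀`, the graph `G` without the nodes of palette size less than `C`. -/
abbrev trialNodes {n : ℕ} (Ψ : Fin n → Finset ℕ) (C : ℕ) : Type :=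
  {v : Fin n // C ≤ (Ψ v).card}

/-- The nodes of `G₀` that fail when the color trial is run on `G₀`, with nominations determined by
the hash function `h₁` and color choices by `h₂`. -/
noncomputable def trialFailed {n A M : ℕ} (hA : n ≤ A) (G : SimpleGraph (Fin n))
    (Ψ : Fin n → Finset ℕ) (C : ℕ) (h₁ h₂ : Fin A → Fin M) : Set (trialNodes Ψ C) :=
  ColorTrial.failed (G.comap (Subtype.val : trialNodes Ψ C → Fin n)) (fun v => Ψ v.1)
    (fun v => hashNominates (h₁ (Fin.castLE hA v.1)))
    (fun v => hashColor (h₂ (Fin.castLE hA v.1)) (Ψ v.1))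

/-- `|F|`: the number of edges of the subgraph induced by the failed nodes. -/
noncomputable def sizeF {n A M : ℕ} (hA : n ≤ A) (G : SimpleGraph (Fin n))
    (Ψ : Fin n → Finset ℕ) (C : ℕ) (h₁ h₂ : Fin A → Fin M) : ℕ :=
  (((G.comap (Subtype.val : trialNodes Ψ C → Fin n)).induce
    (trialFailed hA G Ψ C h₁ h₂)).edgeSet).ncard

/-!
The proof is by the method of conditional expectations, on sample spaces of polynomial size that
are chosen in advance, for all instances of size `n` at once, by the probabilistic method.

*The hash family.* All polynomials of degree at most `100` over the field with `2 ^ m` elements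
form a `101`-wise independent family, and so do their translates by any given functions. The union
of the translates by polynomially many functions contains these functions themselves
(`exists_kWiseIndependent_containing`). Hence the algorithm may choose `h₁` and `h₂` out of any
polynomially many functions fixed in advance.

*The samples.* Nominations depend on a fully random function. For the coloring step, each node
gets a window of `O(log n)` random candidate colors, and then picks one of them at random. Node
`v` fails in the nomination step with probability `O(1 / p(v))`, and the windows near `v` fail
certain tests with probability less than `1 / n`. There are only `2 ^ poly(n)` possible
neighborhoods and palettes, so polynomially many samples `F` represent these probabilities for all
of them, and likewise a sample `ω` of choices of candidates (`exists_sample`,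
`exists_goodSamples`).

*Why windows.* Whether a node `u` takes its color depends on the colors of its neighbors, and thus
a node `v` that wants to know how many of its neighbors take a color outside `Ψ(v)` needs data
about its whole 2-neighborhood, which is too much. Once the windows are fixed, all that `v` needs
to know about `u` is which entries of the windows of the neighbors of `u` coincide with one of the
`O(log n)` candidates of `u`. A candidate that occurs there more than `O(log² n)` times is picked
by a neighbor almost certainly (`pr_not_hit_le`) and can be given up; the list of all other
coincidences has `O(log³ n) = O(√n)` entries (`card_conflicts_le`, `log_pow_three_le`). As degrees
are `O(√n)`, the lists reach all neighbors in two rounds (`Knows.localBroadcast`).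

*The coloring step.* A node `v` that does not succeed for a trivial reason is critical
(`critical_of_nomOk`): a constant fraction of its neighbors are of degree at least `3 d(v)` and
pick colors. Of these, `⌈d(v) / 20⌉` are singled out as helpers. A helper has more than `3 d(v)`
colors, at most `0.367` of them in `Ψ(v)`; its neighbors pick at most `0.251` of its colors, and
collisions between helpers are rare because there are so few of them. Exposing the helpers one
after the other shows that at least `0.22` of them take a color outside `Ψ(v)`, except with
probability exponentially small in `d(v)` (`pr_few_ok_le`); this is at least `0.01 p(v)` nodes
(`colSuccess_of_helpers`).

*The cost.* Both `d / p` and `d * exp (-Ω(d))` are `O(1)`, so the expected total degree of failed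
nodes is `O(n)`. Seeds of at most average cost are found digit by digit in base `n`, each digit in
two rounds (`Knows.select`): node `w` adds up the costs of all nodes for the digit `w`.
-/

namespace TrialDerandomization

open Finset
open scoped BigOperators Classical

/-! ### Uniform averages over product spaces -/

section Probability

/-- The probability of an event under the uniform distribution on a finite type; it is zero if the
type is empty. -/
noncomputable def pr {Ω : Type*} [Fintype Ω] (p : Ω → Prop) : ℝ :=
  𝔼 ω, if p ω then (1 : ℝ) else 0

variable {Ω Ω' : Type*} [Fintype Ω] [Fintype Ω']

lemma expect_mono {f g : Ω → ℝ} (h : ∀ ω, f ω ≤ g ω) : 𝔼 ω, f ω ≤ 𝔼 ω, g ω :=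
  Finset.expect_le_expect fun ω _ => h ω

lemma expect_nonneg' {f : Ω → ℝ} (h : ∀ ω, 0 ≤ f ω) : 0 ≤ 𝔼 ω, f ω :=
  Finset.expect_nonneg fun ω _ => h ω

lemma pr_nonneg (p : Ω → Prop) : 0 ≤ pr p :=
  expect_nonneg' fun ω => by split_ifs <;> norm_num

lemma pr_mono {p q : Ω → Prop} (h : ∀ ω, p ω → q ω) : pr p ≤ pr q :=
  expect_mono fun ω => by
    by_cases hp : p ω
    · simp [hp, h ω hp]
    · simp only [hp, if_false]; split_ifs <;> norm_num

lemma pr_or_le (p q : Ω → Prop) : pr (fun ω => p ω ∨ q ω) ≤ pr p + pr q := by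
  rw [pr, pr, pr, ← Finset.expect_add_distrib]
  refine expect_mono fun ω => ?_
  by_cases hp : p ω <;> by_cases hq : q ω <;> simp [hp, hq]

lemma pr_exists_le {τ : Type*} (T : Finset τ) (p : τ → Ω → Prop) :
    pr (fun ω => ∃ t ∈ T, p t ω) ≤ ∑ t ∈ T, pr (p t) := by
  simp only [pr]
  rw [← Finset.expect_sum_comm]
  refine expect_mono fun ω => ?_
  have h0 : ∀ t ∈ T, (0 : ℝ) ≤ if p t ω then 1 else 0 := fun t _ => by split_ifs <;> norm_num
  split_ifs with h
  · obtain ⟨t, ht, hp⟩ := h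
    exact (by simp [hp] : (1 : ℝ) ≤ if p t ω then 1 else 0).trans (Finset.single_le_sum h0 ht)
  · exact Finset.sum_nonneg h0

/-- The definition of `pr`, for any decidability instance. -/
lemma pr_eq_expect (p : Ω → Prop) [DecidablePred p] : pr p = 𝔼 ω, if p ω then (1 : ℝ) else 0 :=
  Finset.expect_congr rfl fun ω _ => by by_cases h : p ω <;> simp [h]

lemma pr_eq_card_div (p : Ω → Prop) [DecidablePred p] :
    pr p = ((univ.filter p).card : ℝ) / Fintype.card Ω := by
  rw [pr, Fintype.expect_eq_sum_div_card, Finset.card_filter]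
  push_cast
  congr 1
  exact Finset.sum_congr rfl fun ω _ => by by_cases h : p ω <;> simp [h]

/-- Markov's inequality. -/
lemma pr_le_expect_div {X : Ω → ℝ} (hX : ∀ ω, 0 ≤ X ω) {t : ℝ} (ht : 0 < t) {p : Ω → Prop}
    (hp : ∀ ω, p ω → t ≤ X ω) : pr p ≤ (𝔼 ω, X ω) / t := by
  rw [Finset.expect_div]
  refine expect_mono fun ω => ?_
  split_ifs with h
  · rw [le_div_iff₀ ht]; linarith [hp ω h]
  · exact div_nonneg (hX ω) ht.le

/-- The exponential Markov inequality. -/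
lemma pr_le_exp_mul {X : Ω → ℝ} {l t : ℝ} (hl : 0 ≤ l) {p : Ω → Prop} (hp : ∀ ω, p ω → t ≤ X ω)
    {B : ℝ} (hB : 𝔼 ω, Real.exp (l * X ω) ≤ B) : pr p ≤ Real.exp (-(l * t)) * B := by
  have := pr_le_expect_div (X := fun ω => Real.exp (l * X ω)) (fun ω => (Real.exp_pos _).le)
    (Real.exp_pos (l * t)) (p := p)
    (fun ω h => Real.exp_le_exp.2 (mul_le_mul_of_nonneg_left (hp ω h) hl))
  refine this.trans ?_
  rw [Real.exp_neg, div_eq_inv_mul]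
  exact mul_le_mul_of_nonneg_left hB (inv_nonneg.2 (Real.exp_pos _).le)

variable {ι κ : Type*} [Fintype ι] [DecidableEq ι] [Fintype κ] [Nonempty κ]

/-- Resampling one coordinate of a uniformly random function does not change averages. -/
lemma expect_update (i : ι) (f : (ι → κ) → ℝ) :
    𝔼 ω, f ω = 𝔼 ω, 𝔼 y, f (Function.update ω i y) := by
  have h : 𝔼 q : (ι → κ) × κ, f (Function.update q.1 i q.2) = 𝔼 q : (ι → κ) × κ, f q.1 := by
    let e : (ι → κ) × κ ≃ (ι → κ) × κ :=
      { toFun := fun q => (Function.update q.1 i q.2, q.1 i)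
        invFun := fun q => (Function.update q.1 i q.2, q.1 i)
        left_inv := fun q => by simp
        right_inv := fun q => by simp }
    exact Fintype.expect_equiv e _ _ fun q => rfl
  have h1 := Finset.expect_product' (univ : Finset (ι → κ)) (univ : Finset κ)
    (fun ω y => f (Function.update ω i y))
  have h2 := Finset.expect_product' (univ : Finset (ι → κ)) (univ : Finset κ) (fun ω _ => f ω)
  rw [univ_product_univ] at h1 h2
  rw [← h1, h, h2]
  simp

/-- If, with respect to the order `ρ`, each factor `f i` does not depend on the coordinates later
than `i`, and its average over the coordinate `i` is at most `B i` whatever the other coordinates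
are, then the average of the product is at most the product of the bounds. -/
lemma expect_prod_le (J : Finset ι) (ρ : ι → ℕ) (hρ : Function.Injective ρ)
    (f : ι → (ι → κ) → ℝ) (B : ι → ℝ) (hf : ∀ i ω, 0 ≤ f i ω)
    (hind : ∀ i ∈ J, ∀ j ∈ J, ρ i < ρ j → ∀ ω y, f i (Function.update ω j y) = f i ω)
    (hB : ∀ i ∈ J, ∀ ω, 𝔼 y, f i (Function.update ω i y) ≤ B i) :
    𝔼 ω, ∏ i ∈ J, f i ω ≤ ∏ i ∈ J, B i := by
  induction J using Finset.induction_on_max_value ρ with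
  | empty => simp
  | insert a s ha hmax ih =>
    have ih' := ih (fun i hi j hj => hind i (mem_insert_of_mem hi) j (mem_insert_of_mem hj))
      (fun i hi => hB i (mem_insert_of_mem hi))
    have hlt : ∀ i ∈ s, ρ i < ρ a := fun i hi =>
      lt_of_le_of_ne (hmax i hi) fun h => ha (hρ h ▸ hi)
    have hBa : 0 ≤ B a := by
      obtain ⟨y⟩ := ‹Nonempty κ›
      exact (expect_nonneg' fun z => hf _ _).trans (hB a (mem_insert_self _ _) fun _ => y)
    rw [Finset.prod_insert ha, expect_update a]
    calc 𝔼 ω, 𝔼 y, ∏ i ∈ insert a s, f i (Function.update ω a y)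
        ≤ 𝔼 ω, B a * ∏ i ∈ s, f i ω := by
          refine expect_mono fun ω => ?_
          have : ∀ y, ∏ i ∈ insert a s, f i (Function.update ω a y)
              = f a (Function.update ω a y) * ∏ i ∈ s, f i ω := fun y => by
            rw [Finset.prod_insert ha]
            congr 1
            exact Finset.prod_congr rfl fun i hi =>
              hind i (mem_insert_of_mem hi) a (mem_insert_self _ _) (hlt i hi) ω y
          simp only [this]
          rw [← Finset.expect_mul]
          exact mul_le_mul_of_nonneg_right (hB a (mem_insert_self _ _) ω)
            (Finset.prod_nonneg fun i _ => hf i ω)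
      _ = B a * 𝔼 ω, ∏ i ∈ s, f i ω := by rw [Finset.mul_expect]
      _ ≤ B a * ∏ i ∈ s, B i := mul_le_mul_of_nonneg_left ih' hBa

/-- The case of factors that depend on disjoint sets of coordinates of `J`. -/
lemma expect_prod_le_of_indep (J : Finset ι)
    (f : ι → (ι → κ) → ℝ) (B : ι → ℝ) (hf : ∀ i ω, 0 ≤ f i ω)
    (hind : ∀ i ∈ J, ∀ j ∈ J, i ≠ j → ∀ ω y, f i (Function.update ω j y) = f i ω)
    (hB : ∀ i ∈ J, ∀ ω, 𝔼 y, f i (Function.update ω i y) ≤ B i) :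
    𝔼 ω, ∏ i ∈ J, f i ω ≤ ∏ i ∈ J, B i :=
  expect_prod_le J (fun i => (Fintype.equivFin ι i : ℕ))
    (fun i j h => (Fintype.equivFin ι).injective (Fin.ext h)) f B hf
    (fun i hi j hj hij => hind i hi j hj fun h => by simp [h] at hij) hB

/-- The moment generating function of an indicator, for a small parameter. -/
lemma expect_exp_indicator_le [Nonempty Ω] {p : Ω → Prop} [DecidablePred p] {q l : ℝ}
    (hq : pr p ≤ q) (hl : 0 ≤ l) :
    𝔼 ω, Real.exp (l * if p ω then 1 else 0) ≤ Real.exp (q * (Real.exp l - 1)) := by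
  have h : ∀ ω, Real.exp (l * if p ω then 1 else 0)
      = 1 + (if p ω then (1 : ℝ) else 0) * (Real.exp l - 1) := fun ω => by split_ifs <;> simp
  simp only [h]
  rw [Finset.expect_add_distrib, Fintype.expect_one, ← Finset.expect_mul]
  have h1 : 0 ≤ Real.exp l - 1 := by linarith [Real.add_one_le_exp l]
  calc 1 + (𝔼 ω, if p ω then (1 : ℝ) else 0) * (Real.exp l - 1) ≤ 1 + q * (Real.exp l - 1) := by
        have := mul_le_mul_of_nonneg_right hq h1
        rw [pr_eq_expect] at this
        linarith
    _ ≤ _ := by linarith [Real.add_one_le_exp (q * (Real.exp l - 1))]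

lemma exp_sub_one_le {l : ℝ} (h0 : 0 ≤ l) (h1 : l ≤ 1) : Real.exp l - 1 ≤ l + l ^ 2 := by
  have := Real.abs_exp_sub_one_sub_id_le (x := l) (by rwa [abs_of_nonneg h0])
  linarith [(abs_le.1 this).2]

/-- The probabilistic method: for some sample of size `N`, and for each test out of a finite set,
the average over the sample exceeds twice the bound on the expectation by at most `η`, provided
that the number of tests is less than `exp (η * N)`. -/
lemma exists_sample [Nonempty Ω] {τ : Type*} (T : Finset τ) (φ : τ → Ω → ℝ)
    (h0 : ∀ t ω, 0 ≤ φ t ω) (h1 : ∀ t ω, φ t ω ≤ 1) (ε : τ → ℝ)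
    (hε : ∀ t ∈ T, 𝔼 ω, φ t ω ≤ ε t) (N : ℕ) [NeZero N] (η : ℝ)
    (hT : (T.card : ℝ) < Real.exp (η * N)) :
    ∃ x : Fin N → Ω, ∀ t ∈ T, 𝔼 i, φ t (x i) ≤ 2 * ε t + η := by
  by_contra! hcon
  have hN : (0 : ℝ) < N := by exact_mod_cast Nat.pos_of_ne_zero (NeZero.ne N)
  have key : ∀ t ∈ T, pr (fun x : Fin N → Ω => 2 * ε t + η < 𝔼 i, φ t (x i))
      ≤ Real.exp (-(η * N)) := by
    intro t ht
    have hε0 : 0 ≤ ε t := (expect_nonneg' fun ω => h0 t ω).trans (hε t ht)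
    have hmgf : 𝔼 x : Fin N → Ω, Real.exp (1 * ∑ i, φ t (x i)) ≤ Real.exp (2 * ε t) ^ N := by
      have := expect_prod_le_of_indep (κ := Ω) (univ : Finset (Fin N))
        (fun i x => Real.exp (φ t (x i))) (fun _ => Real.exp (2 * ε t))
        (fun i x => (Real.exp_pos _).le)
        (fun i _ j _ hij x y => by simp [Function.update_of_ne hij])
        (fun i _ x => by
          simp only [Function.update_self]
          have hc : ∀ ω, Real.exp (φ t ω) ≤ 1 + 2 * φ t ω := fun ω => by
            have := exp_sub_one_le (h0 t ω) (h1 t ω)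
            nlinarith [h0 t ω, h1 t ω]
          refine (expect_mono hc).trans ?_
          rw [Finset.expect_add_distrib, Fintype.expect_one, ← Finset.mul_expect]
          linarith [hε t ht, Real.add_one_le_exp (2 * ε t)])
      simpa [Real.exp_sum] using this
    refine (pr_le_exp_mul (X := fun x : Fin N → Ω => ∑ i, φ t (x i)) (l := 1)
      (t := (2 * ε t + η) * N) zero_le_one (fun x hx => ?_) hmgf).trans_eq ?_
    · rw [Fintype.expect_eq_sum_div_card, Fintype.card_fin, lt_div_iff₀ hN] at hx
      exact hx.le
    · rw [← Real.exp_nat_mul, ← Real.exp_add]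
      congr 1; ring
  have hall : (1 : ℝ) ≤ pr (fun x : Fin N → Ω => ∃ t ∈ T, 2 * ε t + η < 𝔼 i, φ t (x i)) := by
    rw [pr]
    simp only [hcon, if_true]
    simp
  have := hall.trans ((pr_exists_le T _).trans (Finset.sum_le_sum key))
  rw [Finset.sum_const, nsmul_eq_mul, Real.exp_neg, ← div_eq_mul_inv,
    le_div_iff₀ (Real.exp_pos _)] at this
  linarith

end Probability

/-! ### Colors chosen by a uniform hash value -/

section HashColor

variable {M : ℕ}

lemma card_setOf_mem_toFinset (P : Finset ℕ) (hf : {c | c ∈ P}.Finite) :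
    hf.toFinset.card = P.card := by
  congr 1; ext c; simp

lemma rank_lt_card (y : Fin M) {P : Finset ℕ} (hP : 0 < P.card) :
    (y : ℕ) * P.card / M < P.card := by
  have hM : 0 < M := y.pos
  rw [Nat.div_lt_iff_lt_mul hM, mul_comm]
  exact Nat.mul_lt_mul_of_pos_left y.2 hP

lemma rank_eq_of_hashColor_eq {y z : Fin M} {P : Finset ℕ} (hP : 0 < P.card)
    (h : hashColor y P = hashColor z P) : (y : ℕ) * P.card / M = (z : ℕ) * P.card / M := by
  have hf : {c | c ∈ P}.Finite := P.finite_toSet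
  refine Nat.nth_injOn hf ?_ ?_ h <;>
  · rw [Set.mem_Iio, card_setOf_mem_toFinset]; exact rank_lt_card _ hP

/-- The hash values with the same color form an interval. -/
lemma card_hashColor_eq_le (P : Finset ℕ) (hP : 0 < P.card) (c : ℕ) :
    (univ.filter fun y : Fin M => hashColor y P = c).card ≤ M / P.card + 1 := by
  rcases (univ.filter fun y : Fin M => hashColor y P = c).eq_empty_or_nonempty with h | h
  · simp [h]
  set s := univ.filter fun y : Fin M => hashColor y P = c with hs
  set z := s.min' h
  have hz : z ∈ s := s.min'_mem h
  have hM : 0 < M := z.pos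
  have hsub : s.image (fun y : Fin M => (y : ℕ)) ⊆ Icc (z : ℕ) (z + M / P.card) := by
    intro k hk
    obtain ⟨y, hy, rfl⟩ := mem_image.1 hk
    have hzy : z ≤ y := s.min'_le y hy
    have hr := rank_eq_of_hashColor_eq hP
      (((mem_filter.1 hy).2).trans ((mem_filter.1 hz).2).symm)
    refine mem_Icc.2 ⟨hzy, ?_⟩
    have h1 := Nat.div_add_mod ((y : ℕ) * P.card) M
    have h2 := Nat.div_add_mod ((z : ℕ) * P.card) M
    have h3 := Nat.mod_lt ((y : ℕ) * P.card) hM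
    obtain ⟨d, hd⟩ := Nat.exists_eq_add_of_le (show (z : ℕ) ≤ y from hzy)
    rw [hd]
    refine Nat.add_le_add_left ?_ _
    rw [Nat.le_div_iff_mul_le hP]
    rw [hr] at h1
    rw [hd, add_mul] at h1 h3
    omega
  calc s.card = (s.image fun y : Fin M => (y : ℕ)).card :=
        (Finset.card_image_of_injective _ Fin.val_injective).symm
    _ ≤ _ := card_le_card hsub
    _ = M / P.card + 1 := by
        rw [Nat.card_Icc]; generalize M / P.card = d; omega

/-- Rounding makes the color choice slightly non-uniform: a set of a `q` fraction of the palette is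
hit with probability at most `q + 1/1000`. -/
lemma pr_hashColor_mem_le {P S : Finset ℕ} (hP : 0 < P.card) (hM : 1000 * P.card ≤ M) {q : ℝ}
    (hq : q ≤ 1) (hS : (S.card : ℝ) ≤ q * P.card) :
    pr (fun y : Fin M => hashColor y P ∈ S) ≤ q + 0.001 := by
  have hP' : (0 : ℝ) < P.card := by exact_mod_cast hP
  have hMP : (1000 : ℝ) * P.card ≤ M := by exact_mod_cast hM
  have hM0 : (0 : ℝ) < M := by linarith
  rw [pr_eq_card_div, Fintype.card_fin, div_le_iff₀ hM0]
  have hsub : (univ.filter fun y : Fin M => hashColor y P ∈ S)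
      ⊆ S.biUnion fun c => univ.filter fun y : Fin M => hashColor y P = c := fun y hy => by
    simp only [mem_filter, mem_univ, true_and] at hy
    exact mem_biUnion.2 ⟨_, hy, by simp⟩
  have h1 : ((univ.filter fun y : Fin M => hashColor y P ∈ S).card : ℝ)
      ≤ S.card * ((M : ℝ) / P.card + 1) := by
    have hnat : (univ.filter fun y : Fin M => hashColor y P ∈ S).card
        ≤ S.card * (M / P.card + 1) :=
      (card_le_card hsub).trans (Finset.card_biUnion_le_card_mul _ _ _ fun c _ =>
        card_hashColor_eq_le P hP c)
    have hdiv : ((M / P.card : ℕ) : ℝ) ≤ (M : ℝ) / P.card := Nat.cast_div_le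
    calc ((univ.filter fun y : Fin M => hashColor y P ∈ S).card : ℝ)
        ≤ S.card * (((M / P.card : ℕ) : ℝ) + 1) := by exact_mod_cast hnat
      _ ≤ _ := mul_le_mul_of_nonneg_left (by linarith) (Nat.cast_nonneg _)
  refine h1.trans ?_
  calc (S.card : ℝ) * ((M : ℝ) / P.card + 1) ≤ (q * P.card) * ((M : ℝ) / P.card + 1) :=
        mul_le_mul_of_nonneg_right hS (by positivity)
    _ = q * M + q * P.card := by field_simp
    _ ≤ _ := by nlinarith

end HashColor

/-! ### Hash families that contain given functions -/

section Family

/-- Evaluation at the points of `I` is a surjective homomorphism from the coefficient vectors, so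
all of its fibers have the same size. -/
lemma card_polynomials_through {K : Type*} [Field K] [Fintype K] (k : ℕ) [NeZero k]
    (I : Finset K) (hI : I.card ≤ k) (y : K → K) :
    (univ.filter fun g : Fin k → K => ∀ x ∈ I, ∑ i, g i * x ^ (i : ℕ) = y x).card
      * Fintype.card K ^ I.card = Fintype.card K ^ k := by
  let φ : (Fin k → K) →+ (I → K) :=
    { toFun := fun g x => ∑ i, g i * (x : K) ^ (i : ℕ)
      map_zero' := by ext; simp
      map_add' := fun g h => by ext; simp [add_mul, Finset.sum_add_distrib] }
  have hsurj : Function.Surjective φ := by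
    intro z
    let w : K → K := fun x => if h : x ∈ I then z ⟨x, h⟩ else 0
    let p := Lagrange.interpolate I id w
    have hdeg : p.natDegree < k := by
      by_cases hp : p = 0
      · rw [hp, Polynomial.natDegree_zero]; exact Nat.pos_of_ne_zero (NeZero.ne k)
      · rw [Polynomial.natDegree_lt_iff_degree_lt hp]
        refine lt_of_lt_of_le (Lagrange.degree_interpolate_lt w (Set.injOn_id _)) ?_
        exact_mod_cast hI
    refine ⟨fun i => p.coeff i, ?_⟩
    funext x
    change ∑ i : Fin k, p.coeff i * (x : K) ^ (i : ℕ) = z x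
    rw [Fin.sum_univ_eq_sum_range (fun i => p.coeff i * (x : K) ^ i) k,
      ← Polynomial.eval_eq_sum_range' hdeg]
    have := Lagrange.eval_interpolate_at_node (s := I) (v := id) w (Set.injOn_id _) x.2
    simp only [id] at this
    rw [this]
    simp [w]
  have hfib : ∀ z : I → K, (univ.filter fun g => φ g = z).card
      = (univ.filter fun g => φ g = fun x : I => y x).card := fun z =>
    AddMonoidHom.card_fiber_eq_of_mem_range φ (hsurj z) (hsurj _)
  have hsum := Finset.card_eq_sum_card_fiberwise (s := (univ : Finset (Fin k → K)))
    (t := (univ : Finset (I → K))) (f := φ) (fun _ _ => mem_coe.2 (mem_univ _))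
  simp only [hfib, sum_const, card_univ, Fintype.card_fun, Fintype.card_coe, Fintype.card_fin,
    smul_eq_mul] at hsum
  rw [hsum, mul_comm]
  congr 2
  ext g
  simp only [mem_filter, mem_univ, true_and]
  constructor
  · intro h; funext x; exact h x x.2
  · intro h x hx; exact congrFun h ⟨x, hx⟩

/-- Adding to given functions all polynomials of degree less than `k` over the field with `2 ^ m`
elements gives a `k`-wise independent family; the zero polynomial keeps the given functions in
it. -/
lemma exists_kWiseIndependent_containing (k m N : ℕ) [NeZero k] (hm : m ≠ 0) (hN : 0 < N)
    (f : Fin N → Fin (2 ^ m) → Fin (2 ^ m)) :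
    ∃ H : Fin ((2 ^ m) ^ k * N) → Fin (2 ^ m) → Fin (2 ^ m),
      KWiseIndependent k H ∧ ∀ c, ∃ s, H s = f c := by
  have : Fact (Nat.Prime 2) := ⟨Nat.prime_two⟩
  let K := GaloisField 2 m
  let _ : Fintype K := Fintype.ofFinite K
  have hK : Fintype.card K = 2 ^ m := by
    rw [← Nat.card_eq_fintype_card]; exact GaloisField.card 2 m hm
  let e : K ≃ Fin (2 ^ m) := Fintype.equivFinOfCardEq hK
  let σ : Fin ((2 ^ m) ^ k * N) ≃ (Fin k → K) × Fin N :=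
    (Fintype.equivFinOfCardEq (by simp [hK])).symm
  refine ⟨fun s x => e (∑ i, (σ s).1 i * (e.symm x) ^ (i : ℕ) + e.symm (f (σ s).2 x)), ?_, ?_⟩
  · intro I hI y
    have hcard : (univ.filter fun s : Fin ((2 ^ m) ^ k * N) => ∀ x ∈ I,
        e (∑ i, (σ s).1 i * (e.symm x) ^ (i : ℕ) + e.symm (f (σ s).2 x)) = y x).card
          * (2 ^ m) ^ I.card = (2 ^ m) ^ k * N := by
      have h1 : (univ.filter fun s : Fin ((2 ^ m) ^ k * N) => ∀ x ∈ I,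
          e (∑ i, (σ s).1 i * (e.symm x) ^ (i : ℕ) + e.symm (f (σ s).2 x)) = y x).card
          = (univ.filter fun q : (Fin k → K) × Fin N => ∀ x ∈ I,
          e (∑ i, q.1 i * (e.symm x) ^ (i : ℕ) + e.symm (f q.2 x)) = y x).card := by
        refine Finset.card_bij (fun s _ => σ s) (fun s hs => ?_) (fun s _ t _ h => σ.injective h)
          (fun q hq => ⟨σ.symm q, ?_, by simp⟩)
        · simpa using hs
        · simpa using hq
      rw [h1, Finset.card_eq_sum_card_fiberwise (t := (univ : Finset (Fin N))) (f := Prod.snd)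
        (fun _ _ => mem_coe.2 (mem_univ _)), Finset.sum_mul]
      rw [Finset.sum_congr rfl (g := fun _ => (2 ^ m) ^ k)]
      · simp [mul_comm]
      intro c _
      have h2 := card_polynomials_through k (I.map e.symm.toEmbedding) (by simpa using hI)
        (fun x => e.symm (y (e x)) - e.symm (f c (e x)))
      rw [hK, card_map] at h2
      rw [← h2]
      congr 1
      refine Finset.card_bij (fun q _ => q.1) (fun q hq => ?_) (fun q hq r hr h => ?_)
        (fun g hg => ⟨(g, c), ?_, rfl⟩)
      · simp only [mem_filter, mem_univ, true_and] at hq ⊢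
        intro x hx
        obtain ⟨z, hz, rfl⟩ := mem_map.1 hx
        have := hq.1 z hz
        rw [hq.2] at this
        simp only [Equiv.coe_toEmbedding, Equiv.apply_symm_apply]
        rw [eq_sub_iff_add_eq, ← this, Equiv.symm_apply_apply]
      · simp only [mem_filter, mem_univ, true_and] at hq hr
        exact Prod.ext h (hq.2.trans hr.2.symm)
      · simp only [mem_filter, mem_univ, true_and] at hg ⊢
        refine ⟨fun x hx => ?_, trivial⟩
        have := hg (e.symm x) (mem_map.2 ⟨x, hx, rfl⟩)
        rw [Equiv.apply_symm_apply] at this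
        rw [this, sub_add_cancel, Equiv.apply_symm_apply]
    rw [Finset.prod_const, div_pow, one_pow]
    have hpos : (0 : ℚ) < ((2 ^ m : ℕ) : ℚ) ^ I.card := by positivity
    have hpos2 : (0 : ℚ) < (((2 ^ m) ^ k * N : ℕ) : ℚ) := by
      have : 0 < (2 ^ m) ^ k * N := by positivity
      exact_mod_cast this
    rw [div_eq_div_iff hpos2.ne' hpos.ne', one_mul]
    convert congrArg (Nat.cast (R := ℚ)) hcard using 1
    push_cast
    rfl
  · intro c
    refine ⟨σ.symm (0, c), ?_⟩
    funext x
    simp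

end Family

/-! ### Windows of candidate colors -/

section Windows

variable {V : Type*} {R : ℕ}

/-- Some node of `W` picks the color `c` when every node `w` picks the candidate color
`col w (ω w)` of its window. -/
def Hit (col : V → Fin R → ℕ) (W : Finset V) (ω : V → Fin R) (c : ℕ) : Prop :=
  ∃ w ∈ W, col w (ω w) = c

/-- The positions in the windows of the nodes of `W` that hold the `r`-th candidate color of `u`. -/
noncomputable def entries (col : V → Fin R → ℕ) (W : Finset V) (u : V) (r : Fin R) :
    Finset (V × Fin R) :=
  (W ×ˢ univ).filter fun e => col e.1 e.2 = col u r

/-- The `r`-th candidate color of `u` occurs so often in the windows of `W` that it is almost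
certainly picked by a node of `W`. -/
def Heavy (T : ℕ) (col : V → Fin R → ℕ) (W : Finset V) (u : V) (r : Fin R) : Prop :=
  T * R < (entries col W u r).card

/-- Only with probability at most `δ`, more than `0.257` of the candidate colors of `u` are heavy or
picked in `W`. -/
def FewBlocked [Fintype V] [DecidableEq V] (δ : ℝ) (T : ℕ) (col : V → Fin R → ℕ)
    (W : Finset V) (u : V) : Prop :=
  pr (fun ω : V → Fin R => 0.257 * (R : ℝ) <
    ((univ.filter fun r => Heavy T col W u r ∨ Hit col W ω (col u r)).card : ℝ)) ≤ δ

/-- At most `0.373` of the candidate colors of `u` lie in `S`. -/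
def FewInside (col : V → Fin R → ℕ) (S : Finset ℕ) (u : V) : Prop :=
  ((univ.filter fun r => col u r ∈ S).card : ℝ) ≤ 0.373 * (R : ℝ)

/-- Only with probability at most `δ`, more than `0.023` of the candidate colors of `u` are picked
in `W`. -/
def FewRepeated [Fintype V] [DecidableEq V] (δ : ℝ) (col : V → Fin R → ℕ)
    (W : Finset V) (u : V) : Prop :=
  pr (fun ω : V → Fin R => 0.023 * (R : ℝ) <
    ((univ.filter fun r => Hit col W ω (col u r)).card : ℝ)) ≤ δ

/-- A sufficient condition for `u` to take a color outside `S`, if `W` contains all neighbors of `u`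
that pick a color; heavy colors are given up. -/
def Ok (T : ℕ) (col : V → Fin R → ℕ) (S : Finset ℕ) (W : Finset V) (ω : V → Fin R) (u : V) : Prop :=
  ¬ Heavy T col W u (ω u) ∧ col u (ω u) ∉ S ∧ ¬ Hit col W ω (col u (ω u))

lemma Hit.mono {col : V → Fin R → ℕ} {W W' : Finset V} {ω : V → Fin R} {c : ℕ} (h : W ⊆ W')
    (hit : Hit col W ω c) : Hit col W' ω c := by
  obtain ⟨w, hw, e⟩ := hit
  exact ⟨w, h hw, e⟩

lemma hit_update [DecidableEq V] (col : V → Fin R → ℕ) {W : Finset V} {u : V} (hu : u ∉ W)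
    (ω : V → Fin R) (y : Fin R) (c : ℕ) :
    Hit col W (Function.update ω u y) c ↔ Hit col W ω c := by
  unfold Hit
  refine exists_congr fun w => and_congr_right fun hw => ?_
  rw [Function.update_of_ne (show w ≠ u from fun h => hu (h ▸ hw))]

/-! ### Concentration of the number of successful nodes, for given windows -/

section Concentration

variable [LinearOrder V] (T : ℕ) (col : V → Fin R → ℕ) (S : Finset ℕ) (W : V → Finset V)
  (U : Finset V)

/-- `u` picks a color of `S`, a heavy color, or the color of a node of `W u` outside `U`. -/
def BlockedOutside (ω : V → Fin R) (u : V) : Prop :=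
  (Heavy T col (W u) u (ω u) ∨ Hit col (W u \ U) ω (col u (ω u))) ∨ col u (ω u) ∈ S

/-- `u` repeats the color of an earlier node of `U`. -/
def Repeats (ω : V → Fin R) (u : V) : Prop :=
  Hit col (U.filter fun w => w < u) ω (col u (ω u))

/-- Every repetition spoils, besides the repeating node, at most one node with a new color. -/
lemma card_not_ok_le (hW : ∀ u ∈ U, u ∉ W u) (ω : V → Fin R) :
    (U.filter fun u => ¬ Ok T col S (W u) ω u).card ≤
      (U.filter fun u => BlockedOutside T col S W U ω u).card
        + 2 * (U.filter fun u => Repeats col U ω u).card := by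
  set X := U.filter fun u => BlockedOutside T col S W U ω u with hX
  set Y := U.filter fun u => Repeats col U ω u with hY
  set Z := U.filter fun u => ¬ Repeats col U ω u ∧ ∃ w ∈ U, u < w ∧ col w (ω w) = col u (ω u)
    with hZ
  have hsub : (U.filter fun u => ¬ Ok T col S (W u) ω u) ⊆ X ∪ (Y ∪ Z) := by
    intro u hu
    obtain ⟨huU, hok⟩ := mem_filter.1 hu
    by_cases h1 : BlockedOutside T col S W U ω u
    · exact mem_union_left _ (mem_filter.2 ⟨huU, h1⟩)
    by_cases h2 : Repeats col U ω u
    · exact mem_union_right _ (mem_union_left _ (mem_filter.2 ⟨huU, h2⟩))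
    refine mem_union_right _ (mem_union_right _ (mem_filter.2 ⟨huU, h2, ?_⟩))
    simp only [BlockedOutside, not_or] at h1
    have h3 : Hit col (W u) ω (col u (ω u)) := by
      by_contra h3
      exact hok ⟨h1.1.1, h1.2, h3⟩
    obtain ⟨w, hw, he⟩ := h3
    have hwU : w ∈ U := by
      by_contra hwU
      exact h1.1.2 ⟨w, mem_sdiff.2 ⟨hw, hwU⟩, he⟩
    rcases lt_trichotomy u w with h | h | h
    · exact ⟨w, hwU, h, he⟩
    · exact absurd (h ▸ hw) (hW u huU)
    · exact absurd ⟨w, mem_filter.2 ⟨hwU, h⟩, he⟩ h2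
  have hZY : Z.card ≤ Y.card := by
    have hch : ∀ u ∈ Z, ∃ w ∈ U, u < w ∧ col w (ω w) = col u (ω u) := fun u hu =>
      (mem_filter.1 hu).2.2
    choose! s hs using hch
    refine Finset.card_le_card_of_injOn s (fun u hu => ?_) (fun u hu v hv huv => ?_)
    · have hu' := mem_coe.1 hu
      obtain ⟨a, b, c⟩ := hs u hu'
      exact mem_coe.2 (mem_filter.2 ⟨a, u, mem_filter.2 ⟨(mem_filter.1 hu').1, b⟩, c.symm⟩)
    · have hu' := mem_coe.1 hu
      have hv' := mem_coe.1 hv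
      have he : col u (ω u) = col v (ω v) := by
        rw [← (hs u hu').2.2, ← (hs v hv').2.2, huv]
      rcases lt_trichotomy u v with h | h | h
      · exact absurd ⟨u, mem_filter.2 ⟨(mem_filter.1 hu').1, h⟩, he⟩ (mem_filter.1 hv').2.1
      · exact h
      · exact absurd ⟨v, mem_filter.2 ⟨(mem_filter.1 hv').1, h⟩, he.symm⟩ (mem_filter.1 hu').2.1
  have := card_le_card hsub
  have h1 := card_union_le X (Y ∪ Z)
  have h2 := card_union_le Y Z
  omega

lemma exp_tenth_le : Real.exp 0.1 ≤ 1.1052 := by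
  have := Real.exp_bound' (x := 0.1) (by norm_num) (by norm_num) (n := 4) (by norm_num)
  refine this.trans ?_
  norm_num [Finset.sum_range_succ, Nat.factorial]

lemma exp_three_tenths_le : Real.exp 0.3 ≤ 1.35 := by
  have := Real.exp_bound' (x := 0.3) (by norm_num) (by norm_num) (n := 4) (by norm_num)
  refine this.trans ?_
  norm_num [Finset.sum_range_succ, Nat.factorial]

/-- The indicator of a proposition. -/
noncomputable def ind (p : Prop) : ℝ := if p then 1 else 0

lemma exp_two_indicators_le (p q : Prop) :
    Real.exp (0.1 * (ind p + 2 * ind q)) ≤ 1 + 0.1052 * ind p + 0.35 * ind q := by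
  have h1 := exp_tenth_le
  have h3 := exp_three_tenths_le
  have h2 : Real.exp 0.2 ≤ 1.35 := (Real.exp_le_exp.2 (by norm_num)).trans h3
  by_cases hp : p <;> by_cases hq : q <;> simp only [ind, hp, hq, if_true, if_false]
  · norm_num at h3 ⊢; linarith
  · norm_num at h1 ⊢; linarith
  · norm_num at h2 h3 ⊢; linarith
  · norm_num

lemma strictMono_card_lt [Fintype V] :
    StrictMono fun u : V => (univ.filter fun w => w < u).card := by
  intro u v huv
  refine Finset.card_lt_card (Finset.ssubset_iff_of_subset (fun w hw => ?_) |>.2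
    ⟨u, by simpa using huv, by simp⟩)
  simp only [mem_filter, mem_univ, true_and] at hw ⊢
  exact hw.trans huv

/-- At most `0.257` of the candidate colors of `u` are heavy or picked outside `U`, and at most
`0.023` of them are picked by earlier nodes of `U`. -/
def Typical (ω : V → Fin R) (u : V) : Prop :=
  ((univ.filter fun r => Heavy T col (W u) u r ∨ Hit col (W u \ U) ω (col u r)).card : ℝ)
      ≤ 0.257 * R ∧
  ((univ.filter fun r => Hit col (U.filter fun w => w < u) ω (col u r)).card : ℝ) ≤ 0.023 * R

section Update

variable {T col S W U} {u v : V}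

lemma hit_outside_update (hv : v ∈ U) (ω : V → Fin R) (y : Fin R) (c : ℕ) :
    Hit col (W u \ U) (Function.update ω v y) c ↔ Hit col (W u \ U) ω c :=
  hit_update col (fun h => (mem_sdiff.1 h).2 hv) ω y c

lemma hit_earlier_update (huv : u ≤ v) (ω : V → Fin R) (y : Fin R) (c : ℕ) :
    Hit col (U.filter fun w => w < u) (Function.update ω v y) c
      ↔ Hit col (U.filter fun w => w < u) ω c :=
  hit_update col (show v ∉ U.filter fun w => w < u from
    fun h => absurd (mem_filter.1 h).2 (not_lt.2 huv)) ω y c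

lemma typical_update (hv : v ∈ U) (huv : u ≤ v) (ω : V → Fin R) (y : Fin R) :
    Typical T col W U (Function.update ω v y) u ↔ Typical T col W U ω u := by
  simp only [Typical, hit_outside_update hv, hit_earlier_update huv]

lemma blockedOutside_update_of_lt (hv : v ∈ U) (huv : u < v) (ω : V → Fin R) (y : Fin R) :
    BlockedOutside T col S W U (Function.update ω v y) u ↔ BlockedOutside T col S W U ω u := by
  simp only [BlockedOutside, hit_outside_update hv, Function.update_of_ne huv.ne]

lemma repeats_update_of_lt (huv : u < v) (ω : V → Fin R) (y : Fin R) :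
    Repeats col U (Function.update ω v y) u ↔ Repeats col U ω u := by
  simp only [Repeats, hit_earlier_update huv.le, Function.update_of_ne huv.ne]

lemma pr_blockedOutside_le [NeZero R] (hu : u ∈ U) (hB : FewInside col S u) {ω : V → Fin R}
    (h : Typical T col W U ω u) :
    pr (fun y => BlockedOutside T col S W U (Function.update ω u y) u) ≤ 0.63 := by
  have hR : (0 : ℝ) < R := by exact_mod_cast Nat.pos_of_ne_zero (NeZero.ne R)
  simp only [BlockedOutside, hit_outside_update hu, Function.update_self]
  refine (pr_or_le _ _).trans ?_
  rw [pr_eq_card_div, pr_eq_card_div, Fintype.card_fin, ← add_div, div_le_iff₀ hR]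
  have h1 := h.1
  rw [FewInside] at hB
  linarith

lemma pr_repeats_le [NeZero R] {ω : V → Fin R} (h : Typical T col W U ω u) :
    pr (fun y => Repeats col U (Function.update ω u y) u) ≤ 0.023 := by
  have hR : (0 : ℝ) < R := by exact_mod_cast Nat.pos_of_ne_zero (NeZero.ne R)
  simp only [Repeats, hit_earlier_update le_rfl, Function.update_self]
  rw [pr_eq_card_div, Fintype.card_fin, div_le_iff₀ hR]
  exact h.2

end Update

/-- The moment generating function of the number of nodes that are blocked, with repetitions
counted twice, restricted to typical situations. -/
lemma expect_exp_bad_le [Fintype V] [NeZero R] (hB : ∀ u ∈ U, FewInside col S u) :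
    𝔼 ω : V → Fin R, ∏ u ∈ U, Real.exp (0.1 *
      (ind (Typical T col W U ω u ∧ BlockedOutside T col S W U ω u)
        + 2 * ind (Typical T col W U ω u ∧ Repeats col U ω u))) ≤ ∏ _u ∈ U, Real.exp 0.0744 := by
  refine expect_prod_le U (fun u => (univ.filter fun w => w < u).card) strictMono_card_lt.injective
    (fun u ω => Real.exp (0.1 * (ind (Typical T col W U ω u ∧ BlockedOutside T col S W U ω u)
        + 2 * ind (Typical T col W U ω u ∧ Repeats col U ω u)))) _
    (fun u ω => (Real.exp_pos _).le) (fun u hu v hv huv ω y => ?_) (fun u hu ω => ?_)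
  · have huv' : u < v := strictMono_card_lt.lt_iff_lt.1 huv
    simp only [typical_update hv huv'.le, blockedOutside_update_of_lt hv huv',
      repeats_update_of_lt huv']
  · simp only [typical_update hu le_rfl]
    by_cases h : Typical T col W U ω u
    · simp only [h, true_and]
      refine (expect_mono fun y => exp_two_indicators_le _ _).trans ?_
      rw [Finset.expect_add_distrib, Finset.expect_add_distrib, Fintype.expect_one,
        ← Finset.mul_expect, ← Finset.mul_expect]
      have h1 := pr_blockedOutside_le hu (hB u hu) h
      have h2 := pr_repeats_le h
      have h3 := Real.add_one_le_exp 0.0744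
      unfold pr at h1 h2
      simp only [ind]
      linarith
    · simp only [h, false_and, ind, if_false]
      rw [Fintype.expect_const]
      exact Real.exp_le_exp.2 (by norm_num)

lemma pr_typical_few_ok_le [Fintype V] [NeZero R] (hW : ∀ u ∈ U, u ∉ W u)
    (hB : ∀ u ∈ U, FewInside col S u) :
    pr (fun ω : V → Fin R => (∀ u ∈ U, Typical T col W U ω u) ∧
      ((U.filter fun u => Ok T col S (W u) ω u).card : ℝ) < 0.22 * U.card)
      ≤ Real.exp (-(0.003 * U.card)) := by
  refine (pr_le_expect_div (t := Real.exp (0.078 * U.card))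
    (fun ω => Finset.prod_nonneg fun u _ => (Real.exp_pos _).le)
    (Real.exp_pos _) (fun ω hω => ?_)).trans
      (div_le_of_le_mul₀ (Real.exp_pos _).le (Real.exp_pos _).le
        ((expect_exp_bad_le T col S W U hB).trans ?_))
  · have h1 : ∏ u ∈ U, Real.exp (0.1 *
        (ind (Typical T col W U ω u ∧ BlockedOutside T col S W U ω u)
          + 2 * ind (Typical T col W U ω u ∧ Repeats col U ω u)))
        = Real.exp (0.1 * (((U.filter fun u => BlockedOutside T col S W U ω u).card : ℝ)
          + 2 * (U.filter fun u => Repeats col U ω u).card)) := by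
      have hind : ∀ p : V → Prop,
          ∑ u ∈ U, ind (Typical T col W U ω u ∧ p u) = ((U.filter p).card : ℝ) := fun p => by
        rw [← Finset.sum_boole]
        exact Finset.sum_congr rfl fun u hu => by simp only [ind, hω.1 u hu, true_and]
      rw [← Real.exp_sum, ← Finset.mul_sum, Finset.sum_add_distrib, ← Finset.mul_sum,
        hind, hind]
    rw [h1]
    refine Real.exp_le_exp.2 ?_
    have h2 : ((U.filter fun u => ¬ Ok T col S (W u) ω u).card : ℝ) ≤
        (U.filter fun u => BlockedOutside T col S W U ω u).card
          + 2 * (U.filter fun u => Repeats col U ω u).card := by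
      exact_mod_cast card_not_ok_le T col S W U hW ω
    have h3 : ((U.filter fun u => Ok T col S (W u) ω u).card : ℝ)
        + (U.filter fun u => ¬ Ok T col S (W u) ω u).card = U.card := by
      exact_mod_cast Finset.card_filter_add_card_filter_not (s := U)
        (fun u => Ok T col S (W u) ω u)
    linarith [hω.2]
  · rw [← Real.exp_add, Finset.prod_const, ← Real.exp_nat_mul]
    refine Real.exp_le_exp.2 ?_
    have : (0 : ℝ) ≤ U.card := Nat.cast_nonneg _
    linarith

/-- For windows that pass the tests, all but an exponentially small fraction of the choices of one
candidate color per node leave at least `0.22` of the nodes of `U` successful.  The nodes of `U` are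
exposed one after the other, after all others; for each, the probability to be blocked from outside
is at most `0.257 + 0.373`, and the probability to repeat a color is at most `0.023`. -/
lemma pr_few_ok_le [Fintype V] [NeZero R] {δ : ℝ} (hW : ∀ u ∈ U, u ∉ W u)
    (hA : ∀ u ∈ U, FewBlocked δ T col (W u) u) (hB : ∀ u ∈ U, FewInside col S u)
    (hC : ∀ u ∈ U, FewRepeated δ col (U.erase u) u) :
    pr (fun ω : V → Fin R =>
      ((U.filter fun u => Ok T col S (W u) ω u).card : ℝ) < 0.22 * U.card)
      ≤ Real.exp (-(0.003 * U.card)) + 2 * U.card * δ := by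
  have hexc : ∀ u ∈ U, pr (fun ω : V → Fin R => ¬ Typical T col W U ω u) ≤ 2 * δ := by
    intro u hu
    have h1 : pr (fun ω : V → Fin R => 0.257 * (R : ℝ) < ((univ.filter fun r =>
        Heavy T col (W u) u r ∨ Hit col (W u \ U) ω (col u r)).card : ℝ)) ≤ δ := by
      have := hA u hu
      rw [FewBlocked] at this
      refine le_trans (pr_mono fun ω h => h.trans_le ?_) this
      exact Nat.cast_le.2 (card_le_card (Finset.monotone_filter_right _ fun r _ hr =>
        hr.imp_right (Hit.mono sdiff_subset)))
    have h2 : pr (fun ω : V → Fin R => 0.023 * (R : ℝ) < ((univ.filter fun r =>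
        Hit col (U.filter fun w => w < u) ω (col u r)).card : ℝ)) ≤ δ := by
      have := hC u hu
      rw [FewRepeated] at this
      refine le_trans (pr_mono fun ω h => h.trans_le ?_) this
      exact Nat.cast_le.2 (card_le_card (Finset.monotone_filter_right _ fun r _ hr =>
        hr.mono fun w hw => mem_erase.2 ⟨(mem_filter.1 hw).2.ne, (mem_filter.1 hw).1⟩))
    refine le_trans (pr_mono fun ω h => ?_) ((pr_or_le _ _).trans
      ((add_le_add h1 h2).trans_eq (two_mul δ).symm))
    rw [Typical, not_and_or, not_le, not_le] at h
    exact h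
  refine (pr_mono (q := fun ω => ((∀ u ∈ U, Typical T col W U ω u) ∧
      ((U.filter fun u => Ok T col S (W u) ω u).card : ℝ) < 0.22 * U.card) ∨
      ∃ u ∈ U, ¬ Typical T col W U ω u) fun ω hω => ?_).trans
    ((pr_or_le _ _).trans (add_le_add (pr_typical_few_ok_le T col S W U hW hB)
      ((pr_exists_le U _).trans ((Finset.sum_le_sum hexc).trans_eq ?_))))
  · by_cases h : ∀ u ∈ U, Typical T col W U ω u
    · exact Or.inl ⟨h, hω⟩
    · right
      push Not at h
      exact h
  · rw [Finset.sum_const, nsmul_eq_mul]; ring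

end Concentration

end Windows

/-! ### Random windows pass the tests -/

section RandomWindows

variable {V : Type*} [DecidableEq V] {R M : ℕ}

/-- The candidate colors of the nodes when `F (w, r)` is the hash value for the `r`-th candidate
color of `w`. -/
noncomputable def window (Ψ : V → Finset ℕ) (F : V × Fin R → Fin M) (w : V) (r : Fin R) : ℕ :=
  hashColor (F (w, r)) (Ψ w)

lemma image_window_update {Ψ : V → Finset ℕ} {u : V} {W : Finset V} (huW : u ∉ W)
    (ω : V → Fin R) (F : V × Fin R → Fin M) (r : Fin R)
    (y : Fin M) :
    W.image (fun w => window Ψ (Function.update F (u, r) y) w (ω w))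
      = W.image fun w => window Ψ F w (ω w) := by
  refine Finset.image_congr fun w hw => ?_
  have : (w, ω w) ≠ (u, r) := fun h => huW (by
    have h' : w = u := (Prod.ext_iff.1 h).1
    exact h' ▸ hw)
  simp only [window, Function.update_of_ne this]

variable [Fintype V]

/-- A set of at most a `q` fraction of the palette of `u`, chosen independently of the window of
`u`, contains at most a `q + 0.006` fraction of this window. -/
lemma pr_window_le [NeZero R] [NeZero M] (Ψ : V → Finset ℕ) (u : V)
    (S : (V × Fin R → Fin M) → Finset ℕ) (hS : ∀ F r y, S (Function.update F (u, r) y) = S F)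
    {q : ℝ} (hq : q ≤ 1) (hcard : ∀ F, ((S F).card : ℝ) ≤ q * (Ψ u).card)
    (hP : 0 < (Ψ u).card) (hM : 1000 * (Ψ u).card ≤ M) :
    pr (fun F : V × Fin R → Fin M => (q + 0.006) * (R : ℝ) <
      ((univ.filter fun r => window Ψ F u r ∈ S F).card : ℝ)) ≤ Real.exp (-(6e-6 * R)) := by
  let J : Finset (V × Fin R) := univ.image fun r => (u, r)
  have hJ : ∀ i ∈ J, i.1 = u := fun i hi => by
    obtain ⟨r, -, rfl⟩ := mem_image.1 hi; rfl
  have hmem : ∀ i ∈ J, i = (u, i.2) := fun i hi => Prod.ext (hJ i hi) rfl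
  have hprod := expect_prod_le_of_indep J
    (fun i F => Real.exp (0.0025 * if hashColor (F i) (Ψ u) ∈ S F then 1 else 0))
    (fun _ => Real.exp ((q + 0.001) * (Real.exp 0.0025 - 1)))
    (fun i F => (Real.exp_pos _).le)
    (fun i hi j hj hij F y => by
      rw [Function.update_of_ne hij, hmem j hj, hS])
    (fun i hi F => by
      simp only [Function.update_self]
      rw [hmem i hi]
      simp only [hS]
      exact expect_exp_indicator_le (l := 0.0025) (pr_hashColor_mem_le hP hM hq (hcard F))
        (by norm_num))
  have hsum : ∀ F : V × Fin R → Fin M, ∏ i ∈ J,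
      Real.exp (0.0025 * if hashColor (F i) (Ψ u) ∈ S F then 1 else 0)
      = Real.exp (0.0025 * ((univ.filter fun r => window Ψ F u r ∈ S F).card : ℝ)) := fun F => by
    rw [← Real.exp_sum, ← Finset.mul_sum, Finset.sum_image (fun r _ r' _ h => (Prod.ext_iff.1 h).2),
      ← Finset.sum_boole]
    rfl
  simp only [hsum, Finset.prod_const] at hprod
  have hJc : J.card = R := by
    rw [Finset.card_image_of_injective _ (fun r r' h => (Prod.ext_iff.1 h).2), card_univ,
      Fintype.card_fin]
  rw [hJc, ← Real.exp_nat_mul] at hprod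
  refine (pr_le_exp_mul (by norm_num) (fun F h => h.le) hprod).trans ?_
  rw [← Real.exp_add]
  refine Real.exp_le_exp.2 ?_
  have h1 := exp_sub_one_le (l := 0.0025) (by norm_num) (by norm_num)
  have hq' : 0 ≤ q + 0.001 := by
    obtain ⟨F⟩ : Nonempty (V × Fin R → Fin M) := inferInstance
    have hP' : (0 : ℝ) < (Ψ u).card := by exact_mod_cast hP
    have : 0 ≤ q := by
      by_contra hneg
      have := hcard F
      nlinarith [Nat.cast_nonneg (α := ℝ) (S F).card]
    linarith
  have h2 : (q + 0.001) * (Real.exp 0.0025 - 1) ≤ (q + 0.001) * (0.0025 + 0.0025 ^ 2) :=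
    mul_le_mul_of_nonneg_left h1 hq'
  have hR : (0 : ℝ) ≤ R := Nat.cast_nonneg _
  have h3 : (q + 0.001) * (Real.exp 0.0025 - 1) - 0.0025 * (q + 0.006) ≤ -6e-6 := by
    nlinarith
  nlinarith [mul_le_mul_of_nonneg_left h3 hR]

/-- A heavy color is picked almost certainly. -/
lemma pr_not_hit_le [NeZero R] {T : ℕ} {col : V → Fin R → ℕ} {W : Finset V} {u : V} {r : Fin R}
    (h : Heavy T col W u r) :
    pr (fun ω : V → Fin R => ¬ Hit col W ω (col u r)) ≤ Real.exp (-T) := by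
  have hR : (0 : ℝ) < R := by exact_mod_cast Nat.pos_of_ne_zero (NeZero.ne R)
  let m : V → ℕ := fun w => (univ.filter fun r' => col w r' = col u r).card
  have hprod := expect_prod_le_of_indep W
    (fun w ω => if ¬ col w (ω w) = col u r then (1 : ℝ) else 0)
    (fun w => Real.exp (-((m w : ℝ) / R)))
    (fun w ω => by split_ifs <;> norm_num)
    (fun w hw w' hw' hne ω y => by simp only [Function.update_of_ne hne])
    (fun w hw ω => by
      simp only [Function.update_self]
      have h1 : ∀ y, (if ¬ col w y = col u r then (1 : ℝ) else 0)
          = 1 - if col w y = col u r then 1 else 0 := fun y => by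
        by_cases h : col w y = col u r <;> simp [h]
      simp only [h1]
      rw [Finset.expect_sub_distrib, Fintype.expect_one]
      have h2 := pr_eq_card_div fun y => col w y = col u r
      rw [pr, Fintype.card_fin] at h2
      have h3 := Real.add_one_le_exp (-((m w : ℝ) / R))
      have h4 : (m w : ℝ) / R = 𝔼 y, if col w y = col u r then (1 : ℝ) else 0 := by
        rw [Fintype.expect_eq_sum_div_card, Finset.sum_boole, Fintype.card_fin]
      linarith)
  have hpr : pr (fun ω : V → Fin R => ¬ Hit col W ω (col u r)) ≤
      𝔼 ω : V → Fin R, ∏ w ∈ W, if ¬ col w (ω w) = col u r then (1 : ℝ) else 0 := by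
    refine expect_mono fun ω => ?_
    by_cases hω : Hit col W ω (col u r)
    · simp only [hω, not_true, if_false]
      exact Finset.prod_nonneg fun w _ => by split_ifs <;> norm_num
    · rw [if_pos hω, Finset.prod_congr rfl (g := fun _ => (1 : ℝ)), Finset.prod_const_one]
      exact fun w hw => if_pos fun e => hω ⟨w, hw, e⟩
  refine hpr.trans (hprod.trans ?_)
  rw [← Real.exp_sum]
  refine Real.exp_le_exp.2 ?_
  rw [Finset.sum_neg_distrib, neg_le_neg_iff, ← Finset.sum_div, le_div_iff₀ hR]
  have hcard : (entries col W u r).card = ∑ w ∈ W, m w := by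
    rw [entries, Finset.card_filter, Finset.sum_product]
    exact Finset.sum_congr rfl fun w _ => by rw [← Finset.card_filter]
  rw [Heavy, hcard] at h
  exact_mod_cast h.le

lemma expect_pr_comm {Ω Ω' : Type*} [Fintype Ω] [Fintype Ω'] (p : Ω → Ω' → Prop) :
    𝔼 a, pr (p a) = 𝔼 b, pr fun a => p a b := by
  simp only [pr]
  exact Finset.expect_comm _ _ _

/-- Markov's inequality for a conditional probability. -/
lemma pr_lt_pr_le {Ω Ω' : Type*} [Fintype Ω] [Fintype Ω'] [Nonempty Ω'] (p : Ω → Ω' → Prop)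
    {δ e : ℝ} (hδ : 0 < δ) (h : ∀ b, pr (fun a => p a b) ≤ e) :
    pr (fun a => ¬ pr (p a) ≤ δ) ≤ e / δ := by
  refine (pr_le_expect_div (X := fun a => pr (p a)) (fun a => pr_nonneg _) hδ
    (fun a ha => (not_le.1 ha).le)).trans ?_
  rw [expect_pr_comm]
  refine div_le_div_of_nonneg_right ?_ hδ.le
  calc _ ≤ 𝔼 _b : Ω', e := expect_mono h
    _ = e := Fintype.expect_const e

variable {Ψ : V → Finset ℕ} {u : V} {W : Finset V}

variable [NeZero R] [NeZero M]

/-- The constant is `0.023 = 0.017 + 0.006`; in the application, `u` has about `60` times as many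
colors as `W` has nodes. -/
lemma pr_not_fewRepeated_le {δ : ℝ} (hδ : 0 < δ) (huW : u ∉ W) (hP : 0 < (Ψ u).card)
    (hM : 1000 * (Ψ u).card ≤ M) (hW : (W.card : ℝ) ≤ 0.017 * (Ψ u).card) :
    pr (fun F : V × Fin R → Fin M => ¬ FewRepeated δ (window Ψ F) W u)
      ≤ Real.exp (-(6e-6 * R)) / δ := by
  refine pr_lt_pr_le _ hδ fun ω => ?_
  refine le_trans (pr_mono fun F h => ?_) (pr_window_le Ψ u
    (fun F => W.image fun w => window Ψ F w (ω w)) (image_window_update huW ω) (q := 0.017)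
    (by norm_num) (fun F => ?_) hP hM)
  · refine lt_of_le_of_lt (le_of_eq (by norm_num)) (h.trans_le ?_)
    exact Nat.cast_le.2 (card_le_card (Finset.monotone_filter_right _ fun r _ hr => by
      obtain ⟨w, hw, e⟩ := hr
      exact mem_image.2 ⟨w, hw, e⟩))
  · exact le_trans (Nat.cast_le.2 card_image_le) hW

/-- The constants are `0.367 > 1.1 / 3` and `0.373 = 0.367 + 0.006`. -/
lemma pr_not_fewInside_le {S : Finset ℕ} (hP : 0 < (Ψ u).card)
    (hM : 1000 * (Ψ u).card ≤ M) (hS : 3 * (S.card : ℝ) ≤ 1.1 * (Ψ u).card) :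
    pr (fun F : V × Fin R → Fin M => ¬ FewInside (window Ψ F) S u)
      ≤ Real.exp (-(6e-6 * R)) := by
  refine le_trans (pr_mono fun F h => ?_) (pr_window_le Ψ u
    (fun _ => S) (fun _ _ _ => rfl) (q := 0.367)
    (by norm_num) (fun F => ?_) hP hM)
  · exact lt_of_le_of_lt (le_of_eq (by norm_num)) (not_le.1 h)
  · have : (0 : ℝ) ≤ (Ψ u).card := Nat.cast_nonneg _
    linarith

/-- The nodes of `W` block at most `0.251` of the palette of `u`, hence `0.257 = 0.251 + 0.006` of
its window; heavy colors that are not picked are exceptional. -/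
lemma pr_not_fewBlocked_le {δ : ℝ} {T : ℕ} (hδ : 0 < δ) (huW : u ∉ W) (hP : 0 < (Ψ u).card)
    (hM : 1000 * (Ψ u).card ≤ M) (hW : (W.card : ℝ) ≤ 0.251 * (Ψ u).card) :
    pr (fun F : V × Fin R → Fin M => ¬ FewBlocked δ T (window Ψ F) W u)
      ≤ (Real.exp (-(6e-6 * R)) + R * Real.exp (-T)) / δ := by
  let p : (V × Fin R → Fin M) → (V → Fin R) → Prop := fun F ω => 0.257 * (R : ℝ) <
    ((univ.filter fun r => Heavy T (window Ψ F) W u r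
      ∨ Hit (window Ψ F) W ω (window Ψ F u r)).card : ℝ)
  let p₁ : (V × Fin R → Fin M) → (V → Fin R) → Prop := fun F ω => 0.257 * (R : ℝ) <
    ((univ.filter fun r => Hit (window Ψ F) W ω (window Ψ F u r)).card : ℝ)
  have h1 : ∀ ω, pr (fun F => p₁ F ω) ≤ Real.exp (-(6e-6 * R)) := fun ω => by
    refine le_trans (pr_mono fun F h => ?_) (pr_window_le Ψ u
      (fun F => W.image fun w => window Ψ F w (ω w)) (image_window_update huW ω) (q := 0.251)
      (by norm_num) (fun F => ?_) hP hM)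
    · refine lt_of_le_of_lt (le_of_eq (by norm_num)) (h.trans_le ?_)
      exact Nat.cast_le.2 (card_le_card (Finset.monotone_filter_right _ fun r _ hr => by
        obtain ⟨w, hw, e⟩ := hr
        exact mem_image.2 ⟨w, hw, e⟩))
    · exact le_trans (Nat.cast_le.2 card_image_le) hW
  have h2 : ∀ F, pr (p F) ≤ pr (p₁ F) + R * Real.exp (-T) := fun F => by
    refine (pr_mono (q := fun ω => p₁ F ω ∨ ∃ r ∈ (univ : Finset (Fin R)),
      (Heavy T (window Ψ F) W u r ∧ ¬ Hit (window Ψ F) W ω (window Ψ F u r)))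
      fun ω h => ?_).trans ((pr_or_le _ _).trans (add_le_add_right ((pr_exists_le _ _).trans ?_) _))
    · by_cases hr : ∃ r ∈ (univ : Finset (Fin R)),
        (Heavy T (window Ψ F) W u r ∧ ¬ Hit (window Ψ F) W ω (window Ψ F u r))
      · exact Or.inr hr
      · left
        push Not at hr
        refine lt_of_lt_of_le h (Nat.cast_le.2 (card_le_card
          (Finset.monotone_filter_right _ fun r _ h' => ?_)))
        exact h'.elim (hr r (mem_univ _)) id
    · calc _ ≤ ∑ _r : Fin R, Real.exp (-(T : ℝ)) := Finset.sum_le_sum fun r _ => by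
            by_cases hh : Heavy T (window Ψ F) W u r
            · exact (pr_mono fun ω h => h.2).trans (pr_not_hit_le hh)
            · simp only [hh, false_and, pr, if_false]
              rw [Finset.expect_const_zero]
              exact (Real.exp_pos _).le
        _ = _ := by rw [Finset.sum_const, card_univ, Fintype.card_fin, nsmul_eq_mul]
  refine (pr_le_expect_div (X := fun F => pr (p F)) (fun F => pr_nonneg _) hδ
    (fun F hF => (not_le.1 hF).le)).trans (div_le_div_of_nonneg_right ?_ hδ.le)
  calc 𝔼 F, pr (p F) ≤ 𝔼 F, (pr (p₁ F) + R * Real.exp (-T)) := expect_mono h2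
    _ = 𝔼 F, pr (p₁ F) + R * Real.exp (-T) := by
        rw [Finset.expect_add_distrib, Fintype.expect_const]
    _ ≤ _ := by
        refine add_le_add_left ?_ _
        rw [expect_pr_comm]
        calc _ ≤ 𝔼 _ω : V → Fin R, Real.exp (-(6e-6 * R)) := expect_mono h1
          _ = _ := Fintype.expect_const _

end RandomWindows

/-! ### Random nominations -/

section Nomination

variable {V : Type*} [Fintype V] [DecidableEq V] {R M : ℕ} [NeZero M]

lemma pr_hashNominates (hM : 4 ∣ M) : pr (fun y : Fin M => hashNominates y) = 1 / 4 := by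
  obtain ⟨k, rfl⟩ := hM
  have hk : 0 < k := by have := NeZero.ne (4 * k); omega
  rw [pr_eq_card_div, Fintype.card_fin]
  have : (univ.filter fun y : Fin (4 * k) => hashNominates y).card = k := by
    have h : (univ.filter fun y : Fin (4 * k) => hashNominates y)
        = univ.filter fun y : Fin (4 * k) => (y : ℕ) < k := by
      ext y; simp [hashNominates]
    rw [h, Fin.card_filter_val_lt]
    omega
  rw [this]
  push_cast
  have : (k : ℝ) ≠ 0 := by exact_mod_cast hk.ne'
  field_simp

/-- The centered indicator of a nomination has variance `3 / 16`. -/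
lemma expect_exp_nominates_le (hM : 4 ∣ M) {l : ℝ} (hl : |l| ≤ 1) :
    𝔼 y : Fin M, Real.exp (l * ((if hashNominates y then 1 else 0) - 1 / 4))
      ≤ Real.exp (3 / 16 * l ^ 2) := by
  have hb : ∀ x : ℝ, |x| ≤ 1 → Real.exp x ≤ 1 + x + x ^ 2 := fun x hx => by
    linarith [(abs_le.1 (Real.abs_exp_sub_one_sub_id_le hx)).2]
  have hc : ∀ y : Fin M, Real.exp (l * ((if hashNominates y then 1 else 0) - 1 / 4))
      ≤ (1 - l / 4 + l ^ 2 / 16) + (if hashNominates y then 1 else 0) * (l + l ^ 2 / 2) := by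
    intro y
    have hl' := abs_le.1 hl
    by_cases h : hashNominates y
    · simp only [h, if_true]
      refine (hb _ (abs_le.2 ⟨by linarith, by linarith⟩)).trans (le_of_eq (by ring))
    · simp only [h, if_false]
      refine (hb _ (abs_le.2 ⟨by linarith, by linarith⟩)).trans (le_of_eq (by ring))
  refine (expect_mono hc).trans ?_
  rw [Finset.expect_add_distrib, Fintype.expect_const, ← Finset.expect_mul]
  have h := pr_hashNominates (M := M) hM
  rw [pr] at h
  rw [h]
  linarith [Real.add_one_le_exp (3 / 16 * l ^ 2)]

/-- The number of nominated nodes of `N` when `F (w, r)` are the possible hash values of `w`, of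
which the one at `r = ω w` is used. -/
noncomputable def nominated (F : V × Fin R → Fin M) (ω : V → Fin R) (N : Finset V) : ℕ :=
  (N.filter fun w => hashNominates (F (w, ω w))).card

lemma expect_exp_nominated_le (hM : 4 ∣ M) (ω : V → Fin R) (N : Finset V) {l : ℝ} (hl : |l| ≤ 1) :
    𝔼 F : V × Fin R → Fin M, Real.exp (l * ((nominated F ω N : ℝ) - 1 / 4 * N.card))
      ≤ Real.exp (3 / 16 * l ^ 2 * N.card) := by
  have hprod := expect_prod_le_of_indep (N.image fun w => (w, ω w))
    (fun i (F : V × Fin R → Fin M) =>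
      Real.exp (l * ((if hashNominates (F i) then 1 else 0) - 1 / 4)))
    (fun _ => Real.exp (3 / 16 * l ^ 2)) (fun i F => (Real.exp_pos _).le)
    (fun i _ j _ hij F y => by simp only [Function.update_of_ne hij])
    (fun i _ F => by
      simp only [Function.update_self]
      exact expect_exp_nominates_le hM hl)
  have hinj : Set.InjOn (fun w => (w, ω w)) (N : Set V) := fun w _ w' _ h => (Prod.ext_iff.1 h).1
  have hsum : ∀ F : V × Fin R → Fin M, ∏ i ∈ N.image (fun w => (w, ω w)),
      Real.exp (l * ((if hashNominates (F i) then 1 else 0) - 1 / 4))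
      = Real.exp (l * ((nominated F ω N : ℝ) - 1 / 4 * N.card)) := fun F => by
    rw [← Real.exp_sum, ← Finset.mul_sum, Finset.sum_image hinj, Finset.sum_sub_distrib,
      Finset.sum_boole, Finset.sum_const, nominated, nsmul_eq_mul, mul_comm (1 / 4 : ℝ)]
  simp only [hsum] at hprod
  refine hprod.trans_eq ?_
  rw [Finset.prod_const, card_image_of_injOn hinj, ← Real.exp_nat_mul]
  congr 1; ring

lemma exp_neg_rpow_le {p : ℝ} (hp : 1 ≤ p) : Real.exp (-(13 / 16 * p ^ (0.4 : ℝ))) ≤ 12 / p := by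
  have hp0 : 0 < p := by linarith
  set x := p ^ (0.4 : ℝ) with hx
  have hx0 : 0 < x := Real.rpow_pos_of_pos hp0 _
  have hx3 : p ≤ x ^ 3 := by
    rw [hx, ← Real.rpow_natCast, ← Real.rpow_mul hp0.le]
    calc p = p ^ (1 : ℝ) := (Real.rpow_one p).symm
      _ ≤ _ := Real.rpow_le_rpow_of_exponent_le hp (by norm_num)
  have h := Real.pow_div_factorial_le_exp (13 / 16 * x) (by positivity) 3
  rw [Real.exp_neg, inv_le_comm₀ (Real.exp_pos _) (by positivity), inv_div]
  refine le_trans ?_ h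
  rw [mul_pow]
  norm_num [Nat.factorial]
  linarith

/-- The deviation of the number of nominations allowed in the nomination step is exceeded with
probability `O(1 / p)`, in either direction. -/
lemma pr_nominated_le (hM : 4 ∣ M) (ω : V → Fin R) (N : Finset V) {p : ℝ} (hp : 1 ≤ p)
    (hN : (N.card : ℝ) ≤ p) :
    pr (fun F : V × Fin R → Fin M =>
        1 / 4 * (N.card : ℝ) + p ^ (0.7 : ℝ) < nominated F ω N) ≤ 12 / p ∧
    pr (fun F : V × Fin R → Fin M =>
        (nominated F ω N : ℝ) < 1 / 4 * (N.card : ℝ) - p ^ (0.7 : ℝ)) ≤ 12 / p := by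
  have hp0 : 0 < p := by linarith
  set l := p ^ (-0.3 : ℝ) with hl
  have hl0 : 0 < l := Real.rpow_pos_of_pos hp0 _
  have hl1 : l ≤ 1 := Real.rpow_le_one_of_one_le_of_nonpos hp (by norm_num)
  have hlt : l * p ^ (0.7 : ℝ) = p ^ (0.4 : ℝ) := by
    rw [hl, ← Real.rpow_add hp0]; norm_num
  have hl2 : l ^ 2 * N.card ≤ p ^ (0.4 : ℝ) := by
    calc l ^ 2 * N.card ≤ l ^ 2 * p := mul_le_mul_of_nonneg_left hN (by positivity)
      _ = p ^ (0.4 : ℝ) := by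
        rw [hl, ← Real.rpow_natCast, ← Real.rpow_mul hp0.le]
        nth_rewrite 2 [← Real.rpow_one p]
        rw [← Real.rpow_add hp0]; norm_num
  have hfin : Real.exp (-(l * p ^ (0.7 : ℝ))) * Real.exp (3 / 16 * l ^ 2 * N.card) ≤ 12 / p := by
    refine le_trans ?_ (exp_neg_rpow_le hp)
    rw [← Real.exp_add, hlt]
    refine Real.exp_le_exp.2 ?_
    linarith
  constructor
  · refine (pr_le_exp_mul hl0.le (fun F h => ?_) (expect_exp_nominated_le hM ω N
      (abs_le.2 ⟨by linarith, hl1⟩))).trans hfin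
    linarith
  · have h := expect_exp_nominated_le (R := R) hM ω N (l := -l)
      (abs_le.2 ⟨by linarith, by linarith⟩)
    rw [neg_sq] at h
    refine (pr_le_exp_mul (X := fun F => 1 / 4 * (N.card : ℝ) - nominated F ω N) hl0.le
      (fun F h => ?_) (le_trans (le_of_eq ?_) h)).trans hfin
    · linarith
    · congr 1; funext F; congr 1; ring

end Nomination

/-! ### Knowledge in the congested clique -/

section Knowledge

variable {n B : ℕ} {In I : Type}

/-- Some algorithm makes every node `v` output `f i v` after `r` rounds, on every input `loc i`. -/
def Knows (B : ℕ) (loc : I → Fin n → In) (r : ℕ) {α : Type} (f : I → Fin n → α) : Prop :=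
  ∃ P : CliqueAlgorithm n B In α, ∀ i v, P.outputAfter (loc i) r v = f i v

/-- What each node can say about `g` depends only on what it can say about `f`. -/
def Determines {α β : Type*} (f : I → Fin n → α) (g : I → Fin n → β) : Prop :=
  ∀ i j v, f i v = f j v → g i v = g j v

lemma Determines.exists_map {α β : Type*} [Nonempty β] {f : I → Fin n → α} {g : I → Fin n → β}
    (h : Determines f g) : ∃ φ : Fin n → α → β, ∀ i v, φ v (f i v) = g i v := by
  refine ⟨fun v a => if hi : ∃ i, f i v = a then g hi.choose v else Classical.arbitrary β,
    fun i v => ?_⟩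
  have hi : ∃ j, f j v = f i v := ⟨i, rfl⟩
  simp only [hi, dif_pos]
  exact h _ _ v hi.choose_spec

variable {loc : I → Fin n → In}

lemma Knows.input : Knows B loc 0 loc :=
  ⟨{ State := In
     init := fun _ x => x
     send := fun _ _ _ _ => false
     receive := fun _ x _ => x
     output := fun _ x => x }, fun _ _ => rfl⟩

/-- Local computation takes no rounds. -/
lemma Knows.map {r : ℕ} {α β : Type} {f : I → Fin n → α} (hf : Knows B loc r f)
    (φ : Fin n → α → β) : Knows B loc r fun i v => φ v (f i v) := by
  obtain ⟨P, hP⟩ := hf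
  let Q : CliqueAlgorithm n B In β :=
    { State := P.State
      init := P.init
      send := P.send
      receive := P.receive
      output := fun v s => φ v (P.output v s) }
  refine ⟨Q, fun i v => ?_⟩
  have hs : ∀ r v, Q.stateAfter (loc i) r v = P.stateAfter (loc i) r v := by
    intro r
    induction r with
    | zero => exact fun v => rfl
    | succ r ih =>
      intro v
      simp only [CliqueAlgorithm.stateAfter, ih]
      rfl
  change _ = φ v (f i v)
  rw [← hP, CliqueAlgorithm.outputAfter, hs]
  rfl

lemma Knows.of_determines {r : ℕ} {α β : Type} [Nonempty β] {f : I → Fin n → α}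
    {g : I → Fin n → β} (hf : Knows B loc r f) (h : Determines f g) : Knows B loc r g := by
  obtain ⟨φ, hφ⟩ := h.exists_map
  have := hf.map φ
  simp only [hφ] at this
  exact this

/-- A finite set of at most `2 ^ B` messages can be encoded in `B` bits. -/
lemma exists_code {β : Type*} [Nonempty β] (E : Finset β) (hE : E.card ≤ 2 ^ B) :
    ∃ (enc : β → Fin B → Bool) (dec : (Fin B → Bool) → β), ∀ x ∈ E, dec (enc x) = x := by
  have hcard : Fintype.card E ≤ Fintype.card (Fin B → Bool) := by simpa using hE
  obtain ⟨e⟩ := Function.Embedding.nonempty_of_card_le hcard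
  let enc : β → Fin B → Bool := fun x => if h : x ∈ E then e ⟨x, h⟩ else fun _ => false
  have hinj : Set.InjOn enc E := by
    intro x hx y hy hxy
    simp only [enc, mem_coe.1 hx, mem_coe.1 hy, dif_pos] at hxy
    exact congrArg Subtype.val (e.injective hxy)
  exact ⟨enc, Function.invFunOn enc E, fun x hx => hinj.leftInvOn_invFunOn hx⟩

/-- One round: every node `u` sends to every node `v` a message `m i u v` out of a set of at most
`2 ^ B` messages. -/
lemma Knows.round {r : ℕ} {α β : Type} [Nonempty β] {f : I → Fin n → α} (hf : Knows B loc r f)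
    {m : I → Fin n → Fin n → β} (hm : Determines f m) (E : Finset β) (hE : E.card ≤ 2 ^ B)
    (hmE : ∀ i u v, m i u v ∈ E) :
    Knows B loc (r + 1) fun i v => (f i v, fun u => m i u v) := by
  obtain ⟨P, hP⟩ := hf
  obtain ⟨φ, hφ⟩ := hm.exists_map
  obtain ⟨enc, dec, hcode⟩ := exists_code E hE
  -- The algorithm counts the rounds, follows `P` for `r` of them, and stores the messages of the
  -- next one.
  let Q : CliqueAlgorithm n B In (α × (Fin n → β)) :=
    { State := (ℕ × P.State) × (Fin n → Fin B → Bool)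
      init := fun v x => ((0, P.init v x), fun _ _ => false)
      send := fun u s v => if s.1.1 < r then P.send u s.1.2 v else enc (φ u (P.output u s.1.2) v)
      receive := fun v s x => if s.1.1 < r then ((s.1.1 + 1, P.receive v s.1.2 x), s.2)
        else (s.1, x)
      output := fun v s => (P.output v s.1.2, fun u => dec (s.2 u)) }
  refine ⟨Q, fun i v => ?_⟩
  have hs : ∀ k, k ≤ r → ∀ v, Q.stateAfter (loc i) k v
      = ((k, P.stateAfter (loc i) k v), fun _ _ => false) := by
    intro k
    induction k with
    | zero => exact fun _ v => rfl
    | succ k ih =>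
      intro hk v
      have hk' : k < r := hk
      simp only [CliqueAlgorithm.stateAfter, ih hk'.le]
      simp only [Q, hk', if_true]
  have hlast : Q.stateAfter (loc i) (r + 1) v
      = ((r, P.stateAfter (loc i) r v), fun u => enc (m i u v)) := by
    simp only [CliqueAlgorithm.stateAfter, hs r le_rfl]
    simp only [Q, lt_irrefl, if_false]
    have : ∀ u, P.output u (P.stateAfter (loc i) r u) = f i u := hP i
    simp only [this, hφ]
  simp only [CliqueAlgorithm.outputAfter, hlast]
  simp only [Q, hcode _ (hmE i _ v)]
  exact Prod.ext (hP i v) rfl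

/-- One round in which every node sends the same message to all nodes. -/
lemma Knows.broadcast {r : ℕ} {α β : Type} [Nonempty β] {f : I → Fin n → α} (hf : Knows B loc r f)
    {m : I → Fin n → β} (hm : Determines f m) (E : Finset β) (hE : E.card ≤ 2 ^ B)
    (hmE : ∀ i u, m i u ∈ E) : Knows B loc (r + 1) fun i v => (f i v, m i) :=
  hf.round (m := fun i u _ => m i u) (fun i j v h => funext fun _ => hm i j v h) E hE
    fun i u _ => hmE i u

end Knowledge

/-! ### Relaying data to all neighbors -/

section LocalBroadcast

lemma card_powerset_filter_le {β : Type*} (E : Finset β) (k : ℕ) :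
    (E.powerset.filter fun X => X.card ≤ k).card ≤ (E.card + 1) ^ k := by
  -- A set of at most `k` elements is the range of a function on `Fin k` with possibly missing
  -- values.
  let g : (Fin k → Option E) → Finset β := fun x =>
    univ.biUnion fun j => ((x j).map fun e : E => ({(e : β)} : Finset β)).getD ∅
  have hsub : (E.powerset.filter fun X => X.card ≤ k) ⊆ univ.image g := by
    intro X hX
    obtain ⟨hXE, hXk⟩ := mem_filter.1 hX
    rw [mem_powerset] at hXE
    refine mem_image.2 ⟨fun j => if h : (j : ℕ) < X.card then
      some ⟨(X.equivFin.symm ⟨j, h⟩ : β), hXE (X.equivFin.symm ⟨j, h⟩).2⟩ else none,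
      mem_univ _, ?_⟩
    ext b
    simp only [g, mem_biUnion, mem_univ, true_and]
    constructor
    · rintro ⟨j, hj⟩
      by_cases h : (j : ℕ) < X.card
      · simp only [h, dif_pos, Option.map_some, Option.getD_some, mem_singleton] at hj
        rw [hj]; exact (X.equivFin.symm ⟨j, h⟩).2
      · simp [h] at hj
    · intro hb
      have hlt := (X.equivFin ⟨b, hb⟩).2
      refine ⟨⟨X.equivFin ⟨b, hb⟩, hlt.trans_le hXk⟩, ?_⟩
      simp
  refine (card_le_card hsub).trans (card_image_le.trans ?_)
  simp

/-- A set of at most `k * s` elements is a union of `s` sets of at most `k` elements. -/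
lemma exists_pieces {β : Type*} (X : Finset β) (k s : ℕ) (hX : X.card ≤ k * s) :
    ∃ c : ℕ → Finset β, (∀ j, c j ⊆ X) ∧ (∀ j, (c j).card ≤ k) ∧ ∀ x ∈ X, ∃ j < s, x ∈ c j := by
  rcases Nat.eq_zero_or_pos k with rfl | hk
  · refine ⟨fun _ => ∅, fun _ => empty_subset _, fun _ => by simp, fun x hx => ?_⟩
    have := Finset.card_pos.2 ⟨x, hx⟩
    omega
  let idx : X → ℕ := fun x => X.equivFin x
  refine ⟨fun j => X.filter fun x => ∃ h : x ∈ X, idx ⟨x, h⟩ / k = j, fun j => filter_subset _ _,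
    fun j => ?_, fun x hx => ⟨idx ⟨x, hx⟩ / k, ?_, mem_filter.2 ⟨hx, hx, rfl⟩⟩⟩
  · let idx' : β → ℕ := fun x => if h : x ∈ X then idx ⟨x, h⟩ else 0
    calc _ ≤ (Ico (j * k) (j * k + k)).card := ?_
      _ = k := by simp
    refine Finset.card_le_card_of_injOn idx' (fun x hx => ?_) (fun x hx y hy hxy => ?_)
    · obtain ⟨-, h, hj⟩ := mem_filter.1 (mem_coe.1 hx)
      simp only [idx', h, dif_pos, coe_Ico, Set.mem_Ico]
      have h1 := Nat.div_add_mod (idx ⟨x, h⟩) k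
      have h2 := Nat.mod_lt (idx ⟨x, h⟩) hk
      rw [hj, mul_comm] at h1
      omega
    · have h := (mem_filter.1 (mem_coe.1 hx)).1
      have h' := (mem_filter.1 (mem_coe.1 hy)).1
      simp only [idx', h, h', dif_pos, idx] at hxy
      exact congrArg Subtype.val (X.equivFin.injective (Fin.ext hxy))
  · rw [Nat.div_lt_iff_lt_mul hk, mul_comm]
    exact (X.equivFin ⟨x, hx⟩).2.trans_le hX

variable {n B : ℕ} {In I : Type} {loc : I → Fin n → In}

/-- If every node `u` has data `X i u` of `O(√n)` words and `O(√n)` neighbors `nb i u`, then all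
nodes learn the data of their neighbors in two rounds.  The nodes relay: the node with number
`x = a * s + b`, where `s ≈ √n`, is told the `a`-th part of the neighborhood by every node and
the `b`-th part of the data by every node, and answers to each node with the `b`-th parts of the
data of the `a`-th part of its neighborhood. -/
lemma Knows.localBroadcast {r : ℕ} {α β : Type} [Nonempty α] {f : I → Fin n → α}
    (hf : Knows B loc r f)
    {nb : I → Fin n → Finset (Fin n)} {X : I → Fin n → Finset β} (E : Finset β)
    (hnb : Determines f nb) (hX : Determines f X) (hXE : ∀ i u, X i u ⊆ E) (k l s : ℕ)
    (hs : s * s ≤ n) (hnbc : ∀ i u, (nb i u).card ≤ k * s) (hXc : ∀ i u, (X i u).card ≤ l * s)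
    (hB₁ : (n + 1) ^ k * (E.card + 1) ^ l ≤ 2 ^ B) (hB₂ : (n * E.card + 1) ^ (k * l) ≤ 2 ^ B) :
    Knows B loc (r + 2) fun i v =>
      (f i v, (nb i v ×ˢ E).filter fun q : Fin n × β => q.2 ∈ X i q.1) := by
  have hnb' := fun (Y : Finset (Fin n)) (h : Y.card ≤ k * s) => exists_pieces Y k s h
  have hX' := fun (Y : Finset β) (h : Y.card ≤ l * s) => exists_pieces Y l s h
  choose! cn hcn using hnb'
  choose! cx hcx using hX'
  let E₁ : Finset (Finset (Fin n) × Finset β) :=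
    (univ.powerset.filter fun Y => Y.card ≤ k) ×ˢ (E.powerset.filter fun Y => Y.card ≤ l)
  have hE₁ : E₁.card ≤ 2 ^ B := by
    rw [card_product]
    refine (Nat.mul_le_mul (card_powerset_filter_le _ _) (card_powerset_filter_le _ _)).trans ?_
    simpa using hB₁
  have h1 := hf.round (m := fun i u x => (cn (nb i u) (x / s), cx (X i u) (x % s)))
    (fun i j v h => by simp only [hnb i j v h, hX i j v h]) E₁ hE₁ (fun i u x => by
      have a := hcn (nb i u) (hnbc i u)
      have b := hcx (X i u) (hXc i u)
      exact mem_product.2 ⟨mem_filter.2 ⟨mem_powerset.2 (subset_univ _), a.2.1 _⟩,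
        mem_filter.2 ⟨mem_powerset.2 ((b.1 _).trans (hXE i u)), b.2.1 _⟩⟩)
  let reply : I → Fin n → Fin n → Finset (Fin n × β) := fun i x v =>
    (cn (nb i v) (x / s)).biUnion fun u => (cx (X i u) (x % s)).image fun e => (u, e)
  let E₂ : Finset (Finset (Fin n × β)) :=
    ((univ : Finset (Fin n)) ×ˢ E).powerset.filter fun Y => Y.card ≤ k * l
  have hE₂ : E₂.card ≤ 2 ^ B := by
    refine (card_powerset_filter_le _ _).trans ?_
    simpa using hB₂
  have h2 := h1.round (m := reply) (fun i j x h => by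
      funext v
      have h' := (Prod.ext_iff.1 h).2
      simp only at h'
      have hu : ∀ u, cn (nb i u) (x / s) = cn (nb j u) (x / s) ∧
          cx (X i u) (x % s) = cx (X j u) (x % s) := fun u => Prod.ext_iff.1 (congrFun h' u)
      simp only [reply, (hu _).1, (hu _).2]) E₂ hE₂ (fun i x v => by
      have a := hcn (nb i v) (hnbc i v)
      refine mem_filter.2 ⟨mem_powerset.2 fun q hq => ?_, ?_⟩
      · obtain ⟨u, -, hq⟩ := mem_biUnion.1 hq
        obtain ⟨e, he, rfl⟩ := mem_image.1 hq
        exact mem_product.2 ⟨mem_univ _, hXE i u ((hcx (X i u) (hXc i u)).1 _ he)⟩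
      · refine (card_biUnion_le_card_mul _ _ l fun u _ => ?_).trans
          (Nat.mul_le_mul_right _ (a.2.1 _))
        exact card_image_le.trans ((hcx (X i u) (hXc i u)).2.1 _))
  refine h2.of_determines fun i j v h => ?_
  have hf' : f i v = f j v := congrArg (fun z => z.1.1) h
  have hr : ∀ x, reply i x v = reply j x v := fun x => congrFun (Prod.ext_iff.1 h).2 x
  have key : ∀ i, ((nb i v ×ˢ E).filter fun q : Fin n × β => q.2 ∈ X i q.1)
      = univ.biUnion fun x => reply i x v := by
    intro i
    ext ⟨u, e⟩
    simp only [mem_filter, mem_product, mem_biUnion, mem_univ, true_and, reply, mem_image]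
    constructor
    · rintro ⟨⟨hu, -⟩, he⟩
      obtain ⟨a, ha, hua⟩ := (hcn (nb i v) (hnbc i v)).2.2 u hu
      obtain ⟨b, hb, heb⟩ := (hcx (X i u) (hXc i u)).2.2 e he
      have hlt : a * s + b < n := by
        calc a * s + b < a * s + s := by omega
          _ = (a + 1) * s := by ring
          _ ≤ s * s := Nat.mul_le_mul_right _ ha
          _ ≤ n := hs
      have h1 : (a * s + b) / s = a := by
        rw [add_comm, Nat.add_mul_div_right _ _ (by omega), Nat.div_eq_of_lt hb, zero_add]
      have h2 : (a * s + b) % s = b := by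
        rw [add_comm, Nat.add_mul_mod_self_right, Nat.mod_eq_of_lt hb]
      refine ⟨⟨a * s + b, hlt⟩, u, ?_, e, ?_, rfl⟩
      · simpa only [h1] using hua
      · simpa only [h2] using heb
    · rintro ⟨x, u', hu', e', he', h⟩
      obtain ⟨rfl, rfl⟩ := Prod.ext_iff.1 h
      have hx := (hcx (X i u') (hXc i u')).1 _ he'
      exact ⟨⟨(hcn (nb i v) (hnbc i v)).1 _ hu', hXE i u' hx⟩, hx⟩
  simp only [key, hr, hf']

end LocalBroadcast

/-! ### The method of conditional expectations -/

section Selection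

variable {n B : ℕ} {In I : Type} {loc : I → Fin n → In}

/-- In some class of a partition of `T`, the average of `c` is at most the average over `T`. -/
lemma exists_class_le {n N : ℕ} (T : Finset (Fin N)) (hT : T.Nonempty) (dig : Fin N → Fin n)
    (c : Fin N → ℕ) :
    ∃ w, (T.filter fun s => dig s = w).Nonempty ∧
      T.card * ∑ s ∈ T.filter (fun s => dig s = w), c s
        ≤ (T.filter fun s => dig s = w).card * ∑ s ∈ T, c s := by
  by_contra! hcon
  have hlt : ∑ w, (T.filter fun s => dig s = w).card * ∑ s ∈ T, c s
      < ∑ w, T.card * ∑ s ∈ T.filter (fun s => dig s = w), c s := by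
    obtain ⟨s, hs⟩ := hT
    refine Finset.sum_lt_sum (fun w _ => ?_) ⟨dig s, mem_univ _, hcon _ ⟨s, by simp [hs]⟩⟩
    rcases (T.filter fun s => dig s = w).eq_empty_or_nonempty with h | h
    · simp [h]
    · exact (hcon w h).le
  rw [← Finset.sum_mul, ← Finset.mul_sum,
    ← Finset.card_eq_sum_card_fiberwise (fun _ _ => mem_coe.2 (mem_univ _)),
    Finset.sum_fiberwise] at hlt
  exact lt_irrefl _ hlt

lemma mul_le_mul_of_average {N a b x y z : ℕ} (h₁ : a * x ≤ b * y) (h₂ : N * y ≤ a * z)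
    (ha : 0 < a) : N * x ≤ b * z := by
  refine Nat.le_of_mul_le_mul_left ?_ ha
  calc a * (N * x) = N * (a * x) := by ring
    _ ≤ N * (b * y) := Nat.mul_le_mul_left _ h₁
    _ = b * (N * y) := by ring
    _ ≤ b * (a * z) := Nat.mul_le_mul_left _ h₂
    _ = a * (b * z) := by ring

/-- One digit of a seed is fixed in two rounds: node `w` collects the total cost of the remaining
seeds with this digit equal to `w`, and announces it. -/
lemma Knows.fixDigit {r : ℕ} {α : Type} [Nonempty α] {f : I → Fin n → α} {N : ℕ}
    {T : I → Finset (Fin N)}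
    (hf : Knows B loc r fun i v => (f i v, T i)) (hT : ∀ i, (T i).Nonempty)
    (cost : I → Fin n → Fin N → ℕ) (hcost : Determines f cost) (c₀ : ℕ)
    (hc₀ : ∀ i v s, cost i v s ≤ c₀) (dig : Fin N → Fin n) (hB : n * (N * c₀) + 1 ≤ 2 ^ B) :
    ∃ w : I → Fin n, Knows B loc (r + 2) (fun i v => (f i v, (T i).filter fun s => dig s = w i)) ∧
      ∀ i, ((T i).filter fun s => dig s = w i).Nonempty ∧
        (T i).card * ∑ s ∈ (T i).filter (fun s => dig s = w i), ∑ v, cost i v s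
          ≤ ((T i).filter fun s => dig s = w i).card * ∑ s ∈ T i, ∑ v, cost i v s := by
  let cl : I → Fin n → Finset (Fin N) := fun i w => (T i).filter fun s => dig s = w
  have hbound : ∀ i u w, ∑ s ∈ cl i w, cost i u s ≤ N * c₀ := fun i u w => by
    calc _ ≤ ∑ _s ∈ cl i w, c₀ := Finset.sum_le_sum fun s _ => hc₀ i u s
      _ = (cl i w).card * c₀ := by rw [Finset.sum_const, smul_eq_mul]
      _ ≤ N * c₀ := Nat.mul_le_mul_right _ ((card_le_univ _).trans_eq (Fintype.card_fin N))
  have h1 := hf.round (m := fun i u w => ∑ s ∈ cl i w, cost i u s)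
    (fun i j u h => by
      have h' := Prod.ext_iff.1 h
      have hT' : T i = T j := h'.2
      simp only [cl, hT', hcost i j u h'.1]) (range (n * (N * c₀) + 1)) (by simpa using hB)
    (fun i u w => by
      have hn : 0 < n := u.pos
      have := hbound i u w
      rw [mem_range, Nat.lt_succ_iff]
      exact this.trans (Nat.le_mul_of_pos_left _ hn))
  have h2 := h1.broadcast (m := fun i w => ∑ u, ∑ s ∈ cl i w, cost i u s)
    (fun i j w h => by
      have h' := (Prod.ext_iff.1 h).2
      exact Finset.sum_congr rfl fun u _ => congrFun h' u) (range (n * (N * c₀) + 1))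
    (by simpa using hB) (fun i w => by
      rw [mem_range, Nat.lt_succ_iff]
      calc _ ≤ ∑ _u : Fin n, N * c₀ := Finset.sum_le_sum fun u _ => hbound i u w
        _ = _ := by simp)
  -- The class is chosen by a rule that depends only on commonly known data.
  let good : Finset (Fin N) → (Fin n → ℕ) → Fin n → Prop := fun S t w =>
    (S.filter fun s => dig s = w).Nonempty ∧
      S.card * t w ≤ (S.filter fun s => dig s = w).card * ∑ w, t w
  let tot : I → Fin n → ℕ := fun i w => ∑ u, ∑ s ∈ cl i w, cost i u s
  have hgood : ∀ i, ∃ w, good (T i) (tot i) w := fun i => by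
    obtain ⟨w, hw, hle⟩ := exists_class_le (T i) (hT i) dig fun s => ∑ v, cost i v s
    refine ⟨w, hw, ?_⟩
    have e1 : ∀ w, tot i w = ∑ s ∈ cl i w, ∑ v, cost i v s := fun w => Finset.sum_comm
    simp only [e1, cl]
    rw [Finset.sum_fiberwise]
    exact hle
  let pick : Finset (Fin N) → (Fin n → ℕ) → Option (Fin n) := fun S t =>
    if h : ∃ w, good S t w then some h.choose else none
  have hpick : ∀ i, ∃ w, pick (T i) (tot i) = some w ∧ good (T i) (tot i) w := fun i =>
    ⟨(hgood i).choose, by simp only [pick, hgood i, dif_pos], (hgood i).choose_spec⟩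
  choose w hw hgw using hpick
  refine ⟨w, h2.of_determines fun i j v h => ?_, fun i => ⟨(hgw i).1, ?_⟩⟩
  · have h' := Prod.ext_iff.1 h
    have ht : tot i = tot j := h'.2
    have hfT := Prod.ext_iff.1 (Prod.ext_iff.1 h'.1).1
    have hTT : T i = T j := hfT.2
    have hww : w i = w j := by
      have := hw i
      rw [ht, hTT, hw j] at this
      exact (Option.some.inj this).symm
    exact Prod.ext hfT.1 (by simp only [hTT, hww])
  · have e1 : ∀ w, tot i w = ∑ s ∈ cl i w, ∑ v, cost i v s := fun w => Finset.sum_comm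
    have := (hgw i).2
    simp only [e1, cl] at this
    rwa [Finset.sum_fiberwise] at this

/-- All nodes agree on a seed of at most average total cost, if each of them knows its own cost for
every seed.  The seed is fixed digit by digit in base `n`. -/
lemma Knows.select {r : ℕ} {α : Type} [Nonempty α] {f : I → Fin n → α} {N : ℕ} [NeZero N]
    (hf : Knows B loc r f)
    (cost : I → Fin n → Fin N → ℕ) (hcost : Determines f cost) (c₀ : ℕ)
    (hc₀ : ∀ i v s, cost i v s ≤ c₀) (L : ℕ) (hn : 0 < n) (hN : N ≤ n ^ L)
    (hB : n * (N * c₀) + 1 ≤ 2 ^ B) :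
    ∃ sel : I → Fin N, Knows B loc (r + 2 * L) (fun i v => (f i v, sel i)) ∧
      ∀ i, N * ∑ v, cost i v (sel i) ≤ ∑ s, ∑ v, cost i v s := by
  have key : ∀ k, ∃ T : I → Finset (Fin N), Knows B loc (r + 2 * k) (fun i v => (f i v, T i)) ∧
      ∀ i, (T i).Nonempty ∧
        N * ∑ s ∈ T i, ∑ v, cost i v s ≤ (T i).card * ∑ s, ∑ v, cost i v s ∧
        ∀ s ∈ T i, ∀ s' ∈ T i, (s : ℕ) % n ^ k = s' % n ^ k := by
    intro k
    induction k with
    | zero =>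
      refine ⟨fun _ => univ, ?_, fun i => ⟨univ_nonempty, by simp, fun s _ s' _ => by
        simp [Nat.mod_one]⟩⟩
      exact hf.map fun _ a => (a, univ)
    | succ k ih =>
      obtain ⟨T, hT, hprop⟩ := ih
      obtain ⟨w, hw, hww⟩ := hT.fixDigit (fun i => (hprop i).1) cost hcost c₀ hc₀
        (fun s => ⟨(s : ℕ) / n ^ k % n, Nat.mod_lt _ hn⟩) hB
      refine ⟨_, hw, fun i => ⟨(hww i).1, ?_, fun s hs s' hs' => ?_⟩⟩
      · have h1 := (hww i).2
        have h2 := (hprop i).2.1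
        have hpos := Finset.card_pos.2 (hprop i).1
        exact mul_le_mul_of_average h1 h2 hpos
      · have a := mem_filter.1 hs
        have b := mem_filter.1 hs'
        have h1 := (hprop i).2.2 s a.1 s' b.1
        have h2 := congrArg Fin.val (a.2.trans b.2.symm)
        simp only at h2
        rw [Nat.mod_pow_succ, Nat.mod_pow_succ, h1, h2]
  obtain ⟨T, hT, hprop⟩ := key L
  have hsing : ∀ i, ∃ s, T i = {s} := fun i => by
    obtain ⟨s, hs⟩ := (hprop i).1
    refine ⟨s, Finset.eq_singleton_iff_unique_mem.2 ⟨hs, fun s' hs' => Fin.ext ?_⟩⟩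
    have := (hprop i).2.2 s' hs' s hs
    rwa [Nat.mod_eq_of_lt (s'.2.trans_le hN), Nat.mod_eq_of_lt (s.2.trans_le hN)] at this
  choose sel hsel using hsing
  refine ⟨sel, ?_, fun i => ?_⟩
  · refine hT.of_determines fun i j v h => ?_
    have h' := Prod.ext_iff.1 h
    have h2 : T i = T j := h'.2
    rw [hsel, hsel] at h2
    exact Prod.ext h'.1 (Finset.singleton_injective h2)
  · have := (hprop i).2.1
    rw [hsel] at this
    simpa using this

end Selection

/-! ### The color trial in terms of neighborhoods -/

section TrialData

variable {V : Type*} (N : V → Finset V) (Ψ : V → Finset ℕ) (pk : Finset V)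

/-- The neighbors of at least three times the degree of `v`, for the neighborhoods `N`. -/
noncomputable def higherNbrs (v : V) : Finset V :=
  (N v).filter fun u => 3 * (N v).card ≤ (N u).card

/-- Success in the nomination step, for the neighborhoods `N`. -/
def NomOk (nom : V → Prop) (v : V) : Prop :=
  (((N v).filter nom).card : ℝ) ≤ 1 / 4 * ((N v).card : ℝ) + ((Ψ v).card : ℝ) ^ (0.7 : ℝ) ∧
  (((higherNbrs N v).filter nom).card : ℝ)
    ≥ 1 / 4 * ((higherNbrs N v).card : ℝ) - ((Ψ v).card : ℝ) ^ (0.7 : ℝ)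

/-- The nodes `v` for which the coloring step has to be analyzed when the nodes of `pk` pick colors:
the palette is small, and at least a `1/20` fraction of the neighbors are of much higher degree and
pick a color. -/
def Critical (v : V) : Prop :=
  ((Ψ v).card : ℝ) < 1.1 * ((N v).card : ℝ) ∧
    (N v).card ≤ 20 * ((higherNbrs N v).filter fun u => u ∈ pk).card

/-- A chosen subset of `X` with `min k |X|` elements. -/
noncomputable def subsetOfCard (X : Finset V) (k : ℕ) : Finset V :=
  (Finset.exists_subset_card_eq (min_le_right k X.card)).choose

lemma subsetOfCard_spec (X : Finset V) (k : ℕ) :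
    subsetOfCard X k ⊆ X ∧ (subsetOfCard X k).card = min k X.card :=
  (Finset.exists_subset_card_eq (min_le_right k X.card)).choose_spec

/-- Some `⌈d(v)/20⌉` neighbors of `v` of much higher degree that pick a color.  Having only few of
them makes collisions among them rare. -/
noncomputable def helpers (v : V) : Finset V :=
  subsetOfCard ((higherNbrs N v).filter fun u => u ∈ pk) (((N v).card + 19) / 20)

variable {N Ψ pk} {v : V}

lemma helpers_subset : helpers N pk v ⊆ (higherNbrs N v).filter fun u => u ∈ pk :=
  (subsetOfCard_spec _ _).1

lemma mem_of_mem_helpers {u : V} (hu : u ∈ helpers N pk v) :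
    u ∈ N v ∧ 3 * (N v).card ≤ (N u).card ∧ u ∈ pk := by
  have h := mem_filter.1 (helpers_subset hu)
  have h' := mem_filter.1 h.1
  exact ⟨h'.1, h'.2, h.2⟩

lemma card_helpers_le : (helpers N pk v).card ≤ ((N v).card + 19) / 20 :=
  (subsetOfCard_spec _ _).2.trans_le (min_le_left _ _)

lemma Critical.card_helpers (h : Critical N Ψ pk v) :
    (N v).card ≤ 20 * (helpers N pk v).card := by
  have h1 : (helpers N pk v).card = _ := (subsetOfCard_spec _ _).2
  have := h.2
  rw [h1]
  omega

/-- The lower bound on the palette sizes makes the deviations allowed in the nomination step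
negligible. -/
lemma rpow_le_div {p : ℝ} (hp : 10 ^ 10 ≤ p) : p ^ (0.7 : ℝ) ≤ p / 1000 := by
  have hp0 : 0 < p := by linarith
  have h1 : (1000 : ℝ) ≤ p ^ (0.3 : ℝ) := by
    calc (1000 : ℝ) = ((10 : ℝ) ^ (10 : ℝ)) ^ (0.3 : ℝ) := by
          rw [← Real.rpow_mul (by norm_num)]; norm_num
      _ ≤ _ := Real.rpow_le_rpow (by positivity) (by exact_mod_cast hp) (by norm_num)
  have h2 : p ^ (0.7 : ℝ) * p ^ (0.3 : ℝ) = p := by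
    rw [← Real.rpow_add hp0]; norm_num
  rw [le_div_iff₀ (by norm_num)]
  calc p ^ (0.7 : ℝ) * 1000 ≤ p ^ (0.7 : ℝ) * p ^ (0.3 : ℝ) :=
        mul_le_mul_of_nonneg_left h1 (Real.rpow_nonneg hp0.le _)
    _ = p := h2

/-- About `1/4` of the at least `d(v) / 3` neighbors of higher degree nominate themselves, and fewer
than `0.03 d(v)` of these fail to pick a color, which leaves more than `d(v) / 20`. -/
lemma critical_of_nomOk {nom : V → Prop} (hp : (10 : ℝ) ^ 10 ≤ (Ψ v).card)
    (hv : NomOk N Ψ nom v) (h₁ : ((Ψ v).card : ℝ) < 1.1 * ((N v).card : ℝ))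
    (h₂ : 1 / 3 * ((N v).card : ℝ) ≤ (higherNbrs N v).card)
    (h₃ : (((N v).filter fun u => ¬ NomOk N Ψ nom u).card : ℝ) < 0.03 * (N v).card)
    (hpk : ∀ u ∈ N v, nom u → NomOk N Ψ nom u → u ∈ pk) : Critical N Ψ pk v := by
  refine ⟨h₁, ?_⟩
  have hsub : (higherNbrs N v).filter nom ⊆ ((higherNbrs N v).filter fun u => u ∈ pk)
      ∪ (N v).filter fun u => ¬ NomOk N Ψ nom u := by
    intro u hu
    obtain ⟨hu, hn⟩ := mem_filter.1 hu
    have huN := (mem_filter.1 hu).1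
    by_cases h : NomOk N Ψ nom u
    · exact mem_union_left _ (mem_filter.2 ⟨hu, hpk u huN hn h⟩)
    · exact mem_union_right _ (mem_filter.2 ⟨huN, h⟩)
  have h4 : (((higherNbrs N v).filter nom).card : ℝ)
      ≤ ((higherNbrs N v).filter fun u => u ∈ pk).card
        + ((N v).filter fun u => ¬ NomOk N Ψ nom u).card := by
    exact_mod_cast (card_le_card hsub).trans (card_union_le _ _)
  have h5 := hv.2
  have h6 := rpow_le_div hp
  have h7 : ((N v).card : ℝ) ≤ 20 * ((higherNbrs N v).filter fun u => u ∈ pk).card := by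
    linarith
  exact_mod_cast h7

lemma card_nbr_pickers_le {nom : V → Prop} (hp : (10 : ℝ) ^ 10 ≤ (Ψ v).card)
    (hd : (N v).card ≤ (Ψ v).card) (hv : NomOk N Ψ nom v) (hpk : ∀ u ∈ pk, nom u) :
    (((N v).filter fun u => u ∈ pk).card : ℝ) ≤ 0.251 * (Ψ v).card := by
  have h1 : (((N v).filter fun u => u ∈ pk).card : ℝ) ≤ ((N v).filter nom).card :=
    Nat.cast_le.2 (card_le_card (Finset.monotone_filter_right _ fun u _ h => hpk u h))
  have h2 := hv.1
  have h3 := rpow_le_div hp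
  have h4 : ((N v).card : ℝ) ≤ (Ψ v).card := by exact_mod_cast hd
  linarith

variable [Fintype V] [DecidableEq V] {R M : ℕ}

variable (N Ψ pk) in
/-- The windows given by `F` pass the tests that `v` can check knowing the palettes of its
neighbors. -/
def WindowsGood (δ : ℝ) (T : ℕ) (F : V × Fin R → Fin M) (v : V) : Prop :=
  (v ∈ pk → FewBlocked δ T (window Ψ F) ((N v).filter fun u => u ∈ pk) v) ∧
  (Critical N Ψ pk v → ∀ u ∈ helpers N pk v,
    FewInside (window Ψ F) (Ψ v) u ∧ FewRepeated δ (window Ψ F) ((helpers N pk v).erase u) u)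

lemma pr_not_nomOk_le [NeZero M] (hM : 4 ∣ M) (ω : V → Fin R) (hp : 1 ≤ (Ψ v).card)
    (hd : (N v).card ≤ (Ψ v).card) :
    pr (fun F : V × Fin R → Fin M => ¬ NomOk N Ψ (fun w => hashNominates (F (w, ω w))) v)
      ≤ 24 / (Ψ v).card := by
  have hp' : (1 : ℝ) ≤ (Ψ v).card := by exact_mod_cast hp
  have h1 := (pr_nominated_le (R := R) hM ω (N v) hp' (by exact_mod_cast hd)).1
  have h2 := (pr_nominated_le (R := R) hM ω (higherNbrs N v) hp'
    (by exact_mod_cast (card_filter_le _ _).trans hd)).2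
  refine (pr_mono fun F h => ?_).trans ((pr_or_le _ _).trans ((add_le_add h1 h2).trans_eq ?_))
  · rw [NomOk, not_and_or, not_le, ge_iff_le, not_le] at h
    exact h
  · ring

/-- The data of a trial that are relevant for the node `v`: degrees are less than palette sizes,
which are not too large for nearly uniform color choices. -/
structure ValidAt (N : V → Finset V) (Ψ : V → Finset ℕ) (pk : Finset V) (M : ℕ) (v : V) :
    Prop where
  notMem : v ∉ N v
  large : (10 : ℝ) ^ 10 ≤ (Ψ v).card
  degree_lt : ∀ u ∈ insert v (N v), (N u).card < (Ψ u).card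
  palette_le : ∀ u ∈ insert v (N v), 1000 * (Ψ u).card ≤ M
  pickers_le : v ∈ pk → (((N v).filter fun u => u ∈ pk).card : ℝ) ≤ 0.251 * (Ψ v).card

/-- A union bound over the tests of `v`. -/
lemma pr_not_windowsGood_le [NeZero R] [NeZero M] {δ : ℝ} (hδ : 0 < δ) (hδ1 : δ ≤ 1) {T : ℕ}
    (hv : ValidAt N Ψ pk M v) :
    pr (fun F : V × Fin R → Fin M => ¬ WindowsGood N Ψ pk δ T F v)
      ≤ (1 + 2 * Fintype.card V) * ((Real.exp (-(6e-6 * R)) + R * Real.exp (-T)) / δ) := by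
  set e := (Real.exp (-(6e-6 * R)) + R * Real.exp (-T)) / δ with he
  have he1 : Real.exp (-(6e-6 * R)) / δ ≤ e :=
    div_le_div_of_nonneg_right (le_add_of_nonneg_right (by positivity)) hδ.le
  have he2 : Real.exp (-(6e-6 * R)) ≤ e := by
    refine le_trans ?_ he1
    rw [le_div_iff₀ hδ]
    exact mul_le_of_le_one_right (Real.exp_pos _).le hδ1
  have he0 : 0 ≤ e := (Real.exp_pos _).le.trans he2
  have hpos : ∀ u ∈ insert v (N v), 0 < (Ψ u).card := fun u hu =>
    (Nat.zero_le _).trans_lt (hv.degree_lt u hu)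
  have hA : pr (fun F : V × Fin R → Fin M =>
      ¬ (v ∈ pk → FewBlocked δ T (window Ψ F) ((N v).filter fun u => u ∈ pk) v)) ≤ e := by
    by_cases hvp : v ∈ pk
    · simp only [hvp, true_imp_iff]
      exact pr_not_fewBlocked_le hδ (fun h => hv.notMem (mem_filter.1 h).1)
        (hpos v (mem_insert_self _ _)) (hv.palette_le v (mem_insert_self _ _)) (hv.pickers_le hvp)
    · simp only [hvp, false_imp_iff, not_true, pr, if_false]
      rw [Finset.expect_const_zero]
      exact he0
  have hB : pr (fun F : V × Fin R → Fin M => ¬ (Critical N Ψ pk v → ∀ u ∈ helpers N pk v,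
      FewInside (window Ψ F) (Ψ v) u ∧ FewRepeated δ (window Ψ F) ((helpers N pk v).erase u) u))
      ≤ 2 * Fintype.card V * e := by
    by_cases hc : Critical N Ψ pk v
    · simp only [hc, true_imp_iff]
      have h1 : ∀ u ∈ helpers N pk v, pr (fun F : V × Fin R → Fin M =>
          ¬ (FewInside (window Ψ F) (Ψ v) u
            ∧ FewRepeated δ (window Ψ F) ((helpers N pk v).erase u) u)) ≤ 2 * e := by
        intro u hu
        obtain ⟨huN, hud, -⟩ := mem_of_mem_helpers hu
        have hu' := mem_insert_of_mem (a := u) (b := v) huN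
        have hlt : (3 : ℝ) * (N v).card ≤ (Ψ u).card := by
          exact_mod_cast hud.trans (hv.degree_lt u hu').le
        have hc1 := hc.1
        have hl := hv.large
        have hm : (((helpers N pk v).erase u).card : ℝ) ≤ ((N v).card + 19) / 20 := by
          refine le_trans (Nat.cast_le.2 ((card_le_card (erase_subset _ _)).trans card_helpers_le))
            ((Nat.cast_div_le).trans_eq ?_)
          push_cast; ring
        have h2 := pr_not_fewInside_le (R := R) (hpos u hu') (hv.palette_le u hu')
          (S := Ψ v) (by linarith)
        have h3 := pr_not_fewRepeated_le (R := R) (W := (helpers N pk v).erase u) hδ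
          (notMem_erase _ _) (hpos u hu') (hv.palette_le u hu') (by linarith)
        refine (pr_mono fun F h => not_and_or.1 h).trans ((pr_or_le _ _).trans ?_)
        linarith
      have hcov : ∀ F : V × Fin R → Fin M, (¬ ∀ u ∈ helpers N pk v,
          FewInside (window Ψ F) (Ψ v) u
            ∧ FewRepeated δ (window Ψ F) ((helpers N pk v).erase u) u) →
          ∃ u ∈ helpers N pk v, ¬ (FewInside (window Ψ F) (Ψ v) u
            ∧ FewRepeated δ (window Ψ F) ((helpers N pk v).erase u) u) := fun F h => by
        by_contra! hcon
        exact h hcon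
      refine (pr_mono hcov).trans ((pr_exists_le _ _).trans ((Finset.sum_le_sum h1).trans ?_))
      rw [Finset.sum_const, nsmul_eq_mul]
      have : ((helpers N pk v).card : ℝ) ≤ Fintype.card V := by exact_mod_cast card_le_univ _
      nlinarith
    · simp only [hc, false_imp_iff, not_true, pr, if_false]
      rw [Finset.expect_const_zero]
      positivity
  refine (pr_mono fun F h => not_and_or.1 h).trans ((pr_or_le _ _).trans
    ((add_le_add hA hB).trans_eq (by ring)))

end TrialData

/-! ### Sample spaces that are good for all instances -/

section Samples

/-- The number of candidate colors per node.  The constant makes the error term `exp (-6e-6 *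
windowSize n)` of the tests of windows at most `n ^ (-60)`. -/
def windowSize (n : ℕ) : ℕ := 10 ^ 7 * (Nat.log 2 n + 1)

/-- The threshold for heavy colors, which are thus picked except with probability at most
`n ^ (-100)`. -/
def heavyBound (n : ℕ) : ℕ := 100 * (Nat.log 2 n + 1)

instance (n : ℕ) : NeZero (windowSize n) := ⟨by unfold windowSize; positivity⟩

lemma window_error_le {n : ℕ} (hn : 2 ≤ n) :
    (1 + 2 * (n : ℝ)) * ((Real.exp (-(6e-6 * windowSize n))
      + windowSize n * Real.exp (-heavyBound n)) / (1 / (n : ℝ) ^ 2)) ≤ 1 / (8 * n) := by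
  set l : ℝ := ((Nat.log 2 n + 1 : ℕ) : ℝ) with hl
  have hl1 : 1 ≤ l := by rw [hl]; exact_mod_cast Nat.le_add_left 1 _
  set x := Real.exp (-l) with hx
  have hx0 : 0 < x := Real.exp_pos _
  have hn0 : (2 : ℝ) ≤ n := by exact_mod_cast hn
  have hxe : x * Real.exp l = 1 := by rw [hx, ← Real.exp_add]; simp
  have hnx : n * x ≤ 1 := by
    have h1 : (n : ℝ) ≤ 2 ^ (Nat.log 2 n + 1) := by
      exact_mod_cast (Nat.lt_pow_succ_log_self (by norm_num) n).le
    have h2 : (2 : ℝ) ^ (Nat.log 2 n + 1) ≤ Real.exp l := by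
      rw [hl, ← mul_one ((Nat.log 2 n + 1 : ℕ) : ℝ), Real.exp_nat_mul]
      exact pow_le_pow_left₀ (by norm_num) (by linarith [Real.add_one_le_exp (1 : ℝ)]) _
    nlinarith
  have hx2 : x ≤ 1 / 2 := by nlinarith
  have hlx : l * x ≤ 1 := by nlinarith [Real.add_one_le_exp l]
  have e1 : Real.exp (-(6e-6 * windowSize n)) = x ^ 60 := by
    rw [hx, ← Real.exp_nat_mul, windowSize]
    congr 1; push_cast; rw [hl]; push_cast; ring
  have e2 : Real.exp (-(heavyBound n : ℝ)) = x ^ 100 := by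
    rw [hx, ← Real.exp_nat_mul, heavyBound]
    congr 1; push_cast; rw [hl]; push_cast; ring
  have e3 : (windowSize n : ℝ) = 10 ^ 7 * l := by rw [windowSize, hl]; push_cast; ring
  rw [e1, e2, e3, div_div_eq_mul_div, div_one, le_div_iff₀ (by positivity)]
  have hp : ∀ k : ℕ, x ^ k ≤ (1 / 2) ^ k := fun k => pow_le_pow_left₀ hx0.le hx2 k
  have h3 : 10 ^ 7 * l * x ^ 100 ≤ x ^ 60 := by
    have h4 : x ^ 39 ≤ (1 / 2) ^ 39 := hp 39
    calc 10 ^ 7 * l * x ^ 100 = (l * x) * (10 ^ 7 * x ^ 39) * x ^ 60 := by ring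
      _ ≤ 1 * 1 * x ^ 60 := by
        refine mul_le_mul_of_nonneg_right (mul_le_mul hlx ?_ (by positivity) zero_le_one)
          (by positivity)
        norm_num at h4 ⊢; linarith
      _ = x ^ 60 := by ring
  have h5 : (n * x) ^ 4 ≤ 1 := pow_le_one₀ (by positivity) hnx
  have h6 : x ^ 56 ≤ (1 / 2) ^ 56 := hp 56
  calc (1 + 2 * (n : ℝ)) * ((x ^ 60 + 10 ^ 7 * l * x ^ 100) * n ^ 2) * (8 * n)
      ≤ (3 * n) * ((x ^ 60 + x ^ 60) * n ^ 2) * (8 * n) := by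
        gcongr
        linarith
    _ = (n * x) ^ 4 * (48 * x ^ 56) := by ring
    _ ≤ 1 * 1 := by
        refine mul_le_mul h5 ?_ (by positivity) zero_le_one
        norm_num at h6 ⊢; linarith
    _ = 1 := one_mul 1

/-- The parameters of a test: neighborhoods, palettes, a set of nodes that pick colors, and a
node. -/
abbrev TestParam (n : ℕ) : Type :=
  ((Fin n → Finset (Fin n)) × (Fin n → Finset ℕ)) × (Finset (Fin n) × Fin n)

/-- The parameters with colors less than `n ^ γ`. -/
noncomputable def testSet (n γ : ℕ) : Finset (TestParam n) :=
  (univ ×ˢ Fintype.piFinset fun _ => (range (n ^ γ)).powerset) ×ˢ univ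

lemma card_testSet_le {n : ℕ} (γ : ℕ) (hn : 2 ≤ n) :
    (testSet n γ).card ≤ 2 ^ (4 * n ^ (γ + 2)) := by
  have h0 : n ≤ n ^ (γ + 2) := Nat.le_self_pow (by omega) n
  have h1 : n * n ≤ n ^ (γ + 2) := by
    rw [← sq]; exact Nat.pow_le_pow_right (by omega) (by omega)
  have h2 : n ^ γ * n ≤ n ^ (γ + 2) := by
    rw [← pow_succ]; exact Nat.pow_le_pow_right (by omega) (by omega)
  simp only [testSet, card_product, card_univ, Fintype.card_prod, Fintype.card_fun,
    Fintype.card_finset, Fintype.card_fin, Fintype.card_piFinset, card_powerset, card_range,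
    prod_const]
  rw [← pow_mul, ← pow_mul, ← pow_add]
  calc 2 ^ (n * n + n ^ γ * n) * (2 ^ n * n) ≤ 2 ^ (n * n + n ^ γ * n) * (2 ^ n * 2 ^ n) :=
        Nat.mul_le_mul_left _ (Nat.mul_le_mul_left _ Nat.lt_two_pow_self.le)
    _ = 2 ^ (n * n + n ^ γ * n + (n + n)) := by rw [← pow_add, ← pow_add]
    _ ≤ _ := Nat.pow_le_pow_right (by norm_num) (by omega)

lemma lt_exp_of_le_two_pow {x k : ℕ} {y : ℝ} (hx : x ≤ 2 ^ k) (hk : (k : ℝ) ≤ y) (hy : 0 < y) :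
    (x : ℝ) < Real.exp y := by
  have h1 : (x : ℝ) ≤ 2 ^ k := by exact_mod_cast hx
  have h2 : Real.log 2 < 1 := by have := Real.log_two_lt_d9; linarith
  calc (x : ℝ) ≤ 2 ^ k := h1
    _ = Real.exp (k * Real.log 2) := by
        rw [Real.exp_nat_mul, Real.exp_log (by norm_num)]
    _ < Real.exp y := Real.exp_lt_exp.2 (by
        have := Real.log_pos one_lt_two
        calc k * Real.log 2 ≤ y * Real.log 2 := mul_le_mul_of_nonneg_right hk this.le
          _ < y * 1 := mul_lt_mul_of_pos_left h2 hy
          _ = y := mul_one y)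

/-- The requirements on a sample `F` of hash values and a sample `ω` of choices of candidate colors:
averages over the samples obey, up to a constant factor and a small error, the bounds that
hold for uniformly random functions. -/
structure GoodSamples {n γ M Na Nb : ℕ} (F : Fin Na → Fin n × Fin (windowSize n) → Fin M)
    (ω : Fin Nb → Fin n → Fin (windowSize n)) : Prop where
  nom : ∀ (N : Fin n → Finset (Fin n)) (Ψ : Fin n → Finset ℕ) (v : Fin n),
    (∀ u, Ψ u ⊆ range (n ^ γ)) → 1 ≤ (Ψ v).card → (N v).card ≤ (Ψ v).card →
    pr (fun a => ¬ NomOk N Ψ (fun w => hashNominates (F a (w, 0))) v)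
      ≤ 48 / (Ψ v).card + 1 / (2 * n)
  windows : ∀ (N : Fin n → Finset (Fin n)) (Ψ : Fin n → Finset ℕ) (pk : Finset (Fin n))
    (v : Fin n), (∀ u, Ψ u ⊆ range (n ^ γ)) → ValidAt N Ψ pk M v →
    pr (fun a => ¬ WindowsGood N Ψ pk (1 / (n : ℝ) ^ 2) (heavyBound n) (F a) v) ≤ 3 / (4 * n)
  picks : ∀ (N : Fin n → Finset (Fin n)) (Ψ : Fin n → Finset ℕ) (pk : Finset (Fin n))
    (v : Fin n) (a : Fin Na), (∀ u, Ψ u ⊆ range (n ^ γ)) → Critical N Ψ pk v →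
    (∀ u ∈ insert v (helpers N pk v), u ∉ N u ∧
      WindowsGood N Ψ pk (1 / (n : ℝ) ^ 2) (heavyBound n) (F a) u) →
    pr (fun b => (((helpers N pk v).filter fun u => Ok (heavyBound n) (window Ψ (F a)) (Ψ v)
        ((N u).filter fun w => w ∈ pk) (ω b) u).card : ℝ) < 0.22 * (helpers N pk v).card)
      ≤ 2 * (Real.exp (-(0.003 * (helpers N pk v).card))
        + 2 * (helpers N pk v).card * (1 / (n : ℝ) ^ 2)) + 1 / (2 * n)

/-- The number of tests is `2 ^ O(n ^ (γ + 2))` for `F`, and `2 ^ O(n ^ (γ + 4))` for `ω`, where a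
test also refers to a point of the sample `F`.  The sample sizes exceed these exponents by more
than the factor `2 * n` that an error of `1 / (2 * n)` requires. -/
lemma exists_goodSamples {n : ℕ} (γ : ℕ) {M : ℕ} [NeZero M] (hn : 2 ≤ n) (hM : 4 ∣ M) :
    ∃ (F : Fin (n ^ (γ + 8)) → Fin n × Fin (windowSize n) → Fin M)
      (ω : Fin (n ^ (γ + 10)) → Fin n → Fin (windowSize n)), GoodSamples (γ := γ) F ω := by
  have hn0 : (0 : ℝ) < n := by exact_mod_cast (by omega : 0 < n)
  have hnz : NeZero n := ⟨by omega⟩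
  have : NeZero (n ^ (γ + 8)) := ⟨(pow_pos (by omega) _).ne'⟩
  have : NeZero (n ^ (γ + 10)) := ⟨(pow_pos (by omega) _).ne'⟩
  set δ : ℝ := 1 / (n : ℝ) ^ 2 with hδ
  have hδ0 : 0 < δ := by positivity
  have hδ1 : δ ≤ 1 := by
    rw [hδ, div_le_one (by positivity)]
    exact one_le_pow₀ (by exact_mod_cast (by omega : 1 ≤ n))
  have hsize : ∀ k : ℕ, 1 / (2 * (n : ℝ)) * ((n ^ (γ + k + 1) : ℕ) : ℝ)
      = ((n ^ (γ + k) : ℕ) : ℝ) / 2 := fun k => by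
    push_cast; rw [pow_succ]; field_simp
  have h32 : 32 ≤ n ^ 5 := by
    calc 32 = 2 ^ 5 := by norm_num
      _ ≤ n ^ 5 := Nat.pow_le_pow_left hn 5
  have hpow : 32 * n ^ (γ + 2) ≤ n ^ (γ + 7) := by
    calc 32 * n ^ (γ + 2) ≤ n ^ 5 * n ^ (γ + 2) := Nat.mul_le_mul_right _ h32
      _ = n ^ (γ + 7) := by ring
  have hone : 1 ≤ n ^ (γ + 2) := Nat.one_le_pow _ _ (by omega)
  -- The sample of hash values; the Boolean distinguishes the two kinds of tests.
  let T₁ := testSet n γ ×ˢ (univ : Finset Bool)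
  let good₁ : TestParam n × Bool → Prop := fun t => if t.2 = true
    then 1 ≤ (t.1.1.2 t.1.2.2).card ∧ (t.1.1.1 t.1.2.2).card ≤ (t.1.1.2 t.1.2.2).card
    else ValidAt t.1.1.1 t.1.1.2 t.1.2.1 M t.1.2.2
  let φ₁ : TestParam n × Bool → (Fin n × Fin (windowSize n) → Fin M) → ℝ := fun t F => ind (
    if t.2 = true
    then ¬ NomOk t.1.1.1 t.1.1.2 (fun w => hashNominates (F (w, 0))) t.1.2.2
    else ¬ WindowsGood t.1.1.1 t.1.1.2 t.1.2.1 δ (heavyBound n) F t.1.2.2)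
  let ε₁ : TestParam n × Bool → ℝ := fun t =>
    if t.2 = true then 24 / (t.1.1.2 t.1.2.2).card else 1 / (8 * n)
  have hind0 : ∀ p : Prop, 0 ≤ ind p := fun p => by unfold ind; split_ifs <;> norm_num
  have hind1 : ∀ p : Prop, ind p ≤ 1 := fun p => by unfold ind; split_ifs <;> norm_num
  obtain ⟨F, hF⟩ := exists_sample (T₁.filter good₁) φ₁ (fun _ _ => hind0 _) (fun _ _ => hind1 _)
    ε₁ (fun t ht => by
      obtain ⟨⟨⟨N, Ψ⟩, pk, v⟩, b⟩ := t
      have hg := (mem_filter.1 ht).2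
      cases b with
      | true =>
        simp only [good₁, if_true] at hg
        simp only [φ₁, ε₁, if_true]
        exact pr_not_nomOk_le hM (fun _ => 0) hg.1 hg.2
      | false =>
        simp only [good₁, Bool.false_eq_true, if_false] at hg
        simp only [φ₁, ε₁, Bool.false_eq_true, if_false]
        refine (pr_not_windowsGood_le hδ0 hδ1 hg).trans ?_
        rw [Fintype.card_fin]
        exact window_error_le hn)
    (n ^ (γ + 8)) (1 / (2 * n)) (by
      refine lt_exp_of_le_two_pow (k := 4 * n ^ (γ + 2) + 1) ?_ ?_ (by positivity)
      · refine (card_filter_le _ _).trans ?_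
        rw [card_product, pow_succ]
        exact Nat.mul_le_mul (card_testSet_le γ hn) (by simp)
      · rw [hsize 7, le_div_iff₀ (by norm_num)]
        exact_mod_cast (by omega : (4 * n ^ (γ + 2) + 1) * 2 ≤ n ^ (γ + 7)))
  -- The sample of choices of candidate colors.
  let T₂ := testSet n γ ×ˢ (univ : Finset (Fin (n ^ (γ + 8))))
  let good₂ : TestParam n × Fin (n ^ (γ + 8)) → Prop := fun t =>
    Critical t.1.1.1 t.1.1.2 t.1.2.1 t.1.2.2 ∧
    ∀ u ∈ insert t.1.2.2 (helpers t.1.1.1 t.1.2.1 t.1.2.2), u ∉ t.1.1.1 u ∧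
      WindowsGood t.1.1.1 t.1.1.2 t.1.2.1 δ (heavyBound n) (F t.2) u
  let φ₂ : TestParam n × Fin (n ^ (γ + 8)) → (Fin n → Fin (windowSize n)) → ℝ := fun t ω => ind
    ((((helpers t.1.1.1 t.1.2.1 t.1.2.2).filter fun u =>
      Ok (heavyBound n) (window t.1.1.2 (F t.2)) (t.1.1.2 t.1.2.2)
        ((t.1.1.1 u).filter fun w => w ∈ t.1.2.1) ω u).card : ℝ)
      < 0.22 * (helpers t.1.1.1 t.1.2.1 t.1.2.2).card)
  let ε₂ : TestParam n × Fin (n ^ (γ + 8)) → ℝ := fun t =>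
    Real.exp (-(0.003 * (helpers t.1.1.1 t.1.2.1 t.1.2.2).card))
      + 2 * (helpers t.1.1.1 t.1.2.1 t.1.2.2).card * δ
  obtain ⟨ω, hω⟩ := exists_sample (T₂.filter good₂) φ₂ (fun _ _ => hind0 _) (fun _ _ => hind1 _)
    ε₂ (fun t ht => by
      obtain ⟨⟨⟨N, Ψ⟩, pk, v⟩, a⟩ := t
      have hg := (mem_filter.1 ht).2
      simp only [good₂] at hg
      obtain ⟨hc, hg⟩ := hg
      exact pr_few_ok_le (heavyBound n) (window Ψ (F a)) (Ψ v)
        (fun u => (N u).filter fun w => w ∈ pk) (helpers N pk v)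
        (fun u hu h => (hg u (mem_insert_of_mem hu)).1 (mem_filter.1 h).1)
        (fun u hu => (hg u (mem_insert_of_mem hu)).2.1 (mem_of_mem_helpers hu).2.2)
        (fun u hu => ((hg v (mem_insert_self _ _)).2.2 hc u hu).1)
        (fun u hu => ((hg v (mem_insert_self _ _)).2.2 hc u hu).2))
    (n ^ (γ + 10)) (1 / (2 * n)) (by
      have hγ : γ + 8 ≤ n ^ (γ + 3) := by
        have h1 : γ + 1 ≤ 2 ^ γ := Nat.lt_two_pow_self
        calc γ + 8 ≤ 2 ^ γ * 2 ^ 3 := by omega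
          _ = 2 ^ (γ + 3) := by rw [pow_add]
          _ ≤ n ^ (γ + 3) := Nat.pow_le_pow_left hn _
      have h1 : n ^ (γ + 8) ≤ 2 ^ n ^ (γ + 4) := by
        calc n ^ (γ + 8) ≤ (2 ^ n) ^ (γ + 8) := Nat.pow_le_pow_left Nat.lt_two_pow_self.le _
          _ = 2 ^ (n * (γ + 8)) := by rw [← pow_mul]
          _ ≤ 2 ^ (n * n ^ (γ + 3)) := Nat.pow_le_pow_right (by norm_num) (Nat.mul_le_mul_left _ hγ)
          _ = _ := by rw [mul_comm, ← pow_succ]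
      refine lt_exp_of_le_two_pow (k := 4 * n ^ (γ + 2) + n ^ (γ + 4)) ?_ ?_ (by positivity)
      · refine (card_filter_le _ _).trans ?_
        rw [card_product, card_univ, Fintype.card_fin, pow_add 2]
        exact Nat.mul_le_mul (card_testSet_le γ hn) h1
      · rw [hsize 9, le_div_iff₀ (by norm_num)]
        have h2 : n ^ (γ + 2) ≤ n ^ (γ + 4) := Nat.pow_le_pow_right (by omega) (by omega)
        have h3 : 32 * n ^ (γ + 4) ≤ n ^ (γ + 9) := by
          calc 32 * n ^ (γ + 4) ≤ n ^ 5 * n ^ (γ + 4) := Nat.mul_le_mul_right _ h32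
            _ = n ^ (γ + 9) := by ring
        exact_mod_cast (by omega : (4 * n ^ (γ + 2) + n ^ (γ + 4)) * 2 ≤ n ^ (γ + 9)))
  have hmem : ∀ (N : Fin n → Finset (Fin n)) (Ψ : Fin n → Finset ℕ) (pk : Finset (Fin n))
      (v : Fin n), (∀ u, Ψ u ⊆ range (n ^ γ)) → ((N, Ψ), (pk, v)) ∈ testSet n γ :=
    fun N Ψ pk v h => mem_product.2 ⟨mem_product.2 ⟨mem_univ _, Fintype.mem_piFinset.2 fun u =>
      mem_powerset.2 (h u)⟩, mem_univ _⟩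
  refine ⟨F, ω, ⟨fun N Ψ v hΨ h1 h2 => ?_, fun N Ψ pk v hΨ hv => ?_,
    fun N Ψ pk v a hΨ hc hg => ?_⟩⟩
  · have := hF (((N, Ψ), (∅, v)), true) (mem_filter.2 ⟨mem_product.2 ⟨hmem N Ψ ∅ v hΨ,
      mem_univ _⟩, by simp only [good₁, if_true]; exact ⟨h1, h2⟩⟩)
    simp only [φ₁, ε₁, if_true] at this
    exact this.trans_eq (by ring)
  · have := hF (((N, Ψ), (pk, v)), false) (mem_filter.2 ⟨mem_product.2 ⟨hmem N Ψ pk v hΨ,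
      mem_univ _⟩, by simp only [good₁, Bool.false_eq_true, if_false]; exact hv⟩)
    simp only [φ₁, ε₁, Bool.false_eq_true, if_false] at this
    refine this.trans_eq ?_
    field_simp; norm_num
  · exact hω (((N, Ψ), (pk, v)), a) (mem_filter.2 ⟨mem_product.2 ⟨hmem N Ψ pk v hΨ,
      mem_univ _⟩, hc, hg⟩)

end Samples

/-! ### The trial on the subgraph of nodes with large palettes -/

section Subgraph

variable {n : ℕ} (G : SimpleGraph (Fin n)) (Ψ : Fin n → Finset ℕ) (C : ℕ)

/-- The neighbors of `v` in the subgraph of the nodes with at least `C` colors. -/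
noncomputable def nbrs (v : Fin n) : Finset (Fin n) :=
  univ.filter fun u => G.Adj v u ∧ C ≤ (Ψ u).card

/-- The subgraph of the nodes with at least `C` colors. -/
abbrev trialGraph : SimpleGraph (trialNodes Ψ C) :=
  G.comap (Subtype.val : trialNodes Ψ C → Fin n)

variable {G Ψ C}

lemma mem_nbrs {u v : Fin n} : u ∈ nbrs G Ψ C v ↔ G.Adj v u ∧ C ≤ (Ψ u).card := by
  simp [nbrs]

lemma card_neighborFinset_filter (x : trialNodes Ψ C) (p : Fin n → Prop) [DecidablePred p]
    [DecidablePred fun u : trialNodes Ψ C => p u.1]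
    [Fintype ((trialGraph G Ψ C).neighborSet x)] :
    (((trialGraph G Ψ C).neighborFinset x).filter fun u => p u.1).card
      = ((nbrs G Ψ C x.1).filter p).card := by
  refine Finset.card_bij (fun u _ => u.1) (fun u hu => ?_) (fun u _ w _ h => Subtype.ext h)
    (fun u hu => ?_)
  · simp only [mem_filter, SimpleGraph.mem_neighborFinset, SimpleGraph.comap_adj] at hu
    exact mem_filter.2 ⟨mem_nbrs.2 ⟨hu.1, u.2⟩, hu.2⟩
  · obtain ⟨hu, hp⟩ := mem_filter.1 hu
    obtain ⟨ha, hC⟩ := mem_nbrs.1 hu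
    exact ⟨⟨u, hC⟩, by simpa using ⟨ha, hp⟩, rfl⟩

lemma degree_trialGraph (x : trialNodes Ψ C) [Fintype ((trialGraph G Ψ C).neighborSet x)] :
    (trialGraph G Ψ C).degree x = (nbrs G Ψ C x.1).card := by
  have := card_neighborFinset_filter (G := G) x fun _ => True
  simpa using this

lemma card_highNbrs_filter (x : trialNodes Ψ C) (p : Fin n → Prop) [DecidablePred p]
    [DecidablePred fun u : trialNodes Ψ C => p u.1] :
    ((ColorTrial.highNbrs (trialGraph G Ψ C) x).filter fun u => p u.1).card
      = ((higherNbrs (nbrs G Ψ C) x.1).filter p).card := by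
  rw [ColorTrial.highNbrs, higherNbrs, Finset.filter_filter, Finset.filter_filter]
  simp only [degree_trialGraph]
  exact card_neighborFinset_filter x fun u =>
    3 * (nbrs G Ψ C x.1).card ≤ (nbrs G Ψ C u).card ∧ p u

lemma card_highNbrs (x : trialNodes Ψ C) :
    (ColorTrial.highNbrs (trialGraph G Ψ C) x).card = (higherNbrs (nbrs G Ψ C) x.1).card := by
  have := card_highNbrs_filter (G := G) x fun _ => True
  simpa using this

lemma nomSuccess_iff (nom : Fin n → Prop) (x : trialNodes Ψ C) :
    ColorTrial.NomSuccess (trialGraph G Ψ C) (fun v => Ψ v.1) (fun v => nom v.1) x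
      ↔ NomOk (nbrs G Ψ C) Ψ nom x.1 := by
  simp only [ColorTrial.NomSuccess, NomOk, degree_trialGraph, card_highNbrs]
  rw [card_neighborFinset_filter x nom, card_highNbrs_filter x nom]

/-- The nodes that pick a color in the coloring step. -/
noncomputable def pickers (G : SimpleGraph (Fin n)) (Ψ : Fin n → Finset ℕ) (C : ℕ)
    (nom : Fin n → Prop) : Finset (Fin n) :=
  univ.filter fun v => C ≤ (Ψ v).card ∧ nom v ∧ NomOk (nbrs G Ψ C) Ψ nom v

lemma mem_pickers {nom : Fin n → Prop} {v : Fin n} : v ∈ pickers G Ψ C nom ↔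
    C ≤ (Ψ v).card ∧ nom v ∧ NomOk (nbrs G Ψ C) Ψ nom v := by
  simp [pickers]

lemma picks_iff (nom : Fin n → Prop) (x : trialNodes Ψ C) :
    ColorTrial.Picks (trialGraph G Ψ C) (fun v => Ψ v.1) (fun v => nom v.1) x
      ↔ x.1 ∈ pickers G Ψ C nom := by
  rw [ColorTrial.Picks, nomSuccess_iff]
  simp [mem_pickers, x.2]

/-- A node succeeds in the coloring step if, provided that it is critical, at least `0.22` of its
chosen neighbors take a color outside its palette. -/
lemma colSuccess_of_helpers {nom : Fin n → Prop} {c : Fin n → ℕ} (hC : 10 ^ 10 ≤ C)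
    (x : trialNodes Ψ C) (hx : NomOk (nbrs G Ψ C) Ψ nom x.1)
    (h : Critical (nbrs G Ψ C) Ψ (pickers G Ψ C nom) x.1 →
      0.22 * ((helpers (nbrs G Ψ C) (pickers G Ψ C nom) x.1).card : ℝ) ≤
        ((helpers (nbrs G Ψ C) (pickers G Ψ C nom) x.1).filter fun u => c u ∉ Ψ x.1 ∧
          ∀ w ∈ nbrs G Ψ C u, w ∈ pickers G Ψ C nom → c w ≠ c u).card) :
    ColorTrial.ColSuccess (trialGraph G Ψ C) (fun v => Ψ v.1) (fun v => nom v.1)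
      (fun v => c v.1) x := by
  by_contra hcol
  simp only [ColorTrial.ColSuccess, not_or, not_le, not_lt, ge_iff_le, degree_trialGraph,
    card_highNbrs, nomSuccess_iff] at hcol
  obtain ⟨h1, h2, h3, h4⟩ := hcol
  rw [card_neighborFinset_filter x fun u => ¬ NomOk (nbrs G Ψ C) Ψ nom u] at h3
  have hlarge : (10 : ℝ) ^ 10 ≤ (Ψ x.1).card := by exact_mod_cast hC.trans x.2
  have hcrit : Critical (nbrs G Ψ C) Ψ (pickers G Ψ C nom) x.1 :=
    critical_of_nomOk hlarge hx h1 h2 h3 fun u hu hn hk =>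
      mem_pickers.2 ⟨(mem_nbrs.1 hu).2, hn, hk⟩
  have h5 := h hcrit
  have h6 : ((nbrs G Ψ C x.1).card : ℝ)
      ≤ 20 * (helpers (nbrs G Ψ C) (pickers G Ψ C nom) x.1).card := by
    exact_mod_cast hcrit.card_helpers
  set U := (helpers (nbrs G Ψ C) (pickers G Ψ C nom) x.1).filter fun u => c u ∉ Ψ x.1 ∧
          ∀ w ∈ nbrs G Ψ C u, w ∈ pickers G Ψ C nom → c w ≠ c u with hU
  have h7 : U.card ≤ (((trialGraph G Ψ C).neighborFinset x).filter fun u =>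
      ColorTrial.TakesColor (trialGraph G Ψ C) (fun v => Ψ v.1) (fun v => nom v.1)
        (fun v => c v.1) u ∧ c u.1 ∉ Ψ x.1).card := by
    have hUN : (nbrs G Ψ C x.1).filter (fun u => u ∈ U) = U := by
      ext u
      simp only [mem_filter, and_iff_right_iff_imp]
      exact fun hu => (mem_of_mem_helpers (mem_filter.1 hu).1).1
    rw [← hUN, ← card_neighborFinset_filter x fun u => u ∈ U]
    refine card_le_card (Finset.monotone_filter_right _ fun u _ hu => ?_)
    obtain ⟨hu1, hu2, hu3⟩ := mem_filter.1 hu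
    refine ⟨⟨(picks_iff nom u).2 (mem_of_mem_helpers hu1).2.2, fun w hw hwp => ?_⟩, hu2⟩
    exact hu3 w.1 (mem_nbrs.2 ⟨hw, w.2⟩) ((picks_iff nom w).1 hwp)
  have h8 : (U.card : ℝ) < 0.01 * (Ψ x.1).card := lt_of_le_of_lt (Nat.cast_le.2 h7) h4
  linarith

/-- The number of edges between failed nodes is at most the sum of their degrees. -/
lemma sizeF_le {A M : ℕ} (hA : n ≤ A) (h₁ h₂ : Fin A → Fin M) (cost : Fin n → ℕ)
    (hcost : ∀ x ∈ trialFailed hA G Ψ C h₁ h₂, (nbrs G Ψ C x.1).card ≤ cost x.1) :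
    sizeF hA G Ψ C h₁ h₂ ≤ ∑ v, cost v := by
  set S := trialFailed hA G Ψ C h₁ h₂ with hS
  have hE : sizeF hA G Ψ C h₁ h₂ = ((trialGraph G Ψ C).induce S).edgeFinset.card := by
    rw [sizeF, ← SimpleGraph.coe_edgeFinset, Set.ncard_coe_finset]
  have hdeg : ∀ x : S, ((trialGraph G Ψ C).induce S).degree x ≤ cost x.1.1 := by
    intro x
    refine le_trans ?_ (hcost x.1 x.2)
    rw [← degree_trialGraph x.1, ← SimpleGraph.card_neighborFinset_eq_degree,
      ← SimpleGraph.card_neighborFinset_eq_degree]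
    refine Finset.card_le_card_of_injOn (fun u => u.1) (fun u hu => ?_)
      (fun u _ w _ h => Subtype.ext h)
    rw [mem_coe, SimpleGraph.mem_neighborFinset] at hu ⊢
    exact hu
  have hsum := ((trialGraph G Ψ C).induce S).sum_degrees_eq_twice_card_edges
  have h1 : ∑ x : S, cost x.1.1 ≤ ∑ v, cost v := by
    let e : S ↪ Fin n := ⟨fun x => x.1.1, fun x y h => Subtype.ext (Subtype.ext h)⟩
    rw [show ∑ x : S, cost x.1.1 = ∑ v ∈ univ.map e, cost v from (Finset.sum_map univ e cost).symm]
    exact Finset.sum_le_sum_of_subset (subset_univ _)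
  have h2 := Finset.sum_le_sum fun x (_ : x ∈ (univ : Finset S)) => hdeg x
  rw [hE]
  omega

end Subgraph

/-! ### Locality of the tests -/

section Locality

variable {V : Type*} {R : ℕ} {col col' : V → Fin R → ℕ} {W : Finset V} {u : V}

lemma hit_congr (hW : ∀ w ∈ W, col w = col' w) (ω : V → Fin R) (c : ℕ) :
    Hit col W ω c ↔ Hit col' W ω c :=
  exists_congr fun w => and_congr_right fun hw => by rw [hW w hw]

lemma entries_congr (hu : col u = col' u) (hW : ∀ w ∈ W, col w = col' w) (r : Fin R) :
    entries col W u r = entries col' W u r := by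
  refine Finset.filter_congr fun e he => ?_
  rw [hu, hW e.1 (mem_product.1 he).1]

lemma heavy_congr (T : ℕ) (hu : col u = col' u) (hW : ∀ w ∈ W, col w = col' w) (r : Fin R) :
    Heavy T col W u r ↔ Heavy T col' W u r := by
  rw [Heavy, Heavy, entries_congr hu hW]

lemma fewInside_congr (S : Finset ℕ) (hu : col u = col' u) :
    FewInside col S u ↔ FewInside col' S u := by
  rw [FewInside, FewInside, hu]

lemma fewBlocked_congr [Fintype V] [DecidableEq V] (δ : ℝ) (T : ℕ)
    (hu : col u = col' u) (hW : ∀ w ∈ W, col w = col' w) :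
    FewBlocked δ T col W u ↔ FewBlocked δ T col' W u := by
  simp only [FewBlocked, heavy_congr T hu hW, hit_congr hW, hu]

lemma fewRepeated_congr [Fintype V] [DecidableEq V] (δ : ℝ) (hu : col u = col' u)
    (hW : ∀ w ∈ W, col w = col' w) :
    FewRepeated δ col W u ↔ FewRepeated δ col' W u := by
  simp only [FewRepeated, hit_congr hW, hu]

variable {N N' : V → Finset V} {Ψ Ψ' : V → Finset ℕ} {pk pk' : Finset V} {v : V} {M : ℕ}

/-- Two trials look the same at `v`: the neighborhood of `v`, all degrees, and the palettes of `v`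
and its neighbors agree. -/
structure SameView (N N' : V → Finset V) (Ψ Ψ' : V → Finset ℕ) (v : V) : Prop where
  nbrs : N v = N' v
  degree : ∀ u, (N u).card = (N' u).card
  palette : Ψ v = Ψ' v
  palettes : ∀ u ∈ N v, Ψ u = Ψ' u

lemma SameView.higherNbrs (h : SameView N N' Ψ Ψ' v) : higherNbrs N v = higherNbrs N' v := by
  rw [TrialDerandomization.higherNbrs, TrialDerandomization.higherNbrs, ← h.nbrs]
  simp only [h.degree]

lemma SameView.nomOk (h : SameView N N' Ψ Ψ' v) (nom : V → Prop) :
    NomOk N Ψ nom v ↔ NomOk N' Ψ' nom v := by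
  rw [NomOk, NomOk, h.higherNbrs, h.nbrs, h.palette]

lemma SameView.critical (h : SameView N N' Ψ Ψ' v) : Critical N Ψ pk v ↔ Critical N' Ψ' pk v := by
  rw [Critical, Critical, h.higherNbrs, h.nbrs, h.palette]

lemma SameView.helpers (h : SameView N N' Ψ Ψ' v) : helpers N pk v = helpers N' pk v := by
  rw [TrialDerandomization.helpers, TrialDerandomization.helpers, h.higherNbrs, h.nbrs]

lemma SameView.window (h : SameView N N' Ψ Ψ' v) (F : V × Fin R → Fin M) :
    window Ψ F v = window Ψ' F v := by
  funext r
  rw [TrialDerandomization.window, TrialDerandomization.window, h.palette]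

lemma SameView.windows (h : SameView N N' Ψ Ψ' v) (F : V × Fin R → Fin M) {u : V} (hu : u ∈ N v) :
    TrialDerandomization.window Ψ F u = TrialDerandomization.window Ψ' F u := by
  funext r
  rw [TrialDerandomization.window, TrialDerandomization.window, h.palettes u hu]

lemma SameView.windowsGood [Fintype V] [DecidableEq V] (h : SameView N N' Ψ Ψ' v) (δ : ℝ) (T : ℕ)
    (F : V × Fin R → Fin M) :
    WindowsGood N Ψ pk δ T F v ↔ WindowsGood N' Ψ' pk δ T F v := by
  rw [WindowsGood, WindowsGood, h.critical, ← h.helpers, ← h.palette, ← h.nbrs]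
  refine and_congr (imp_congr_right fun _ => fewBlocked_congr δ T (h.window F) fun w hw =>
    h.windows F (mem_filter.1 hw).1) (imp_congr_right fun _ => forall₂_congr fun u hu => ?_)
  exact and_congr (fewInside_congr _ (h.windows F (mem_of_mem_helpers hu).1))
    (fewRepeated_congr δ (h.windows F (mem_of_mem_helpers hu).1) fun w hw =>
      h.windows F (mem_of_mem_helpers (erase_subset _ _ hw)).1)

/-- What the neighbors of `u` have to know about the conflicts of `u`: the positions of the heavy
colors in the window of `u`, and the entries of the other colors. -/
noncomputable def conflicts [Fintype V] (T : ℕ) (col : V → Fin R → ℕ) (W : Finset V) (u : V) :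
    Finset (Fin R × Option (V × Fin R)) :=
  univ.filter fun q => match q.2 with
    | none => Heavy T col W u q.1
    | some e => ¬ Heavy T col W u q.1 ∧ e ∈ entries col W u q.1

lemma conflicts_congr [Fintype V] (T : ℕ) (hu : col u = col' u) (hW : ∀ w ∈ W, col w = col' w) :
    conflicts T col W u = conflicts T col' W u := by
  simp only [conflicts, heavy_congr T hu hW, entries_congr hu hW]

/-- There is one conflict for a heavy color, and at most `T * R` conflicts for any other color. -/
lemma card_conflicts_le [Fintype V] (T : ℕ) : (conflicts T col W u).card ≤ R * (T * R + 1) := by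
  rw [Finset.card_eq_sum_card_fiberwise (t := (univ : Finset (Fin R))) (f := Prod.fst)
    (fun _ _ => mem_coe.2 (mem_univ _))]
  calc _ ≤ ∑ _r : Fin R, (T * R + 1) := Finset.sum_le_sum fun r _ => ?_
    _ = _ := by simp
  by_cases h : Heavy T col W u r
  · refine le_trans (card_le_card (t := {(r, none)}) fun q hq => ?_) (by simp)
    obtain ⟨hq1, rfl⟩ := mem_filter.1 hq
    obtain ⟨r, e⟩ := q
    cases e with
    | none => simp
    | some e => exact absurd h (mem_filter.1 hq1).2.1
  · refine le_trans (card_le_card (t := (entries col W u r).image fun e => (r, some e))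
      fun q hq => ?_) (card_image_le.trans ((not_lt.1 h).trans (Nat.le_succ _)))
    obtain ⟨hq1, rfl⟩ := mem_filter.1 hq
    obtain ⟨r, e⟩ := q
    cases e with
    | none => exact absurd (mem_filter.1 hq1).2 h
    | some e => exact mem_image.2 ⟨e, (mem_filter.1 hq1).2.2, rfl⟩

/-- Whether `u` is certain to take a color outside `S` can be told from its window, its conflicts,
and `S`. -/
lemma ok_iff_conflicts [Fintype V] (T : ℕ) (S : Finset ℕ) (ω : V → Fin R) :
    Ok T col S W ω u ↔ (ω u, none) ∉ conflicts T col W u ∧ col u (ω u) ∉ S ∧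
      ∀ w, (ω u, some (w, ω w)) ∉ conflicts T col W u := by
  simp only [Ok, conflicts, mem_filter, mem_univ, true_and, entries, mem_product, and_true]
  refine and_congr_right fun h => and_congr_right fun _ => ?_
  simp only [h, not_false_eq_true, true_and, Hit, not_exists]

end Locality

/-! ### The algorithm -/

section Protocol

variable {V : Type*} {n R M Na Nb : ℕ}

/-- The cost of `v` for the nominations given by the sample `F a`: its degree, if `v` fails in the
nomination step.  Nodes with small palettes do not count. -/
noncomputable def nomCost [NeZero R] (N : V → Finset V) (Ψ : V → Finset ℕ) (C : ℕ)
    (F : Fin Na → V × Fin R → Fin M) (v : V) (a : Fin Na) : ℕ :=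
  if C ≤ (Ψ v).card ∧ ¬ NomOk N Ψ (fun w => hashNominates (F a (w, 0))) v then (N v).card else 0

/-- The cost of `v` for the windows given by the sample `F a`: one, if they fail a test of `v`. -/
noncomputable def windowCost [Fintype V] [DecidableEq V] (N : V → Finset V) (Ψ : V → Finset ℕ)
    (pk : Finset V) (C : ℕ) (δ : ℝ) (T : ℕ) (F : Fin Na → V × Fin R → Fin M) (v : V) (a : Fin Na) :
    ℕ :=
  if C ≤ (Ψ v).card ∧ ¬ WindowsGood N Ψ pk δ T (F a) v then 1 else 0

/-- The cost of `v` for the choice `ω b` of candidate colors: its degree, if `v` is critical and too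
few of its helpers are certain to take a color outside the palette of `v`. -/
noncomputable def colCost (N : Fin n → Finset (Fin n)) (Ψ : Fin n → Finset ℕ) (pk : Finset (Fin n))
    (C T : ℕ) (F : Fin n × Fin R → Fin M) (ω : Fin Nb → Fin n → Fin R) (v : Fin n) (b : Fin Nb) :
    ℕ :=
  if C ≤ (Ψ v).card ∧ Critical N Ψ pk v ∧
      (((helpers N pk v).filter fun u => Ok T (window Ψ F) (Ψ v)
        ((N u).filter fun w => w ∈ pk) (ω b) u).card : ℝ) < 0.22 * (helpers N pk v).card
    then (N v).card else 0

variable {D γ C B : ℕ}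

/-- The admissible inputs. -/
abbrev Instance (n D γ : ℕ) : Type :=
  {x : SimpleGraph (Fin n) × (Fin n → Finset ℕ) // IsSqrtInstance n D γ x.1 x.2}

namespace Instance

variable (i : Instance n D γ)

/-- The palettes of an instance. -/
abbrev Ψ : Fin n → Finset ℕ := i.1.2

/-- The neighborhoods in the graph on which the trial is run. -/
noncomputable abbrev N (C : ℕ) : Fin n → Finset (Fin n) := nbrs i.1.1 i.1.2 C

/-- What the nodes know initially. -/
noncomputable abbrev loc : Fin n → Finset (Fin n) × Finset ℕ := localInput i.1.1 i.1.2

/-- The nodes that pick a color after the nominations of the sample point `F`. -/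
noncomputable abbrev pk [NeZero R] (C : ℕ) (F : Fin n × Fin R → Fin M) : Finset (Fin n) :=
  pickers i.1.1 i.1.2 C fun w => hashNominates (F (w, 0))

lemma nbrs_eq_filter (u : Fin n) :
    i.N C u = (i.loc u).1.filter fun w => C ≤ (i.Ψ w).card := by
  ext w
  simp [mem_nbrs, localInput]

lemma card_le_mul_sqrt {x : ℕ} (hn : 0 < n) (h : (x : ℝ) ≤ D * √(n : ℝ)) :
    x ≤ 2 * D * Nat.sqrt n := by
  have h1 : (√(n : ℝ)) ≤ 2 * Nat.sqrt n := by
    have h2 : 1 ≤ Nat.sqrt n := Nat.sqrt_pos.2 hn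
    have h3 := Real.real_sqrt_lt_nat_sqrt_succ (a := n)
    have h4 : (1 : ℝ) ≤ Nat.sqrt n := by exact_mod_cast h2
    linarith
  have h2 : (x : ℝ) ≤ D * (2 * Nat.sqrt n) := h.trans (mul_le_mul_of_nonneg_left h1 (by positivity))
  have h3 : (x : ℝ) ≤ ((2 * D * Nat.sqrt n : ℕ) : ℝ) := by push_cast; linarith
  exact_mod_cast h3

lemma card_neighbors_le (hn : 0 < n) (u : Fin n) : (i.loc u).1.card ≤ 2 * D * Nat.sqrt n :=
  card_le_mul_sqrt hn (i.2.degree_le u)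

lemma card_palette_le (hn : 0 < n) (u : Fin n) : (i.Ψ u).card ≤ 2 * D * Nat.sqrt n :=
  card_le_mul_sqrt hn (i.2.palette_le u)

lemma card_nbrs_le (hn : 0 < n) (u : Fin n) : (i.N C u).card ≤ 2 * D * Nat.sqrt n := by
  rw [nbrs_eq_filter]
  exact (card_filter_le _ _).trans (i.card_neighbors_le hn u)

lemma palette_subset (u : Fin n) : i.Ψ u ⊆ range (n ^ γ) := fun c hc =>
  mem_range.2 (i.2.color_lt u c hc)

lemma card_nbrs_lt (u : Fin n) : (i.N C u).card < (i.Ψ u).card := by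
  rw [nbrs_eq_filter]
  exact (card_filter_le _ _).trans_lt (i.2.degree_lt_palette u)

end Instance

/-- In four rounds, every node learns its view of the trial: it announces whether it takes part,
then its degree, and the palettes are relayed to all neighbors. -/
lemma knows_view (hn : 0 < n) (hB₁ : 2 ≤ 2 ^ B) (hB₂ : n + 1 ≤ 2 ^ B)
    (hB₃ : (n + 1) ^ (2 * D) * (n ^ γ + 1) ^ (2 * D) ≤ 2 ^ B)
    (hB₄ : (n * n ^ γ + 1) ^ (2 * D * (2 * D)) ≤ 2 ^ B) :
    ∃ (α : Type) (_ : Nonempty α) (f : Instance n D γ → Fin n → α),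
      Knows B Instance.loc 4 f ∧
      ∀ i j v, f i v = f j v → SameView (i.N C) (j.N C) i.Ψ j.Ψ v := by
  have h0 : Knows B (Instance.loc (n := n) (D := D) (γ := γ)) 0 Instance.loc := Knows.input
  have h1 := h0.broadcast (m := fun i u => decide (C ≤ (i.Ψ u).card))
    (fun i j v h => by
      have : i.Ψ v = j.Ψ v := congrArg Prod.snd h
      simp only [this]) univ (by simpa using hB₁) (fun _ _ => mem_univ _)
  have hbig : ∀ i j : Instance n D γ, (fun u => decide (C ≤ (i.Ψ u).card))
      = (fun u => decide (C ≤ (j.Ψ u).card)) → ∀ u, C ≤ (i.Ψ u).card ↔ C ≤ (j.Ψ u).card :=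
    fun i j h u => by simpa using congrFun h u
  have hnbrs : ∀ (i j : Instance n D γ) (v : Fin n), i.loc v = j.loc v →
      (∀ u, C ≤ (i.Ψ u).card ↔ C ≤ (j.Ψ u).card) → i.N C v = j.N C v := fun i j v h hb => by
    rw [i.nbrs_eq_filter, j.nbrs_eq_filter, h]
    simp only [hb]
  have h2 := h1.broadcast (m := fun i u => (i.N C u).card)
    (fun i j v h => by
      have h' := Prod.ext_iff.1 h
      simp only [hnbrs i j v h'.1 (hbig i j h'.2)]) (range (n + 1)) (by simpa using hB₂)
    (fun i u => by
      rw [mem_range, Nat.lt_succ_iff]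
      exact (card_le_univ _).trans_eq (Fintype.card_fin n))
  have h3 := h2.localBroadcast (nb := fun i u => (i.loc u).1) (X := fun i u => i.Ψ u)
    (range (n ^ γ))
    (fun i j v h => congrArg Prod.fst (congrArg (fun z => z.1.1) h))
    (fun i j v h => congrArg Prod.snd (congrArg (fun z => z.1.1) h))
    (fun i u => i.palette_subset u) (2 * D) (2 * D) (Nat.sqrt n) (Nat.sqrt_le n)
    (fun i u => i.card_neighbors_le hn u) (fun i u => i.card_palette_le hn u)
    (by simpa using hB₃) (by simpa using hB₄)
  refine ⟨_, inferInstance, _, h3, fun i j v h => ?_⟩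
  have hp := (Prod.ext_iff.1 h).2
  have hd := (Prod.ext_iff.1 (Prod.ext_iff.1 h).1).2
  have hl := Prod.ext_iff.1 (Prod.ext_iff.1 (Prod.ext_iff.1 h).1).1
  have hl1 : i.loc v = j.loc v := hl.1
  have hN := hnbrs i j v hl1 (hbig i j hl.2)
  refine ⟨hN, fun u => congrFun hd u, congrArg Prod.snd hl1, fun u hu => ?_⟩
  have hu' : u ∈ (i.loc v).1 := by
    rw [i.nbrs_eq_filter] at hu
    exact (mem_filter.1 hu).1
  ext c
  have := Finset.ext_iff.1 hp (u, c)
  simp only [mem_filter, mem_product, ← hl1, hu', true_and] at this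
  constructor
  · exact fun hc => (this.1 ⟨i.palette_subset u hc, hc⟩).2
  · exact fun hc => (this.2 ⟨j.palette_subset u hc, hc⟩).2

/-- The algorithm: the seeds are chosen one after the other by the method of conditional
expectations.  Between the choices, the nodes announce whether they pick a color, and conflicts of
candidate colors are relayed to all neighbors. -/
lemma exists_protocol [NeZero R] [NeZero Na] [NeZero Nb] (hn : 0 < n) {δ : ℝ} {T κ L₁ L₂ : ℕ}
    (F : Fin Na → Fin n × Fin R → Fin M) (ω : Fin Nb → Fin n → Fin R)
    (hκ : R * (T * R + 1) ≤ κ * Nat.sqrt n) (hNa : Na ≤ n ^ L₁) (hNb : Nb ≤ n ^ L₂)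
    (hB₁ : 2 ≤ 2 ^ B) (hB₂ : n + 1 ≤ 2 ^ B)
    (hB₃ : (n + 1) ^ (2 * D) * (n ^ γ + 1) ^ (2 * D) ≤ 2 ^ B)
    (hB₄ : (n * n ^ γ + 1) ^ (2 * D * (2 * D)) ≤ 2 ^ B)
    (hB₅ : n * (Na * n) + 1 ≤ 2 ^ B) (hB₆ : n * (Nb * n) + 1 ≤ 2 ^ B)
    (hB₇ : (n + 1) ^ (2 * D) * (R * (n * R + 1) + 1) ^ κ ≤ 2 ^ B)
    (hB₈ : (n * (R * (n * R + 1)) + 1) ^ (2 * D * κ) ≤ 2 ^ B) :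
    ∃ (a₁ a₂ : Instance n D γ → Fin Na) (b : Instance n D γ → Fin Nb),
      Knows B Instance.loc (7 + 4 * L₁ + 2 * L₂) (fun i _ => (a₁ i, a₂ i, b i)) ∧
      ∀ i, Na * ∑ v, nomCost (i.N C) i.Ψ C F v (a₁ i) ≤ ∑ a, ∑ v, nomCost (i.N C) i.Ψ C F v a ∧
        Na * ∑ v, windowCost (i.N C) i.Ψ (i.pk C (F (a₁ i))) C δ T F v (a₂ i)
          ≤ ∑ a, ∑ v, windowCost (i.N C) i.Ψ (i.pk C (F (a₁ i))) C δ T F v a ∧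
        Nb * ∑ v, colCost (i.N C) i.Ψ (i.pk C (F (a₁ i))) C T (F (a₂ i)) ω v (b i)
          ≤ ∑ s, ∑ v, colCost (i.N C) i.Ψ (i.pk C (F (a₁ i))) C T (F (a₂ i)) ω v s := by
  have hdeg : ∀ (i : Instance n D γ) v, (i.N C v).card ≤ n := fun i v =>
    (card_le_univ _).trans_eq (Fintype.card_fin n)
  obtain ⟨α, _, f, hf, hview⟩ := knows_view (C := C) hn hB₁ hB₂ hB₃ hB₄
  obtain ⟨a₁, hf₁, ha₁⟩ := hf.select (fun i v => nomCost (i.N C) i.Ψ C F v)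
    (fun i j v h => funext fun a => by
      have hv := hview i j v h
      simp only [nomCost, hv.nomOk, hv.palette, hv.nbrs]) n
    (fun i v a => by unfold nomCost; split_ifs <;> simp [hdeg]) L₁ hn hNa hB₅
  have hf₂ := hf₁.broadcast (m := fun i v => decide (v ∈ i.pk C (F (a₁ i))))
    (fun i j v h => by
      have h' := Prod.ext_iff.1 h
      have hv := hview i j v h'.1
      have ha : a₁ i = a₁ j := h'.2
      simp only [pickers, mem_filter, mem_univ, true_and, hv.nomOk, hv.palette, ha])
    univ (by simpa using hB₁) (fun _ _ => mem_univ _)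
  have hpk : ∀ i j : Instance n D γ, (fun v => decide (v ∈ i.pk C (F (a₁ i))))
      = (fun v => decide (v ∈ j.pk C (F (a₁ j)))) → i.pk C (F (a₁ i)) = j.pk C (F (a₁ j)) :=
    fun i j h => by
      ext v
      simpa using congrFun h v
  obtain ⟨a₂, hf₃, ha₂⟩ := hf₂.select
    (fun i v => windowCost (i.N C) i.Ψ (i.pk C (F (a₁ i))) C δ T F v)
    (fun i j v h => funext fun a => by
      have h' := Prod.ext_iff.1 h
      have hv := hview i j v (Prod.ext_iff.1 h'.1).1
      simp only [windowCost, hv.windowsGood, hv.palette, hpk i j h'.2]) n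
    (fun i v a => by unfold windowCost; split_ifs <;> omega) L₁ hn hNa hB₅
  let conf : Instance n D γ → Fin n → Finset (Fin R × Option (Fin n × Fin R)) := fun i u =>
    conflicts T (window i.Ψ (F (a₂ i))) ((i.N C u).filter fun w => w ∈ i.pk C (F (a₁ i))) u
  have hf₄ := hf₃.localBroadcast (nb := fun i u => i.N C u) (X := conf) univ
    (fun i j v h => (hview i j v (congrArg (fun z => z.1.1.1) h)).nbrs)
    (fun i j v h => by
      have h' := Prod.ext_iff.1 h
      have hv := hview i j v (congrArg (fun z => z.1.1.1) h)
      have ha : a₂ i = a₂ j := h'.2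
      have hp := hpk i j (Prod.ext_iff.1 h'.1).2
      simp only [conf]
      rw [conflicts_congr T (hv.window _) (fun w hw => hv.windows _ (mem_filter.1 hw).1), hp, ha,
        hv.nbrs])
    (fun _ _ => subset_univ _) (2 * D) κ (Nat.sqrt n) (Nat.sqrt_le n)
    (fun i u => i.card_nbrs_le hn u) (fun i u => (card_conflicts_le T).trans hκ)
    (by simpa [Fintype.card_prod, Fintype.card_option] using hB₇)
    (by simpa [Fintype.card_prod, Fintype.card_option] using hB₈)
  obtain ⟨b, hf₅, hb⟩ := hf₄.select
    (fun i v => colCost (i.N C) i.Ψ (i.pk C (F (a₁ i))) C T (F (a₂ i)) ω v)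
    (fun i j v h => funext fun s => by
      have h' := Prod.ext_iff.1 h
      have hv := hview i j v (congrArg (fun z => z.1.1.1.1) h)
      have ha : a₂ i = a₂ j := congrArg (fun z => z.1.2) h
      have hp := hpk i j (congrArg (fun z => z.1.1.2) h)
      have hok : ((helpers (i.N C) (i.pk C (F (a₁ i))) v).filter fun u =>
            Ok T (window i.Ψ (F (a₂ i))) (i.Ψ v)
              ((i.N C u).filter fun w => w ∈ i.pk C (F (a₁ i))) (ω s) u)
          = (helpers (j.N C) (j.pk C (F (a₁ j))) v).filter fun u =>
            Ok T (window j.Ψ (F (a₂ j))) (j.Ψ v)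
              ((j.N C u).filter fun w => w ∈ j.pk C (F (a₁ j))) (ω s) u := by
        rw [hv.helpers, hp]
        refine Finset.filter_congr fun u hu => ?_
        have huN : u ∈ j.N C v := (mem_of_mem_helpers hu).1
        have hconf : conf i u = conf j u := by
          ext q
          have := Finset.ext_iff.1 h'.2 (u, q)
          simpa [hv.nbrs, huN] using this
        have hw := hv.windows (F (a₂ i)) (hv.nbrs ▸ huN)
        rw [← hp, ok_iff_conflicts, ok_iff_conflicts, hp]
        simp only [conf] at hconf
        rw [hp] at hconf
        rw [hconf, hw, hv.palette, ha]
      have hcrit := hv.critical (pk := i.pk C (F (a₁ i)))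
      have hhelp := hv.helpers (pk := i.pk C (F (a₁ i)))
      simp only [colCost]
      rw [hok, hcrit, hhelp, hp, hv.palette, hv.nbrs]) n
    (fun i v s => by unfold colCost; split_ifs <;> simp [hdeg]) L₂ hn hNb hB₆
  refine ⟨a₁, a₂, b, ?_, fun i => ⟨ha₁ i, ha₂ i, hb i⟩⟩
  have := hf₅.map fun _ z => (z.1.1.1.1.2, z.1.1.2, z.2)
  have hr : 4 + 2 * L₁ + 1 + 2 * L₁ + 2 + 2 * L₂ = 7 + 4 * L₁ + 2 * L₂ := by ring
  rwa [hr] at this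

end Protocol

/-! ### The cost of the selected seeds -/

section Averaging

/-- If each node pays its degree in a bad event, then a seed of at most average cost costs at most
the expectation. -/
lemma sum_cost_le {V : Type*} [Fintype V] {S : ℕ} [NeZero S] (d : V → ℕ) (p : V → Fin S → Prop)
    (cost : V → Fin S → ℕ) (hcost : ∀ v s, cost v s = if p v s then d v else 0) (s₀ : Fin S)
    (h : S * ∑ v, cost v s₀ ≤ ∑ s, ∑ v, cost v s) :
    ((∑ v, cost v s₀ : ℕ) : ℝ) ≤ ∑ v, (d v : ℝ) * pr (p v) := by
  have hS : (0 : ℝ) < S := by exact_mod_cast Nat.pos_of_ne_zero (NeZero.ne S)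
  have h1 : ((∑ s, ∑ v, cost v s : ℕ) : ℝ) = S * ∑ v, (d v : ℝ) * pr (p v) := by
    rw [Finset.sum_comm, Finset.mul_sum]
    push_cast
    refine Finset.sum_congr rfl fun v _ => ?_
    rw [pr_eq_card_div, Fintype.card_fin, Finset.card_filter]
    push_cast
    rw [mul_div_assoc', mul_div_cancel₀ _ hS.ne', Finset.mul_sum]
    refine Finset.sum_congr rfl fun s _ => ?_
    rw [hcost]
    split_ifs <;> simp
  have h2 : (S : ℝ) * ((∑ v, cost v s₀ : ℕ) : ℝ) ≤ S * ∑ v, (d v : ℝ) * pr (p v) := by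
    rw [← h1]; exact_mod_cast h
  exact le_of_mul_le_mul_left h2 hS

lemma pr_and_left {Ω : Type*} [Fintype Ω] {q : Prop} {p : Ω → Prop} {x : ℝ} (hx : 0 ≤ x)
    (h : q → pr p ≤ x) : pr (fun ω => q ∧ p ω) ≤ x := by
  by_cases hq : q
  · simpa only [hq, true_and] using h hq
  · simp only [hq, false_and, pr, if_false]
    rw [Finset.expect_const_zero]
    exact hx

lemma mul_exp_neg_le {m : ℝ} : m * Real.exp (-(0.003 * m)) ≤ 1000 / 3 := by
  have h1 := Real.add_one_le_exp (0.003 * m)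
  rw [Real.exp_neg, ← div_eq_mul_inv, div_le_iff₀ (Real.exp_pos _)]
  linarith

end Averaging

section Analysis

variable {n D γ C M Na Nb : ℕ} {F : Fin Na → Fin n × Fin (windowSize n) → Fin M}
  {ω : Fin Nb → Fin n → Fin (windowSize n)} (i : Instance n D γ)

namespace Instance

lemma card_nbrs_le_size (v : Fin n) : (i.N C v).card ≤ n :=
  (card_le_univ _).trans_eq (Fintype.card_fin n)

lemma palette_le_mul (hn : 2 ≤ n) (v : Fin n) : (i.Ψ v).card ≤ D * n := by
  have h1 : (√(n : ℝ)) ≤ n := by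
    rw [Real.sqrt_le_left (by positivity)]
    have : (1 : ℝ) ≤ n := by exact_mod_cast (by omega : 1 ≤ n)
    nlinarith
  have h2 := (i.2.palette_le v).trans (mul_le_mul_of_nonneg_left h1 (Nat.cast_nonneg D))
  exact_mod_cast h2

lemma validAt {R : ℕ} [NeZero R] (hn : 2 ≤ n) (hC : 10 ^ 10 ≤ C) (hM : 1000 * (D * n) ≤ M)
    (F₀ : Fin n × Fin R → Fin M) {v : Fin n} (hv : C ≤ (i.Ψ v).card) :
    ValidAt (i.N C) i.Ψ (i.pk C F₀) M v := by
  have hl : (10 : ℝ) ^ 10 ≤ (i.Ψ v).card := by exact_mod_cast hC.trans hv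
  constructor
  · exact fun h => (mem_nbrs.1 h).1.ne rfl
  · exact hl
  · exact fun u _ => i.card_nbrs_lt u
  · exact fun u _ => (Nat.mul_le_mul_left _ (i.palette_le_mul hn u)).trans hM
  · intro h
    have hmem : ∀ u ∈ i.pk C F₀, hashNominates (F₀ (u, 0)) ∧
        NomOk (i.N C) i.Ψ (fun w => hashNominates (F₀ (w, 0))) u := fun u hu =>
      (mem_pickers.1 hu).2
    convert card_nbr_pickers_le hl (i.card_nbrs_lt v).le (hmem v h).2 fun u hu => (hmem u hu).1

/-- A node pays at most `p(v)`, with probability `O(1 / p(v) + 1 / n)`. -/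
lemma sum_nomCost_le [NeZero Na] (hS : GoodSamples (γ := γ) F ω) (hn : 2 ≤ n) (a : Fin Na)
    (h : Na * ∑ v, nomCost (i.N C) i.Ψ C F v a ≤ ∑ a, ∑ v, nomCost (i.N C) i.Ψ C F v a) :
    ((∑ v, nomCost (i.N C) i.Ψ C F v a : ℕ) : ℝ) ≤ 49 * n := by
  have hn0 : (2 : ℝ) ≤ n := by exact_mod_cast hn
  refine (sum_cost_le (fun v => (i.N C v).card)
    (fun v a => C ≤ (i.Ψ v).card ∧ ¬ NomOk (i.N C) i.Ψ (fun w => hashNominates (F a (w, 0))) v)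
    (nomCost (i.N C) i.Ψ C F) (fun v a => by unfold nomCost; congr) a h).trans ?_
  calc _ ≤ ∑ _v : Fin n, (49 : ℝ) := Finset.sum_le_sum fun v _ => ?_
    _ = 49 * n := by simp [mul_comm]
  have hd := i.card_nbrs_lt (C := C) v
  have hd1 : ((i.N C v).card : ℝ) ≤ (i.Ψ v).card := by exact_mod_cast hd.le
  have hd2 : ((i.N C v).card : ℝ) ≤ n := by exact_mod_cast i.card_nbrs_le_size v
  have hp : (0 : ℝ) < (i.Ψ v).card := by exact_mod_cast (Nat.zero_le _).trans_lt hd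
  have h1 := pr_and_left (q := C ≤ (i.Ψ v).card) (by positivity) fun _ =>
    hS.nom (i.N C) i.Ψ v i.palette_subset (by omega) hd.le
  refine (mul_le_mul_of_nonneg_left h1 (Nat.cast_nonneg _)).trans ?_
  have h2 : ((i.N C v).card : ℝ) * (48 / (i.Ψ v).card) ≤ 48 := by
    rw [mul_div_assoc', div_le_iff₀ hp]; linarith
  have h3 : ((i.N C v).card : ℝ) * (1 / (2 * n)) ≤ 1 := by
    rw [mul_div_assoc', div_le_iff₀ (by positivity)]; linarith
  rw [mul_add]
  linarith

/-- The expected number of nodes with a failed test is at most `3 / 4`, so a seed of at most average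
cost has none. -/
lemma windowsGood_of_cost [NeZero Na] (hS : GoodSamples (γ := γ) F ω) (hn : 2 ≤ n)
    (hC : 10 ^ 10 ≤ C) (hM : 1000 * (D * n) ≤ M) (a a₂ : Fin Na)
    (h : Na * ∑ v, windowCost (i.N C) i.Ψ (i.pk C (F a)) C (1 / (n : ℝ) ^ 2) (heavyBound n) F v a₂
      ≤ ∑ s, ∑ v, windowCost (i.N C) i.Ψ (i.pk C (F a)) C (1 / (n : ℝ) ^ 2) (heavyBound n) F v s)
    {v : Fin n} (hv : C ≤ (i.Ψ v).card) :
    WindowsGood (i.N C) i.Ψ (i.pk C (F a)) (1 / (n : ℝ) ^ 2) (heavyBound n) (F a₂) v := by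
  have hn0 : (0 : ℝ) < n := by exact_mod_cast (by omega : 0 < n)
  have h0 := sum_cost_le (fun _ => 1)
    (fun v a₂ => C ≤ (i.Ψ v).card ∧
      ¬ WindowsGood (i.N C) i.Ψ (i.pk C (F a)) (1 / (n : ℝ) ^ 2) (heavyBound n) (F a₂) v)
    (windowCost (i.N C) i.Ψ (i.pk C (F a)) C (1 / (n : ℝ) ^ 2) (heavyBound n) F)
    (fun v a => by unfold windowCost; congr) a₂ h
  have h1 : ∑ v, ((1 : ℕ) : ℝ) * pr (fun a₂ => C ≤ (i.Ψ v).card ∧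
      ¬ WindowsGood (i.N C) i.Ψ (i.pk C (F a)) (1 / (n : ℝ) ^ 2) (heavyBound n) (F a₂) v) < 1 := by
    calc _ ≤ ∑ _v : Fin n, (3 / (4 * n) : ℝ) := Finset.sum_le_sum fun v _ => ?_
      _ = 3 / 4 := by
        rw [Finset.sum_const, card_univ, Fintype.card_fin, nsmul_eq_mul]
        field_simp
      _ < 1 := by norm_num
    rw [Nat.cast_one, one_mul]
    exact pr_and_left (by positivity) fun hv =>
      hS.windows (i.N C) i.Ψ _ v i.palette_subset (i.validAt hn hC hM (F a) hv)
  have h2 := Nat.lt_one_iff.1 (Nat.cast_lt.1 ((h0.trans_lt h1).trans_eq Nat.cast_one.symm))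
  have h3 := (Finset.sum_eq_zero_iff.1 h2) v (mem_univ v)
  by_contra hcon
  rw [windowCost, if_pos ⟨hv, hcon⟩] at h3
  exact one_ne_zero h3

/-- A critical node has at most `20` times as many neighbors as helpers, and the probability that it
fails is exponentially small in the number of helpers. -/
lemma sum_colCost_le [NeZero Nb] (hS : GoodSamples (γ := γ) F ω) (hn : 2 ≤ n)
    (F₀ : Fin n × Fin (windowSize n) → Fin M) (a₂ : Fin Na)
    (b : Fin Nb)
    (hW : ∀ v, C ≤ (i.Ψ v).card →
      WindowsGood (i.N C) i.Ψ (i.pk C F₀) (1 / (n : ℝ) ^ 2) (heavyBound n) (F a₂) v)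
    (h : Nb * ∑ v, colCost (i.N C) i.Ψ (i.pk C F₀) C (heavyBound n) (F a₂) ω v b
      ≤ ∑ s, ∑ v, colCost (i.N C) i.Ψ (i.pk C F₀) C (heavyBound n) (F a₂) ω v s) :
    ((∑ v, colCost (i.N C) i.Ψ (i.pk C F₀) C (heavyBound n) (F a₂) ω v b : ℕ) : ℝ)
      ≤ 14000 * n := by
  have hn0 : (2 : ℝ) ≤ n := by exact_mod_cast hn
  refine (sum_cost_le (fun v => (i.N C v).card)
    (fun v b => C ≤ (i.Ψ v).card ∧ Critical (i.N C) i.Ψ (i.pk C F₀) v ∧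
      (((helpers (i.N C) (i.pk C F₀) v).filter fun u =>
        Ok (heavyBound n) (window i.Ψ (F a₂)) (i.Ψ v)
          ((i.N C u).filter fun w => w ∈ i.pk C F₀) (ω b) u).card : ℝ)
        < 0.22 * (helpers (i.N C) (i.pk C F₀) v).card)
    (colCost (i.N C) i.Ψ (i.pk C F₀) C (heavyBound n) (F a₂) ω)
    (fun v b => by unfold colCost; congr) b h).trans ?_
  calc _ ≤ ∑ _v : Fin n, (14000 : ℝ) := Finset.sum_le_sum fun v _ => ?_
    _ = 14000 * n := by simp [mul_comm]
  set m : ℝ := ((helpers (i.N C) (i.pk C F₀) v).card : ℝ) with hm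
  set d : ℝ := ((i.N C v).card : ℝ) with hd
  have hdn : d ≤ n := by rw [hd]; exact_mod_cast i.card_nbrs_le_size v
  have hd0 : 0 ≤ d := Nat.cast_nonneg _
  have hm0 : 0 ≤ m := Nat.cast_nonneg _
  have hmd : m ≤ d := by
    rw [hm, hd]
    exact_mod_cast card_le_card fun u hu => (mem_of_mem_helpers hu).1
  by_cases hc : C ≤ (i.Ψ v).card ∧ Critical (i.N C) i.Ψ (i.pk C F₀) v
  · obtain ⟨hv, hc⟩ := hc
    have hdm : d ≤ 20 * m := by rw [hm, hd]; exact_mod_cast hc.card_helpers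
    have h1 := pr_and_left (q := C ≤ (i.Ψ v).card) (by positivity) fun _ =>
      pr_and_left (q := Critical (i.N C) i.Ψ (i.pk C F₀) v) (by positivity) fun _ =>
        hS.picks (i.N C) i.Ψ (i.pk C F₀) v a₂ i.palette_subset hc fun u hu => by
          refine ⟨fun h => (mem_nbrs.1 h).1.ne rfl, hW u ?_⟩
          rcases mem_insert.1 hu with rfl | hu
          · exact hv
          · exact (mem_nbrs.1 (mem_of_mem_helpers hu).1).2
    refine (mul_le_mul_of_nonneg_left h1 hd0).trans ?_
    rw [← hm]
    have h2 : d * Real.exp (-(0.003 * m)) ≤ 20 * (1000 / 3) := by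
      calc d * Real.exp (-(0.003 * m)) ≤ 20 * m * Real.exp (-(0.003 * m)) :=
            mul_le_mul_of_nonneg_right hdm (Real.exp_pos _).le
        _ = 20 * (m * Real.exp (-(0.003 * m))) := by ring
        _ ≤ _ := mul_le_mul_of_nonneg_left mul_exp_neg_le (by norm_num)
    have h3 : d * (m * (1 / (n : ℝ) ^ 2)) ≤ 1 := by
      rw [← mul_assoc, mul_one_div, div_le_one (by positivity), sq]
      exact mul_le_mul hdn (hmd.trans hdn) hm0 (by positivity)
    have h4 : d * (1 / (2 * n)) ≤ 1 := by
      rw [mul_one_div, div_le_one (by positivity)]; linarith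
    calc _ = 2 * (d * Real.exp (-(0.003 * m))) + 4 * (d * (m * (1 / (n : ℝ) ^ 2)))
          + d * (1 / (2 * n)) := by ring
      _ ≤ 14000 := by linarith
  · have h1 : pr (fun b => C ≤ (i.Ψ v).card ∧ Critical (i.N C) i.Ψ (i.pk C F₀) v ∧
      (((helpers (i.N C) (i.pk C F₀) v).filter fun u =>
        Ok (heavyBound n) (window i.Ψ (F a₂)) (i.Ψ v)
          ((i.N C u).filter fun w => w ∈ i.pk C F₀) (ω b) u).card : ℝ)
        < 0.22 * m) ≤ 0 := by
      simp only [← and_assoc]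
      exact pr_and_left le_rfl fun h => absurd h hc
    exact (mul_nonpos_of_nonneg_of_nonpos hd0 h1).trans (by norm_num)

/-- Nodes that fail pay their degree in the nomination step or in the coloring step. -/
lemma sizeF_le_cost {A : ℕ} (hA : n ≤ A) (hC : 10 ^ 10 ≤ C) (h₁ h₂ : Fin A → Fin M) (a₁ a₂ : Fin Na)
    (b : Fin Nb) (e₁ : ∀ v : Fin n, h₁ (Fin.castLE hA v) = F a₁ (v, 0))
    (e₂ : ∀ v : Fin n, h₂ (Fin.castLE hA v) = F a₂ (v, ω b v)) :
    sizeF hA i.1.1 i.Ψ C h₁ h₂ ≤ ∑ v, nomCost (i.N C) i.Ψ C F v a₁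
      + ∑ v, colCost (i.N C) i.Ψ (i.pk C (F a₁)) C (heavyBound n) (F a₂) ω v b := by
  rw [← Finset.sum_add_distrib]
  refine sizeF_le hA h₁ h₂ _ fun x hx => ?_
  have hx' : ¬ ColorTrial.NomSuccess (trialGraph i.1.1 i.Ψ C) (fun v => i.Ψ v.1)
        (fun v => hashNominates (F a₁ (v.1, 0))) x ∨
      ¬ ColorTrial.ColSuccess (trialGraph i.1.1 i.Ψ C) (fun v => i.Ψ v.1)
        (fun v => hashNominates (F a₁ (v.1, 0)))
        (fun v => window i.Ψ (F a₂) v.1 (ω b v.1)) x := by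
    simp only [trialFailed, ColorTrial.failed, e₁, e₂] at hx
    exact hx
  rw [nomSuccess_iff (fun v => hashNominates (F a₁ (v, 0)))] at hx'
  by_cases hnom : NomOk (i.N C) i.Ψ (fun v => hashNominates (F a₁ (v, 0))) x.1
  · have hcol := hx'.resolve_left (not_not.2 hnom)
    refine le_trans ?_ (Nat.le_add_left _ _)
    rw [colCost, if_pos]
    by_contra hcost
    refine hcol (colSuccess_of_helpers (nom := fun v => hashNominates (F a₁ (v, 0)))
      (c := fun v => window i.Ψ (F a₂) v (ω b v)) hC x hnom fun hc => ?_)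
    refine (not_lt.1 fun hlt => hcost ⟨x.2, hc, hlt⟩).trans (Nat.cast_le.2 (card_le_card ?_))
    refine Finset.monotone_filter_right _ fun u _ hu => ⟨hu.2.1, fun w hw hwp h => ?_⟩
    exact hu.2.2 ⟨w, mem_filter.2 ⟨hw, hwp⟩, h⟩
  · rw [nomCost, if_pos ⟨x.2, hnom⟩]
    exact Nat.le_add_right _ _

end Instance

end Analysis

/-! ### Parameters -/

section Parameters

lemma pow_six_le {l : ℕ} (hl : 0 < l) : l ^ 6 ≤ 4096 * 2 ^ (l - 1) := by
  obtain ⟨l, rfl⟩ := Nat.exists_eq_succ_of_ne_zero hl.ne'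
  rw [Nat.succ_sub_one]
  by_cases h : l < 9
  · interval_cases l <;> norm_num
  · induction l, not_lt.1 h using Nat.le_induction with
    | base => norm_num
    | succ l hl ih =>
      have h1 : (9 * (l + 1 + 1)) ^ 6 ≤ (10 * (l + 1)) ^ 6 := Nat.pow_le_pow_left (by omega) 6
      have h2 := ih (by omega) (by omega)
      simp only [Nat.succ_eq_add_one, mul_pow] at h1 h2 ⊢
      rw [pow_succ 2 l]
      omega

lemma log_pow_three_le {n : ℕ} (hn : 0 < n) : (Nat.log 2 n + 1) ^ 3 ≤ 128 * Nat.sqrt n := by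
  have h1 := pow_six_le (Nat.succ_pos (Nat.log 2 n))
  have h2 : 2 ^ Nat.log 2 n ≤ n := Nat.pow_log_le_self 2 hn.ne'
  have h3 : 1 ≤ Nat.sqrt n := Nat.sqrt_pos.2 hn
  have h4 : n ≤ (2 * Nat.sqrt n) ^ 2 := by
    have h5 := Nat.lt_succ_sqrt n
    nlinarith
  refine (Nat.pow_le_pow_iff_left (n := 2) (by norm_num)).1 ?_
  rw [← pow_mul]
  calc (Nat.log 2 n + 1) ^ 6 ≤ 4096 * 2 ^ Nat.log 2 n := h1
    _ ≤ 4096 * (2 * Nat.sqrt n) ^ 2 := Nat.mul_le_mul_left _ (h2.trans h4)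
    _ = (128 * Nat.sqrt n) ^ 2 := by ring

/-- The lists of conflicts consist of `O(√n)` words. -/
lemma card_conflicts_bound {n : ℕ} (hn : 0 < n) :
    windowSize n * (heavyBound n * windowSize n + 1) ≤ 256 * 10 ^ 16 * Nat.sqrt n := by
  have h := log_pow_three_le hn
  unfold windowSize heavyBound
  set l := Nat.log 2 n + 1 with hl
  have h1 : l ≤ l ^ 3 := Nat.le_self_pow (by norm_num) l
  calc 10 ^ 7 * l * (100 * l * (10 ^ 7 * l) + 1) = 10 ^ 16 * l ^ 3 + 10 ^ 7 * l := by ring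
    _ ≤ 2 * 10 ^ 16 * l ^ 3 := by omega
    _ ≤ 2 * 10 ^ 16 * (128 * Nat.sqrt n) := Nat.mul_le_mul_left _ h
    _ = _ := by ring

lemma windowSize_le {n : ℕ} (hn : 2 ≤ n) : windowSize n ≤ n ^ 25 := by
  have h1 : 10 ^ 7 ≤ n ^ 24 := le_trans (by norm_num) (Nat.pow_le_pow_left hn 24)
  calc windowSize n ≤ n ^ 24 * n := Nat.mul_le_mul h1 (Nat.log_lt_self 2 (by omega))
    _ = n ^ 25 := by ring

lemma add_one_le_pow {n x k : ℕ} (hn : 2 ≤ n) (h : x ≤ n ^ k) : x + 1 ≤ n ^ (k + 1) := by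
  have h1 := Nat.one_le_pow k n (by omega)
  calc x + 1 ≤ n ^ k * 2 := by omega
    _ ≤ n ^ k * n := Nat.mul_le_mul_left _ hn
    _ = n ^ (k + 1) := (pow_succ n k).symm

lemma le_two_pow_mul_log {n x e b : ℕ} (hn : 2 ≤ n) (hx : x ≤ n ^ e) (he : e ≤ b) :
    x ≤ 2 ^ (b * (Nat.log 2 n + 1)) := by
  calc x ≤ n ^ b := hx.trans (Nat.pow_le_pow_right (by omega) he)
    _ ≤ (2 ^ (Nat.log 2 n + 1)) ^ b :=
        Nat.pow_le_pow_left (Nat.lt_pow_succ_log_self (by norm_num) n).le _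
    _ = _ := by rw [← pow_mul, mul_comm]

/-- The message size, as a multiple of the logarithm of the number of nodes; the summands are
exponents of `n` that bound the numbers of different messages in the rounds of the algorithm. -/
def messageWords (D γ κ : ℕ) : ℕ :=
  4 * D + (γ + 1) * (2 * D) + (γ + 2) * (2 * D * (2 * D)) + 4 * D + 54 * κ + 54 * (2 * D * κ)
    + γ + 13

/-- There is a power of two in the range needed for the number of hash values. -/
lemma exists_two_pow (D : ℕ) {n : ℕ} (hn : 2 ≤ n) :
    ∃ m, m ≠ 0 ∧ 4 ∣ 2 ^ m ∧ n ^ 3 ≤ 2 ^ m ∧ 1000 * (D * n) ≤ 2 ^ m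
      ∧ 2 ^ m ≤ n ^ (2 * (D + 13)) := by
  refine ⟨(Nat.log 2 n + 1) * (D + 13), by positivity, ?_, ?_, ?_, ?_⟩
  · exact pow_dvd_pow 2 (m := 2) (by nlinarith)
  all_goals rw [pow_mul]
  · exact (Nat.pow_le_pow_right (by omega) (by omega)).trans
      (Nat.pow_le_pow_left (Nat.lt_pow_succ_log_self (by norm_num) n).le (D + 13))
  · refine le_trans ?_ (Nat.pow_le_pow_left (Nat.lt_pow_succ_log_self (by norm_num) n).le (D + 13))
    have h1 : D ≤ n ^ D := Nat.lt_two_pow_self.le.trans (Nat.pow_le_pow_left hn D)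
    have h2 : 1000 ≤ n ^ 12 := le_trans (by norm_num) (Nat.pow_le_pow_left hn 12)
    calc 1000 * (D * n) ≤ n ^ 12 * (n ^ D * n) :=
          Nat.mul_le_mul h2 (Nat.mul_le_mul_right _ h1)
      _ = n ^ (D + 13) := by ring
  · rw [pow_mul]
    refine Nat.pow_le_pow_left ?_ _
    calc 2 ^ (Nat.log 2 n + 1) = 2 ^ Nat.log 2 n * 2 := pow_succ _ _
      _ ≤ n * n := Nat.mul_le_mul (Nat.pow_log_le_self 2 (by omega)) hn
      _ = n ^ 2 := (sq n).symm

variable {n D γ C : ℕ}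

/-- The algorithm for the sample spaces at hand, with messages of logarithmic size. -/
lemma exists_small_protocol {M : ℕ} (hn : 2 ≤ n)
    (F : Fin (n ^ (γ + 8)) → Fin n × Fin (windowSize n) → Fin M)
    (ω : Fin (n ^ (γ + 10)) → Fin n → Fin (windowSize n)) {κ : ℕ}
    (hκ : windowSize n * (heavyBound n * windowSize n + 1) ≤ κ * Nat.sqrt n) :
    ∃ (a₁ a₂ : Instance n D γ → Fin (n ^ (γ + 8))) (b : Instance n D γ → Fin (n ^ (γ + 10))),
      Knows (messageWords D γ κ * (Nat.log 2 n + 1)) Instance.loc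
        (7 + 4 * (γ + 8) + 2 * (γ + 10)) (fun i _ => (a₁ i, a₂ i, b i)) ∧
      ∀ i, n ^ (γ + 8) * ∑ v, nomCost (i.N C) i.Ψ C F v (a₁ i)
          ≤ ∑ a, ∑ v, nomCost (i.N C) i.Ψ C F v a ∧
        n ^ (γ + 8) * ∑ v, windowCost (i.N C) i.Ψ (i.pk C (F (a₁ i))) C (1 / (n : ℝ) ^ 2)
            (heavyBound n) F v (a₂ i)
          ≤ ∑ a, ∑ v, windowCost (i.N C) i.Ψ (i.pk C (F (a₁ i))) C (1 / (n : ℝ) ^ 2)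
            (heavyBound n) F v a ∧
        n ^ (γ + 10) * ∑ v, colCost (i.N C) i.Ψ (i.pk C (F (a₁ i))) C (heavyBound n) (F (a₂ i)) ω v
            (b i)
          ≤ ∑ s, ∑ v, colCost (i.N C) i.Ψ (i.pk C (F (a₁ i))) C (heavyBound n) (F (a₂ i)) ω v
            s := by
  have hn0 : 0 < n := by omega
  have : NeZero (n ^ (γ + 8)) := ⟨(pow_pos hn0 _).ne'⟩
  have : NeZero (n ^ (γ + 10)) := ⟨(pow_pos hn0 _).ne'⟩
  have hn1 : n + 1 ≤ n ^ 2 := add_one_le_pow hn (k := 1) (by simp)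
  have hR := windowSize_le hn
  have hE : windowSize n * (n * windowSize n + 1) ≤ n ^ 52 := by
    calc windowSize n * (n * windowSize n + 1) ≤ n ^ 25 * n ^ 27 :=
          Nat.mul_le_mul hR (add_one_le_pow hn ((Nat.mul_le_mul_left n hR).trans_eq (by ring)))
      _ = n ^ 52 := by ring
  have hnD : (n + 1) ^ (2 * D) ≤ n ^ (4 * D) := by
    calc (n + 1) ^ (2 * D) ≤ (n ^ 2) ^ (2 * D) := Nat.pow_le_pow_left hn1 _
      _ = n ^ (4 * D) := by rw [← pow_mul]; ring_nf
  have hsel : ∀ k, n * (n ^ k * n) + 1 ≤ n ^ (k + 3) := fun k =>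
    add_one_le_pow hn (le_of_eq (by ring))
  refine exists_protocol hn0 F ω hκ le_rfl le_rfl (le_two_pow_mul_log hn (e := 1) (by simpa) ?_)
    (le_two_pow_mul_log hn hn1 ?_)
    (le_two_pow_mul_log hn (e := 4 * D + (γ + 1) * (2 * D)) ?_ ?_)
    (le_two_pow_mul_log hn (e := (γ + 2) * (2 * D * (2 * D))) ?_ ?_)
    (le_two_pow_mul_log hn (hsel _) ?_) (le_two_pow_mul_log hn (hsel _) ?_)
    (le_two_pow_mul_log hn (e := 4 * D + 53 * κ) ?_ ?_)
    (le_two_pow_mul_log hn (e := 54 * (2 * D * κ)) ?_ ?_)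
  case refine_3 =>
    rw [pow_add, pow_mul n (γ + 1)]
    exact Nat.mul_le_mul hnD (Nat.pow_le_pow_left (add_one_le_pow hn le_rfl) _)
  case refine_5 =>
    rw [pow_mul n (γ + 2)]
    refine Nat.pow_le_pow_left (add_one_le_pow hn (k := γ + 1) (le_of_eq (by ring))) _
  case refine_9 =>
    rw [pow_add, pow_mul n 53]
    exact Nat.mul_le_mul hnD (Nat.pow_le_pow_left (add_one_le_pow hn hE) _)
  case refine_11 =>
    rw [pow_mul n 54]
    exact Nat.pow_le_pow_left (add_one_le_pow hn (k := 53)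
      ((Nat.mul_le_mul_left n hE).trans_eq (by ring))) _
  all_goals
    unfold messageWords
    omega

/-- The functions that the hash family has to contain, on the domain of node identifiers:
`(a, none)` stands for the first hash values of the sample point `F a`, and `(a, some b)` for the
hash values of `F a` chosen by `ω b`.  Values outside the set of node identifiers are irrelevant. -/
noncomputable def offset {A M Na Nb R : ℕ} [NeZero R] [NeZero M]
    (F : Fin Na → Fin n × Fin R → Fin M) (ω : Fin Nb → Fin n → Fin R) (c : Fin Na × Option (Fin Nb))
    (x : Fin A) : Fin M :=
  if h : (x : ℕ) < n then F c.1 (⟨x, h⟩, c.2.elim 0 fun b => ω b ⟨x, h⟩) else 0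

/-- A `101`-wise independent family of polynomial size that contains the functions given by the two
samples. -/
lemma exists_hashFamily {m : ℕ} (hm : m ≠ 0) (h4 : 4 ∣ 2 ^ m) (hn : 2 ≤ n) (h3 : n ^ 3 ≤ 2 ^ m)
    (hle : 2 ^ m ≤ n ^ (2 * (D + 13))) (R : ℕ) [NeZero R]
    (F : Fin (n ^ (γ + 8)) → Fin n × Fin R → Fin (2 ^ m)) (ω : Fin (n ^ (γ + 10)) → Fin n → Fin R) :
    ∃ (S : ℕ) (H : Fin S → Fin (2 ^ m) → Fin (2 ^ m)),
      IsPolyHashFamily 101 n (202 * (D + 13) + 2 * γ + 19) H ∧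
      ∀ c, ∃ s, H s = offset F ω c := by
  have hn0 : 0 < n := by omega
  let e : Fin (n ^ (γ + 8)) × Option (Fin (n ^ (γ + 10)))
      ≃ Fin (n ^ (γ + 8) * (n ^ (γ + 10) + 1)) :=
    Fintype.equivFinOfCardEq (by simp)
  obtain ⟨H, hH, hoff⟩ := exists_kWiseIndependent_containing 101 m
    (n ^ (γ + 8) * (n ^ (γ + 10) + 1)) hm (by positivity) (fun c => offset F ω (e.symm c))
  refine ⟨_, H, ⟨?_, ?_, h3, ?_, h4, ?_, hH⟩, fun c => ?_⟩
  · exact (Nat.le_self_pow (by norm_num) n).trans h3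
  · exact hle.trans (Nat.pow_le_pow_right hn0 (by omega))
  · exact hle.trans (Nat.pow_le_pow_right hn0 (by omega))
  · calc (2 ^ m) ^ 101 * (n ^ (γ + 8) * (n ^ (γ + 10) + 1))
        ≤ (n ^ (2 * (D + 13))) ^ 101 * (n ^ (γ + 8) * n ^ (γ + 11)) :=
          Nat.mul_le_mul (Nat.pow_le_pow_left hle _)
            (Nat.mul_le_mul_left _ (add_one_le_pow hn le_rfl))
      _ = n ^ (202 * (D + 13) + 2 * γ + 19) := by
        rw [← pow_mul, ← pow_add, ← pow_add]; congr 1; ring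
  · obtain ⟨s, hs⟩ := hoff (e c)
    exact ⟨s, by rw [hs, e.symm_apply_apply]⟩

end Parameters

end TrialDerandomization

open TrialDerandomization in
theorem mainTheorem4 :
    ∃ C₀ K : ℕ, ∀ D γ : ℕ, ∃ q b R : ℕ, ∀ n : ℕ, 2 ≤ n →
      ∃ (S A M : ℕ) (H : Fin S → Fin A → Fin M) (hH : IsPolyHashFamily 101 n q H),
        ∀ C : ℕ, C₀ ≤ C →
          ∃ P : CliqueAlgorithm n (b * (Nat.log 2 n + 1))
              (Finset (Fin n) × Finset ℕ) (Fin S × Fin S),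
            ∀ (G : SimpleGraph (Fin n)) (Ψ : Fin n → Finset ℕ), IsSqrtInstance n D γ G Ψ →
              ∃ s₁ s₂ : Fin S,
                (∀ v : Fin n, P.outputAfter (localInput G Ψ) R v = (s₁, s₂)) ∧
                sizeF hH.le_domain G Ψ C (H s₁) (H s₂) ≤ K * n := by
  -- The nodes pay at most `49 n` in the nomination step and at most `14000 n` in the coloring step.
  refine ⟨10 ^ 10, 15000, fun D γ => ⟨202 * (D + 13) + 2 * γ + 19,
    messageWords D γ (256 * 10 ^ 16), 7 + 4 * (γ + 8) + 2 * (γ + 10), fun n hn => ?_⟩⟩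
  have hn0 : 0 < n := by omega
  have : NeZero (n ^ (γ + 8)) := ⟨(pow_pos hn0 _).ne'⟩
  have : NeZero (n ^ (γ + 10)) := ⟨(pow_pos hn0 _).ne'⟩
  obtain ⟨m, hm, h4, h3, hMD, hle⟩ := exists_two_pow D hn
  obtain ⟨F, ω, hFω⟩ := exists_goodSamples γ hn h4
  obtain ⟨S, H, hH, hoff⟩ := exists_hashFamily (D := D) hm h4 hn h3 hle _ F ω
  choose s hs using hoff
  refine ⟨S, _, _, H, hH, fun C hC => ?_⟩
  obtain ⟨a₁, a₂, b, hknow, hsel⟩ := exists_small_protocol (D := D) (γ := γ) (C := C) hn F ω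
    (card_conflicts_bound hn0)
  obtain ⟨P, hP⟩ := hknow.map fun _ z => (s (z.1, none), s (z.2.1, some z.2.2))
  -- `h₁` takes the first hash values of one sample point; `h₂` takes hash values of another one, at
  -- the places chosen by `ω`.
  refine ⟨P, fun G Ψ hI => ?_⟩
  let i : Instance n D γ := ⟨(G, Ψ), hI⟩
  obtain ⟨hsel₁, hsel₂, hsel₃⟩ := hsel i
  refine ⟨s (a₁ i, none), s (a₂ i, some (b i)), fun v => hP i v, ?_⟩
  have h1 := i.sizeF_le_cost (F := F) (ω := ω) hH.le_domain hC (H (s (a₁ i, none)))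
    (H (s (a₂ i, some (b i)))) (a₁ i) (a₂ i) (b i)
    (fun v => by simp [hs, offset]) (fun v => by simp [hs, offset])
  have h2 := i.sum_nomCost_le hFω hn _ hsel₁
  have h5 := i.sum_colCost_le hFω hn _ _ _
    (fun v hv => i.windowsGood_of_cost hFω hn hC hMD _ _ hsel₂ hv) hsel₃
  have h6 : ((sizeF hH.le_domain G Ψ C (H (s (a₁ i, none))) (H (s (a₂ i, some (b i)))) : ℕ) : ℝ)
      ≤ ((15000 * n : ℕ) : ℝ) := by
    refine (Nat.cast_le.2 h1).trans ?_
    push_cast at h2 h5 ⊢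
    have : (0 : ℝ) ≤ n := Nat.cast_nonneg n
    linarith
  exact_mod_cast h6
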